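/- **Setting.** Let $E$ be a locally compact separable metric space, $m$ a Radon measure on $E$ with full support, and $(\mathscr E,\mathscr F)$ a regular (symmetric) Dirichlet form on $L^2(E,m)$. Let $\mu\neq 0$ be a finite positive Borel measure on $E$ that is smooth, i.e. charges no $\mathscr E$-polar set (set of zero $1$-capacity), and put $|\mu|=\mu(E)$. Functions are always represented by their $\mathscr E$-quasi-continuous versions. The snapping-out form $(\mathscr E^{\mathrm s},\mathscr F^{\mathrm s})$ is $$\mathscr F^{\mathrm s}=\Big\{u\in\mathscr F:\ \int_{E\times E}(u(x)-u(y))^2\,\mu(dx)\mu(dy)<\infty\Big\},$$ $$\mathscr E^{\mathrm s}(u,v)=\mathscr E(u,v)+\frac1{2|\mu|}\int_{E\times E}(u(x)-u(y))(v(x)-v(y))\,\mu(dx)\mu(dy),\qquad u,v\in\mathscr F^{\mathrm s}.$$ For a form $(\mathscr A,\mathscr D)$ on $L^2(E,m)$ the extended Dirichlet space consists of the $m$-a.e. finite functions that are $m$-a.e. limits of $\mathscr A$-Cauchy sequences in $\mathscr D$. Let $(G_\alpha)_{\alpha>0}$ be its resolvent, i.e. $G_\alpha f\in\mathscr D$ and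 $\mathscr A(G_\alpha f,v)+\alpha (G_\alpha f,v)_m=(f,v)_m$ for all $v\in\mathscr D$, and let $Gf=\lim_{\alpha\downarrow0}G_\alpha f\in[0,\infty]$ for $0\le f\in L^2(E,m)$. The form is *transient* if $Gg<\infty$ $m$-a.e. for some $g\in L^1(E,m)\cap L^2(E,m)$ with $g>0$ $m$-a.e.; *recurrent* if for every $f\in L^1(E,m)\cap L^2(E,m)$ with $f\ge0$ one has $Gf\in\{0,\infty\}$ $m$-a.e.; *irreducible* if every measurable set $A$ with $G_\alpha(1_Af)=1_A\,G_\alpha f$ $m$-a.e. for all $\alpha>0$ and $f\in L^2(E,m)$ satisfies $m(A)=0$ or $m(E\setminus A)=0$. It is *local* if $\mathscr A(u,v)=0$ whenever $u,v\in\mathscr D$ have disjoint compact supports. **Proposition.** Let $\mathscr F_{\mathrm e}$ and $\mathscr F^{\mathrm s}_{\mathrm e}$ be the extended Dirichlet spaces of $(\mathscr E,\mathscr F)$ and $(\mathscr E^{\mathrm s},\mathscr F^{\mathrm s})$. Then $$\mathscr F^{\mathrm s}_{\mathrm e}=\Big\{u\in\mathscr F_{\mathrm e}:\ \int_{E\times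 E}(u(x)-u(y))^2\,\mu(dx)\mu(dy)<\infty\Big\}.$$ Moreover: 1. $(\mathscr E,\mathscr F)$ is recurrent if and only if $(\mathscr E^{\mathrm s},\mathscr F^{\mathrm s})$ is recurrent. 2. If $(\mathscr E,\mathscr F)$ is transient, then $(\mathscr E^{\mathrm s},\mathscr F^{\mathrm s})$ is transient. If $(\mathscr E,\mathscr F)$ is irreducible and $(\mathscr E^{\mathrm s},\mathscr F^{\mathrm s})$ is transient, then $(\mathscr E,\mathscr F)$ is transient. 3. If $(\mathscr E,\mathscr F)$ is recurrent or local, and irreducible, then $(\mathscr E^{\mathrm s},\mathscr F^{\mathrm s})$ is irreducible. -/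

import Mathlib

open MeasureTheory Filter Topology
open scoped ENNReal

noncomputable section

/-- The data of a (not yet assumed bilinear, closed, ...) form on `L²(E, m)`: a domain `𝓕` and a
function `(u, v) ↦ 𝓔(u, v)`, of which only the values at `u, v ∈ 𝓕` matter. -/
structure L2Form {E : Type*} [MeasurableSpace E] (m : Measure E) where
  domain : Set (Lp ℝ 2 m)
  toFun : Lp ℝ 2 m → Lp ℝ 2 m → ℝ

namespace L2Form

section Basic

variable {E : Type*} [MeasurableSpace E] {m : Measure E}

/-- `𝓔_α(u, v) = 𝓔(u, v) + α (u, v)_m`. -/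
def order (D : L2Form m) (α : ℝ) (u v : Lp ℝ 2 m) : ℝ :=
  D.toFun u v + α * inner ℝ u v

/-- `(𝓔, 𝓕)` is a (symmetric) Dirichlet form on `L²(E, m)`: a densely defined nonnegative
symmetric bilinear form which is closed (`𝓕` is complete for `𝓔₁`) and Markovian (the unit
contraction operates on it). -/
structure IsDirichletForm (D : L2Form m) : Prop where
  zero_mem : (0 : Lp ℝ 2 m) ∈ D.domain
  add_mem : ∀ u ∈ D.domain, ∀ v ∈ D.domain, u + v ∈ D.domain
  smul_mem : ∀ (c : ℝ), ∀ u ∈ D.domain, c • u ∈ D.domain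
  dense : Dense D.domain
  add_left : ∀ u ∈ D.domain, ∀ v ∈ D.domain, ∀ w ∈ D.domain,
    D.toFun (u + v) w = D.toFun u w + D.toFun v w
  smul_left : ∀ (c : ℝ), ∀ u ∈ D.domain, ∀ v ∈ D.domain, D.toFun (c • u) v = c * D.toFun u v
  symm : ∀ u ∈ D.domain, ∀ v ∈ D.domain, D.toFun u v = D.toFun v u
  nonneg : ∀ u ∈ D.domain, 0 ≤ D.toFun u u
  closed : ∀ u : ℕ → Lp ℝ 2 m, (∀ n, u n ∈ D.domain) →
    (∀ ε > 0, ∃ N, ∀ n ≥ N, ∀ k ≥ N, D.order 1 (u n - u k) (u n - u k) < ε) →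
    ∃ v ∈ D.domain, Tendsto (fun n => D.order 1 (u n - v) (u n - v)) atTop (𝓝 0)
  markov : ∀ u ∈ D.domain, ∀ v : Lp ℝ 2 m, (∀ᵐ x ∂m, v x = max 0 (min (u x) 1)) →
    v ∈ D.domain ∧ D.toFun v v ≤ D.toFun u u

/-- The extended Dirichlet space `𝓕_e`: the (classes of) `m`-a.e. finite functions `u` that are
`m`-a.e. limits of an `𝓔`-Cauchy sequence in `𝓕`. -/
def extendedSpace (D : L2Form m) : Set (E →ₘ[m] ℝ) :=
  {u | ∃ w : ℕ → Lp ℝ 2 m, (∀ n, w n ∈ D.domain) ∧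
    (∀ ε > 0, ∃ N, ∀ n ≥ N, ∀ k ≥ N, D.toFun (w n - w k) (w n - w k) < ε) ∧
    ∀ᵐ x ∂m, Tendsto (fun n => w n x) atTop (𝓝 (u x))}

/-- `w = G_α f`: `w ∈ 𝓕` and `𝓔_α(w, v) = (f, v)_m` for all `v ∈ 𝓕`. -/
def IsResolvent (D : L2Form m) (α : ℝ) (f w : Lp ℝ 2 m) : Prop :=
  w ∈ D.domain ∧ ∀ v ∈ D.domain, D.order α w v = inner ℝ f v

open Classical in
/-- The resolvent operator `G_α`, `α > 0` (for a Dirichlet form, `G_α f` exists and is unique). -/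
def resolvent (D : L2Form m) (α : ℝ) (f : Lp ℝ 2 m) : Lp ℝ 2 m :=
  if h : ∃ w, D.IsResolvent α f w then h.choose else 0

/-- The potential `G f = ∫₀^∞ T_t f dt = lim_{α ↓ 0} G_α f ∈ [0, ∞]` of a nonnegative `f`;
`G_α f` increases, `m`-a.e., as `α` decreases, so that the limit is a supremum. -/
def potential (D : L2Form m) (f : Lp ℝ 2 m) (x : E) : ℝ≥0∞ :=
  ⨆ n : ℕ, ENNReal.ofReal (D.resolvent (1 / ((n : ℝ) + 1)) f x)

/-- Transience: `G g < ∞` a.e. for some integrable `g` with `g > 0` a.e. (Replacing `g` by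
`min g 1`, one may take `g` in `L²` as well.) -/
def IsTransient (D : L2Form m) : Prop :=
  ∃ g : Lp ℝ 2 m, Integrable g m ∧ (∀ᵐ x ∂m, 0 < g x) ∧ ∀ᵐ x ∂m, D.potential g x < ∞

/-- Recurrence: for every integrable `f ≥ 0`, a.e. `G f = 0` or `G f = ∞`. (A nonnegative
integrable function is an increasing limit of nonnegative functions in `L¹ ∩ L²`.) -/
def IsRecurrent (D : L2Form m) : Prop :=
  ∀ f : Lp ℝ 2 m, Integrable f m → (∀ᵐ x ∂m, 0 ≤ f x) →
    ∀ᵐ x ∂m, D.potential f x = 0 ∨ D.potential f x = ∞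

/-- Invariance of a set `A`: `G_α (1_A f) = 1_A G_α f` a.e. for all `α > 0` and `f ∈ L²(E, m)`
(equivalently, `T_t (1_A f) = 1_A T_t f` for all `t > 0`). -/
def IsInvariant (D : L2Form m) (A : Set E) : Prop :=
  ∀ α > 0, ∀ f g : Lp ℝ 2 m, (∀ᵐ x ∂m, g x = A.indicator f x) →
    ∀ᵐ x ∂m, D.resolvent α g x = A.indicator (D.resolvent α f) x

/-- Irreducibility: every invariant set is null or conull. -/
def IsIrreducible (D : L2Form m) : Prop :=
  ∀ A : Set E, MeasurableSet A → D.IsInvariant A → m A = 0 ∨ m Aᶜ = 0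

end Basic

section Topological

variable {E : Type*} [TopologicalSpace E] [MeasurableSpace E] {m : Measure E}

/-- Regularity: `𝓕 ∩ C_c(E)` is `𝓔₁`-dense in `𝓕` and uniformly dense in `C_c(E)`. -/
def IsRegular (D : L2Form m) : Prop :=
  (∀ u ∈ D.domain, ∀ ε > 0, ∃ v ∈ D.domain,
    (∃ f : E → ℝ, Continuous f ∧ HasCompactSupport f ∧ ∀ᵐ x ∂m, v x = f x) ∧
      D.order 1 (u - v) (u - v) < ε) ∧
  (∀ f : E → ℝ, Continuous f → HasCompactSupport f → ∀ ε > 0,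
    ∃ g : E → ℝ, Continuous g ∧ HasCompactSupport g ∧
      (∃ v ∈ D.domain, ∀ᵐ x ∂m, v x = g x) ∧ ∀ x, |f x - g x| < ε)

/-- The support of the class `u`, i.e. of the measure `|u| dm`: the complement of the largest open
set on which `u = 0` a.e. -/
def essSupport (u : Lp ℝ 2 m) : Set E :=
  {x | ∀ U ∈ 𝓝 x, m {y ∈ U | u y ≠ 0} ≠ 0}

/-- Locality: `𝓔(u, v) = 0` for all `u, v ∈ 𝓕` with disjoint compact supports. -/
def IsLocal (D : L2Form m) : Prop :=
  ∀ u ∈ D.domain, ∀ v ∈ D.domain, IsCompact (essSupport u) → IsCompact (essSupport v) →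
    Disjoint (essSupport u) (essSupport v) → D.toFun u v = 0

/-- The 1-capacity of an open set `U`: the infimum of `𝓔₁(u, u)` over `u ∈ 𝓕` with `u ≥ 1` a.e. on
`U` (and `∞` if there is no such `u`). -/
def capOpen (D : L2Form m) (U : Set E) : ℝ≥0∞ :=
  ⨅ u : {u : Lp ℝ 2 m // u ∈ D.domain ∧ ∀ᵐ x ∂m, x ∈ U → 1 ≤ u x},
    ENNReal.ofReal (D.order 1 u.1 u.1)

/-- The 1-capacity of an arbitrary set. The `𝓔`-polar sets are those of capacity zero. -/
def cap (D : L2Form m) (A : Set E) : ℝ≥0∞ :=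
  ⨅ U : {U : Set E // IsOpen U ∧ A ⊆ U}, D.capOpen U.1

/-- `f` is `𝓔`-quasi-continuous: it is continuous outside open sets of arbitrarily small
capacity. -/
def QuasiContinuous (D : L2Form m) (f : E → ℝ) : Prop :=
  ∀ ε : ℝ≥0∞, 0 < ε → ∃ U : Set E, IsOpen U ∧ D.cap U < ε ∧ ContinuousOn f Uᶜ

open Classical in
/-- The quasi-continuous version of `u` (for a regular Dirichlet form and `u` in its extended
Dirichlet space it exists and is unique up to an `𝓔`-polar set). -/
def qcVersion (D : L2Form m) (u : E →ₘ[m] ℝ) : E → ℝ :=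
  if h : ∃ f : E → ℝ, D.QuasiContinuous f ∧ ∀ᵐ x ∂m, f x = u x then h.choose else u

/-- A finite measure is smooth if it charges no `𝓔`-polar set. -/
def ChargesNoPolarSet (D : L2Form m) (μ : Measure E) : Prop :=
  ∀ A : Set E, D.cap A = 0 → μ A = 0

/-- `∬ (u(x) - u(y))² μ(dx) μ(dy) ∈ [0, ∞]`, with the quasi-continuous version of `u`. -/
def jumpEnergy (D : L2Form m) (μ : Measure E) (u : E →ₘ[m] ℝ) : ℝ≥0∞ :=
  ∫⁻ z, ENNReal.ofReal ((D.qcVersion u z.1 - D.qcVersion u z.2) ^ 2) ∂(μ.prod μ)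

/-- The form `(𝓔ˢ, 𝓕ˢ)`, the Dirichlet form of the snapping out Markov process:
`𝓕ˢ = {u ∈ 𝓕 : ∬ (u(x) - u(y))² μ(dx) μ(dy) < ∞}` and
`𝓔ˢ(u, v) = 𝓔(u, v) + (2 |μ|)⁻¹ ∬ (u(x) - u(y)) (v(x) - v(y)) μ(dx) μ(dy)`. -/
def snappingOut (D : L2Form m) (μ : Measure E) : L2Form m where
  domain := {u | u ∈ D.domain ∧ D.jumpEnergy μ (u : E →ₘ[m] ℝ) < ∞}
  toFun u v := D.toFun u v + 1 / (2 * μ.real Set.univ) *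
    ∫ z, (D.qcVersion (u : E →ₘ[m] ℝ) z.1 - D.qcVersion (u : E →ₘ[m] ℝ) z.2) *
      (D.qcVersion (v : E →ₘ[m] ℝ) z.1 - D.qcVersion (v : E →ₘ[m] ℝ) z.2) ∂(μ.prod μ)

end Topological

end L2Form

end

/-! ### Quadratic inequalities and convergence in `L²` -/

noncomputable section

/-! The energy only grows, `𝓔 ≤ 𝓔ˢ` on `𝓕ˢ ⊆ 𝓕`, so everything that passes from `𝓔ˢ` to `𝓔` by
domination is immediate. For the converse, the jump term must be controlled by `𝓔`. Since `μ` is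
finite, bounded functions of `𝓕` lie in `𝓕ˢ`, and an `L²(μ)`-error controls the jump integral
(`jumpIntegral_le_add`). The decisive fact is `exists_convexHull_lintegral_lt`: if a uniformly
bounded, energy bounded sequence converges `m`-a.e., then convex combinations of its tails converge
in `L²(μ)` to a quasi-continuous version of the limit. To see this, cut the sequence off locally so
that it converges in `L²(m)`. The Banach-Saks property gives `𝓔₁`-convergence of convex
combinations, hence convergence quasi-everywhere along a subsequence, hence `μ`-a.e. because `μ`
charges no polar set. Dominated convergence does the rest, and the finiteness of `μ` makes the part
outside the cutoff negligible.

Extended space. Truncate at level `k`, apply this fact with error `1`, and obtain jump bounds that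
do not depend on `k`. Letting `k → ∞`, Fatou's lemma gives one inclusion. A diagonal sequence
bounded in `𝓔ˢ` gives the other, because boundedness may replace the Cauchy property
(`mem_extendedSpace_of_energy_le`). Quasi-continuous versions of functions in `𝓕_e` are glued from
those of their local truncations.

Recurrence is equivalent to `ApproximatesOne`: the constant `1` is an a.e. limit of functions of
arbitrarily small energy. By the decisive fact with limit `1`, whose jump integral is zero, this
property is shared by both forms (`approximatesOne_snappingOut_iff`).

Transience passes to the larger form because `(g, Gˢ_α g) ≤ (g, G_α g)`, by Cauchy-Schwarz for
`𝓔_α`. Conversely, an irreducible form is transient or recurrent, since the set where the potential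
of a positive function is infinite is invariant. If `𝓔` is recurrent then so is `𝓔ˢ`, which excludes
transience of `𝓔ˢ`.

Irreducibility: let `A` be invariant for `𝓔ˢ`, and let `a, b ≥ 0` in `𝓕ˢ` live on `A` and on its
complement. Then `𝓔ˢ(a, b) = 0`, while both `𝓔(a, b)` and the jump part are nonpositive, so both
vanish. Thus `1_A` operates on `𝓔` over `𝓕ˢ`, and by density over `𝓕`: `A` is invariant for `𝓔`
(`isInvariant_of_snappingOut`). -/

lemma sq_le_mul_of_forall_quadratic_nonneg {a b c : ℝ}
    (h : ∀ t : ℝ, 0 ≤ a + 2 * t * b + t ^ 2 * c) : b ^ 2 ≤ a * c := by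
  have := discrim_le_zero (a := c) (b := 2 * b) (c := a) fun t => by linarith [h t]
  unfold discrim at this
  linarith

/-- As `t ↓ 0` the linear term dominates. This extracts first-order information from one-sided
variations of an energy. -/
lemma nonneg_of_forall_quadratic_nonneg {b c : ℝ} (h : ∀ t : ℝ, 0 < t → 0 ≤ t * b + t ^ 2 * c) :
    0 ≤ b := by
  by_contra! hb
  have hc : 0 < |c| + 1 := by positivity
  -- This `t` is small enough that `t * c ≤ -b / 2`, so the quadratic term cannot compensate the
  -- negative linear one.
  have ht : 0 < -b / (2 * (|c| + 1)) := by
    apply div_pos <;> linarith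
  have h1 := h _ ht
  set t := -b / (2 * (|c| + 1)) with htdef
  have h2 : 0 ≤ b + t * c := by
    by_contra! h3
    nlinarith
  have h3 : t * c ≤ t * (|c| + 1) := by
    have := le_abs_self c
    gcongr
    linarith
  have h4 : t * (|c| + 1) = -b / 2 := by
    rw [htdef]; field_simp
  linarith

namespace MeasureTheory.Lp

variable {E : Type*} [MeasurableSpace E] {m : Measure E}

lemma real_inner_eq_integral (u v : Lp ℝ 2 m) : inner ℝ u v = ∫ x, u x * v x ∂m := by
  rw [L2.inner_def]
  exact integral_congr_ae (.of_forall fun x => by simp [mul_comm])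

lemma integrable_mul_coeFn (u v : Lp ℝ 2 m) : Integrable (fun x => u x * v x) m :=
  (Lp.memLp u).integrable_mul (Lp.memLp v)

lemma norm_sq_eq_integral (u : Lp ℝ 2 m) : ‖u‖ ^ 2 = ∫ x, u x ^ 2 ∂m := by
  rw [← real_inner_self_eq_norm_sq, real_inner_eq_integral]
  simp only [sq]

lemma inner_nonneg_of_ae_nonneg {u v : Lp ℝ 2 m} (hu : ∀ᵐ x ∂m, 0 ≤ u x)
    (hv : ∀ᵐ x ∂m, 0 ≤ v x) : 0 ≤ inner ℝ u v := by
  rw [real_inner_eq_integral]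
  apply integral_nonneg_of_ae
  filter_upwards [hu, hv] with x h1 h2 using mul_nonneg h1 h2

lemma exists_coeFn_ae_eq_of_abs_le (h : Lp ℝ 2 m) {f : E → ℝ} (hf : AEStronglyMeasurable f m)
    (hle : ∀ᵐ x ∂m, |f x| ≤ |h x|) : ∃ v : Lp ℝ 2 m, ∀ᵐ x ∂m, v x = f x :=
  ⟨((Lp.memLp h).of_le hf hle).toLp f, MemLp.coeFn_toLp _⟩

lemma tendsto_of_ae_tendsto_of_abs_le {v : ℕ → Lp ℝ 2 m} {u h : Lp ℝ 2 m}
    (hle : ∀ n, ∀ᵐ x ∂m, |v n x| ≤ |h x|)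
    (hlim : ∀ᵐ x ∂m, Tendsto (fun n => v n x) atTop (𝓝 (u x))) :
    Tendsto v atTop (𝓝 u) := by
  rw [tendsto_iff_norm_sub_tendsto_zero]
  have hu : ∀ᵐ x ∂m, |u x| ≤ |h x| := by
    filter_upwards [ae_all_iff.2 hle, hlim] with x h1 h2
    exact le_of_tendsto h2.abs (.of_forall h1)
  have key : Tendsto (fun n => ∫ x, (v n - u) x ^ 2 ∂m) atTop (𝓝 (∫ _, 0 ∂m)) := by
    refine tendsto_integral_of_dominated_convergence (fun x => 4 * (h x * h x)) (fun n => ?_)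
      ((integrable_mul_coeFn h h).const_mul 4) (fun n => ?_) ?_
    · exact (Lp.aestronglyMeasurable _).pow 2
    · filter_upwards [hle n, hu, Lp.coeFn_sub (v n) u] with x h1 h2 h3
      rw [h3, Pi.sub_apply, Real.norm_eq_abs, abs_of_nonneg (sq_nonneg _), ← sq_abs]
      have h4 : |v n x - u x| ≤ 2 * |h x| := (abs_sub _ _).trans (by linarith)
      have h5 := abs_nonneg (v n x - u x)
      have h6 := abs_mul_abs_self (h x)
      nlinarith
    · have h3 : ∀ n, ∀ᵐ x ∂m, (v n - u) x = v n x - u x := fun n => Lp.coeFn_sub _ _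
      filter_upwards [hlim, ae_all_iff.2 h3] with x h1 h2
      simp only [h2]
      simpa using (h1.sub_const (u x)).pow 2
  rw [integral_zero] at key
  have := key.sqrt
  simp only [← norm_sq_eq_integral, Real.sqrt_zero, Real.sqrt_sq (norm_nonneg _)] at this
  exact this

lemma exists_subseq_ae_tendsto {v : ℕ → Lp ℝ 2 m} {u : Lp ℝ 2 m} (h : Tendsto v atTop (𝓝 u)) :
    ∃ ns : ℕ → ℕ, StrictMono ns ∧ ∀ᵐ x ∂m, Tendsto (fun k => v (ns k) x) atTop (𝓝 (u x)) :=
  (tendstoInMeasure_of_tendsto_Lp h).exists_seq_tendsto_ae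

lemma ae_mem_convexHull {v : ℕ → Lp ℝ 2 m} {N : ℕ} {c : Lp ℝ 2 m}
    (hc : c ∈ convexHull ℝ (v '' Set.Ici N)) :
    ∀ᵐ x ∂m, c x ∈ convexHull ℝ ((fun n => v n x) '' Set.Ici N) := by
  have hconv : Convex ℝ {c : Lp ℝ 2 m | ∀ᵐ x ∂m,
      c x ∈ convexHull ℝ ((fun n => v n x) '' Set.Ici N)} := by
    intro c hc d hd a b ha hb hab
    simp only [Set.mem_ofPred_eq] at hc hd ⊢
    filter_upwards [hc, hd, Lp.coeFn_add (a • c) (b • d), Lp.coeFn_smul a c, Lp.coeFn_smul b d]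
      with x h1 h2 h3 h4 h5
    rw [h3, Pi.add_apply, h4, h5]
    exact convex_convexHull ℝ _ h1 h2 ha hb hab
  refine convexHull_min ?_ hconv hc
  rintro _ ⟨n, hn, rfl⟩
  refine Set.mem_ofPred_eq ▸ .of_forall fun x => ?_
  exact subset_convexHull ℝ _ (Set.mem_image_of_mem (fun n => v n x) hn)

/-- Balls are convex, so combinations of a tail stay in every ball that contains the tail. Passing
to convex combinations of tails therefore costs nothing pointwise. -/
lemma ae_tendsto_of_mem_convexHull {v c : ℕ → Lp ℝ 2 m} {u : E → ℝ}
    (hc : ∀ n, c n ∈ convexHull ℝ (v '' Set.Ici n))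
    (hlim : ∀ᵐ x ∂m, Tendsto (fun n => v n x) atTop (𝓝 (u x))) :
    ∀ᵐ x ∂m, Tendsto (fun n => c n x) atTop (𝓝 (u x)) := by
  filter_upwards [hlim, ae_all_iff.2 fun n => ae_mem_convexHull (hc n)] with x h1 h2
  rw [Metric.tendsto_atTop] at h1 ⊢
  intro ε hε
  obtain ⟨N, hN⟩ := h1 ε hε
  refine ⟨N, fun n hn => ?_⟩
  refine convexHull_min ?_ (convex_ball (u x) ε) (h2 n)
  rintro _ ⟨k, hk, rfl⟩
  exact hN k (le_trans hn hk)

lemma tendsto_of_mem_convexHull {v c : ℕ → Lp ℝ 2 m} {u : Lp ℝ 2 m}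
    (hc : ∀ n, c n ∈ convexHull ℝ (v '' Set.Ici n)) (hlim : Tendsto v atTop (𝓝 u)) :
    Tendsto c atTop (𝓝 u) := by
  rw [Metric.tendsto_atTop] at hlim ⊢
  intro ε hε
  obtain ⟨N, hN⟩ := hlim ε hε
  refine ⟨N, fun n hn => ?_⟩
  refine convexHull_min ?_ (convex_ball u ε) (hc n)
  rintro _ ⟨k, hk, rfl⟩
  exact hN k (le_trans hn hk)

end MeasureTheory.Lp

/-! ### Energy, Cauchy-Schwarz and the Banach-Saks property -/

namespace L2Form

variable {E : Type*} [MeasurableSpace E] {m : Measure E} {D : L2Form m}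

/-- The quadratic form `𝓔(u) = 𝓔(u, u)`. -/
def energy (D : L2Form m) (u : Lp ℝ 2 m) : ℝ := D.toFun u u

/-- The form `𝓔_α` on `𝓕`. -/
def shift (D : L2Form m) (α : ℝ) : L2Form m := ⟨D.domain, D.order α⟩

lemma energy_shift (D : L2Form m) (α : ℝ) (u : Lp ℝ 2 m) :
    (D.shift α).energy u = D.energy u + α * ‖u‖ ^ 2 := by
  simp only [energy, shift, order, real_inner_self_eq_norm_sq]

lemma order_self (D : L2Form m) (α : ℝ) (u : Lp ℝ 2 m) :
    D.order α u u = D.energy u + α * ‖u‖ ^ 2 := energy_shift D α u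

lemma energy_le_order (D : L2Form m) {α : ℝ} (hα : 0 ≤ α) (u : Lp ℝ 2 m) :
    D.energy u ≤ D.order α u u := by
  rw [order_self]
  have : 0 ≤ α * ‖u‖ ^ 2 := by positivity
  linarith

namespace IsDirichletForm

variable {u v w : Lp ℝ 2 m}

lemma neg_mem (hD : D.IsDirichletForm) (hu : u ∈ D.domain) : -u ∈ D.domain := by
  simpa using hD.smul_mem (-1) u hu

lemma sub_mem (hD : D.IsDirichletForm)
    (hu : u ∈ D.domain) (hv : v ∈ D.domain) : u - v ∈ D.domain := by
  simpa [sub_eq_add_neg] using hD.add_mem u hu _ (hD.neg_mem hv)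

lemma add_right (hD : D.IsDirichletForm)
    (hu : u ∈ D.domain) (hv : v ∈ D.domain) (hw : w ∈ D.domain) :
    D.toFun u (v + w) = D.toFun u v + D.toFun u w := by
  rw [hD.symm _ hu _ (hD.add_mem _ hv _ hw), hD.add_left _ hv _ hw _ hu, hD.symm _ hv _ hu,
    hD.symm _ hw _ hu]

lemma smul_right (hD : D.IsDirichletForm) (c : ℝ) (hu : u ∈ D.domain) (hv : v ∈ D.domain) :
    D.toFun u (c • v) = c * D.toFun u v := by
  rw [hD.symm _ hu _ (hD.smul_mem _ _ hv), hD.smul_left _ _ hv _ hu, hD.symm _ hv _ hu]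

lemma sub_right (hD : D.IsDirichletForm)
    (hu : u ∈ D.domain) (hv : v ∈ D.domain) (hw : w ∈ D.domain) :
    D.toFun u (v - w) = D.toFun u v - D.toFun u w := by
  have h : v - w = v + (-1 : ℝ) • w := by rw [neg_one_smul, sub_eq_add_neg]
  rw [h, hD.add_right hu hv (hD.smul_mem _ _ hw), hD.smul_right _ hu hw]
  ring

lemma sub_left (hD : D.IsDirichletForm)
    (hu : u ∈ D.domain) (hv : v ∈ D.domain) (hw : w ∈ D.domain) :
    D.toFun (u - v) w = D.toFun u w - D.toFun v w := by
  rw [hD.symm _ (hD.sub_mem hu hv) _ hw, hD.sub_right hw hu hv, hD.symm _ hu _ hw,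
    hD.symm _ hv _ hw]

lemma energy_nonneg (hD : D.IsDirichletForm) (hu : u ∈ D.domain) : 0 ≤ D.energy u := hD.nonneg u hu

lemma energy_smul (hD : D.IsDirichletForm)
    (c : ℝ) (hu : u ∈ D.domain) : D.energy (c • u) = c ^ 2 * D.energy u := by
  unfold energy
  rw [hD.smul_left _ _ hu _ (hD.smul_mem _ _ hu), hD.smul_right _ hu hu]
  ring

lemma energy_zero (hD : D.IsDirichletForm) : D.energy 0 = 0 := by
  simpa using hD.energy_smul 0 hD.zero_mem

lemma energy_neg (hD : D.IsDirichletForm) (hu : u ∈ D.domain) : D.energy (-u) = D.energy u := by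
  simpa using hD.energy_smul (-1) hu

lemma energy_add (hD : D.IsDirichletForm) (hu : u ∈ D.domain) (hv : v ∈ D.domain) :
    D.energy (u + v) = D.energy u + 2 * D.toFun u v + D.energy v := by
  unfold energy
  rw [hD.add_left _ hu _ hv _ (hD.add_mem _ hu _ hv), hD.add_right hu hu hv,
    hD.add_right hv hu hv, hD.symm _ hv _ hu]
  ring

lemma energy_sub (hD : D.IsDirichletForm) (hu : u ∈ D.domain) (hv : v ∈ D.domain) :
    D.energy (u - v) = D.energy u - 2 * D.toFun u v + D.energy v := by
  unfold energy
  rw [hD.sub_left hu hv (hD.sub_mem hu hv), hD.sub_right hu hu hv,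
    hD.sub_right hv hu hv, hD.symm _ hv _ hu]
  ring

lemma energy_sub_comm (hD : D.IsDirichletForm) (hu : u ∈ D.domain) (hv : v ∈ D.domain) :
    D.energy (u - v) = D.energy (v - u) := by
  rw [hD.energy_sub hu hv, hD.energy_sub hv hu, hD.symm _ hu _ hv]
  ring

lemma energy_add_smul (hD : D.IsDirichletForm) (t : ℝ) (hu : u ∈ D.domain) (hv : v ∈ D.domain) :
    D.energy (u + t • v) = D.energy u + 2 * t * D.toFun u v + t ^ 2 * D.energy v := by
  rw [hD.energy_add hu (hD.smul_mem _ _ hv), hD.smul_right _ hu hv, hD.energy_smul _ hv]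
  ring

lemma cauchy_schwarz (hD : D.IsDirichletForm) (hu : u ∈ D.domain) (hv : v ∈ D.domain) :
    D.toFun u v ^ 2 ≤ D.energy u * D.energy v := by
  apply sq_le_mul_of_forall_quadratic_nonneg
  intro t
  rw [← hD.energy_add_smul t hu hv]
  exact hD.energy_nonneg (hD.add_mem _ hu _ (hD.smul_mem _ _ hv))

lemma energy_add_le (hD : D.IsDirichletForm) (hu : u ∈ D.domain) (hv : v ∈ D.domain) :
    D.energy (u + v) ≤ 2 * (D.energy u + D.energy v) := by
  have := hD.energy_nonneg (hD.sub_mem hu hv)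
  rw [hD.energy_sub hu hv] at this
  rw [hD.energy_add hu hv]
  linarith

lemma energy_sub_le (hD : D.IsDirichletForm) (hu : u ∈ D.domain) (hv : v ∈ D.domain) :
    D.energy (u - v) ≤ 2 * (D.energy u + D.energy v) := by
  have := hD.energy_nonneg (hD.add_mem _ hu _ hv)
  rw [hD.energy_add hu hv] at this
  rw [hD.energy_sub hu hv]
  linarith

/-- This is `𝓔(t u + (u - v)) ≥ 0` divided by `t`, combined with the expansion of `𝓔(u - (u - v))`.
-/
lemma energy_le_young (hD : D.IsDirichletForm)
    {t : ℝ} (ht : 0 < t) (hu : u ∈ D.domain) (hv : v ∈ D.domain) :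
    D.energy v ≤ (1 + t) * D.energy u + (1 + 1 / t) * D.energy (u - v) := by
  have hw := hD.sub_mem hu hv
  have h1 : v = u - (u - v) := by abel
  have h2 := hD.energy_sub hu hw
  rw [← h1] at h2
  have h3 := hD.energy_nonneg (hD.add_mem _ (hD.smul_mem t _ hu) _ hw)
  rw [hD.energy_add (hD.smul_mem t _ hu) hw, hD.smul_left _ _ hu _ hw, hD.energy_smul _ hu] at h3
  have h4 : 0 ≤ (t ^ 2 * D.energy u + 2 * (t * D.toFun u (u - v)) + D.energy (u - v)) / t :=
    div_nonneg h3 ht.le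
  have h5 : (t ^ 2 * D.energy u + 2 * (t * D.toFun u (u - v)) + D.energy (u - v)) / t
      = t * D.energy u + 2 * D.toFun u (u - v) + 1 / t * D.energy (u - v) := by
    field_simp
  linarith

lemma energy_le_of_close (hD : D.IsDirichletForm) {M : ℝ} (hv : v ∈ D.domain)
    (h : ∀ ε > 0, ∃ c ∈ D.domain, D.energy c ≤ M + ε ∧ D.energy (c - v) < ε) :
    D.energy v ≤ M := by
  have hM : 0 ≤ M := by
    refine le_of_forall_pos_le_add fun ε hε => ?_
    obtain ⟨c, hc, h1, -⟩ := h ε hε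
    exact (hD.energy_nonneg hc).trans h1
  refine le_of_forall_pos_le_add fun ε hε => ?_
  have ht : 0 < ε / (2 * (M + 1)) := by positivity
  -- With this `t` the excess `t * M` is at most `ε / 2` (the `+ 1` covers `M = 0`); `δ` then
  -- absorbs the remaining two error terms into the other half.
  set t := ε / (2 * (M + 1)) with htdef
  set δ := min 1 (ε / (2 * ((1 + t) + (1 + 1 / t)))) with hδ
  have hδ0 : 0 < δ := by positivity
  obtain ⟨c, hc, h1, h2⟩ := h δ hδ0
  have h3 := hD.energy_le_young ht hc hv
  have h4 : t * M ≤ ε / 2 := by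
    rw [htdef]
    rw [div_mul_eq_mul_div, div_le_div_iff₀ (by positivity) (by positivity)]
    nlinarith
  have h5 : δ * ((1 + t) + (1 + 1 / t)) ≤ ε / 2 := by
    have h6 : δ ≤ ε / (2 * ((1 + t) + (1 + 1 / t))) := min_le_right _ _
    calc _ ≤ ε / (2 * ((1 + t) + (1 + 1 / t))) * ((1 + t) + (1 + 1 / t)) := by gcongr
      _ = ε / 2 := by field_simp
  have h6 : (1 + t) * D.energy c ≤ (1 + t) * (M + δ) := by gcongr
  have h7 : (1 + 1 / t) * D.energy (c - v) ≤ (1 + 1 / t) * δ := by gcongr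
  nlinarith

/-- For `a + b = 1` one has `𝓔(a u + b v) = a 𝓔(u) + b 𝓔(v) - a b 𝓔(u - v)`. -/
lemma convex_energy_le (hD : D.IsDirichletForm)
    (M : ℝ) : Convex ℝ {u | u ∈ D.domain ∧ D.energy u ≤ M} := by
  rintro u ⟨hu, hu'⟩ v ⟨hv, hv'⟩ a b ha hb hab
  refine ⟨hD.add_mem _ (hD.smul_mem _ _ hu) _ (hD.smul_mem _ _ hv), ?_⟩
  have h1 := hD.energy_nonneg (hD.sub_mem hu hv)
  rw [hD.energy_sub hu hv] at h1
  rw [hD.energy_add (hD.smul_mem _ _ hu) (hD.smul_mem _ _ hv), hD.energy_smul _ hu,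
    hD.energy_smul _ hv, hD.smul_left _ _ hu _ (hD.smul_mem _ _ hv), hD.smul_right _ hu hv]
  have hb' : b = 1 - a := by linarith
  subst hb'
  have h2 : 0 ≤ a * (1 - a) * (D.energy u - 2 * D.toFun u v + D.energy v) := by positivity
  nlinarith

lemma convexHull_subset_energy_le (hD : D.IsDirichletForm)
    {v : ℕ → Lp ℝ 2 m} (hv : ∀ n, v n ∈ D.domain) {M : ℝ}
    (hM : ∀ n, D.energy (v n) ≤ M) {N : ℕ} {c : Lp ℝ 2 m}
    (hc : c ∈ convexHull ℝ (v '' Set.Ici N)) : c ∈ D.domain ∧ D.energy c ≤ M := by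
  refine convexHull_min ?_ (hD.convex_energy_le M) hc
  rintro _ ⟨n, -, rfl⟩
  exact ⟨hv n, hM n⟩

/-- An energy bounded sequence has energy Cauchy convex combinations of its tails. -/
lemma exists_cauchy_convexHull (hD : D.IsDirichletForm)
    {v : ℕ → Lp ℝ 2 m} (hv : ∀ n, v n ∈ D.domain) {M : ℝ}
    (hM : ∀ n, D.energy (v n) ≤ M) :
    ∃ c : ℕ → Lp ℝ 2 m, (∀ n, c n ∈ convexHull ℝ (v '' Set.Ici n)) ∧
      ∀ ε > 0, ∃ N, ∀ n ≥ N, ∀ k ≥ N, D.energy (c n - c k) < ε := by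
  set H : ℕ → Set (Lp ℝ 2 m) := fun n => convexHull ℝ (v '' Set.Ici n) with hH
  have hHmono : ∀ {n k}, n ≤ k → H k ⊆ H n := fun h =>
    convexHull_mono (Set.image_mono (Set.Ici_subset_Ici.2 h))
  have hHdom : ∀ {n c}, c ∈ H n → c ∈ D.domain ∧ D.energy c ≤ M := fun hc =>
    hD.convexHull_subset_energy_le hv hM hc
  have hvH : ∀ n, v n ∈ H n := fun n => subset_convexHull ℝ _ ⟨n, Set.self_mem_Ici, rfl⟩
  have hne : ∀ n, (D.energy '' H n).Nonempty := fun n => ⟨_, _, hvH n, rfl⟩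
  have hbdd : ∀ n, BddBelow (D.energy '' H n) := fun n => ⟨0, by
    rintro _ ⟨c, hc, rfl⟩
    exact hD.energy_nonneg (hHdom hc).1⟩
  -- The minimal energies over the hulls of the tails increase and are bounded by `M`, hence
  -- converge; near-minimisers will be Cauchy by the parallelogram identity.
  set d : ℕ → ℝ := fun n => sInf (D.energy '' H n) with hd
  have hdle : ∀ {n c}, c ∈ H n → d n ≤ D.energy c := fun hc => csInf_le (hbdd _) ⟨_, hc, rfl⟩
  have hdM : ∀ n, d n ≤ M := fun n => (hdle (hvH n)).trans (hM n)
  have hdmono : Monotone d := fun n k hnk =>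
    csInf_le_csInf (hbdd n) (hne k) (Set.image_mono (hHmono hnk))
  have hlim := tendsto_atTop_ciSup hdmono ⟨M, by rintro _ ⟨n, rfl⟩; exact hdM n⟩
  set L := ⨆ n, d n
  have hdL : ∀ n, d n ≤ L := fun n => le_ciSup ⟨M, by rintro _ ⟨n, rfl⟩; exact hdM n⟩ n
  have hex : ∀ n : ℕ, ∃ c ∈ H n, D.energy c < d n + 1 / ((n : ℝ) + 1) := fun n => by
    obtain ⟨_, ⟨c, hc, rfl⟩, h⟩ := exists_lt_of_csInf_lt (hne n)
      (show sInf (D.energy '' H n) < d n + 1 / ((n : ℝ) + 1) from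
        lt_add_of_pos_right _ (by positivity))
    exact ⟨c, hc, h⟩
  choose c hc hcd using hex
  refine ⟨c, hc, fun ε hε => ?_⟩
  have hlim2 : Tendsto (fun n : ℕ => 4 * (L - d n) + 4 * (1 / ((n : ℝ) + 1))) atTop (𝓝 0) := by
    simpa using (((tendsto_const_nhds (x := L)).sub hlim).const_mul 4).add
      (tendsto_one_div_add_atTop_nhds_zero_nat.const_mul 4)
  obtain ⟨N, hN⟩ := (hlim2.eventually (gt_mem_nhds hε)).exists
  refine ⟨N, fun n hn k hk => ?_⟩
  -- The midpoint lies in `H N`, so its energy is at least `d N`, and the parallelogram identity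
  -- bounds `𝓔(c n - c k)` by `4 (L - d N) + 4 / (N + 1)`.
  have hmid : (1 / 2 : ℝ) • c n + (1 / 2 : ℝ) • c k ∈ H N :=
    convex_convexHull ℝ _ (hHmono hn (hc n)) (hHmono hk (hc k)) (by norm_num) (by norm_num)
      (by norm_num)
  have h1 := hdle hmid
  have hn' := (hHdom (hc n)).1
  have hk' := (hHdom (hc k)).1
  rw [← smul_add, hD.energy_smul _ (hD.add_mem _ hn' _ hk'), hD.energy_add hn' hk'] at h1
  rw [hD.energy_sub hn' hk']
  have h2 : 1 / ((n : ℝ) + 1) ≤ 1 / ((N : ℝ) + 1) := by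
    gcongr
  have h3 : 1 / ((k : ℝ) + 1) ≤ 1 / ((N : ℝ) + 1) := by
    gcongr
  have := hcd n
  have := hcd k
  have := hdL n
  have := hdL k
  linarith

/-- The shifted form `𝓔_α`, `α ≥ 0`, is again a Dirichlet form. -/
lemma shift (hD : D.IsDirichletForm) {α : ℝ} (hα : 0 ≤ α) : (D.shift α).IsDirichletForm where
  zero_mem := hD.zero_mem
  add_mem := hD.add_mem
  smul_mem := hD.smul_mem
  dense := hD.dense
  add_left u hu v hv w hw := by
    simp only [L2Form.shift, order, hD.add_left u hu v hv w hw, inner_add_left]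
    ring
  smul_left c u hu v hv := by
    simp only [L2Form.shift, order, hD.smul_left c u hu v hv, real_inner_smul_left]
    ring
  symm u hu v hv := by
    simp only [L2Form.shift, order, hD.symm u hu v hv, real_inner_comm]
  nonneg u hu := by
    have := hD.energy_nonneg hu
    change 0 ≤ (D.shift α).energy u
    rw [energy_shift]
    positivity
  closed u hu hcau := by
    have key : ∀ w, (D.shift α).order 1 w w = D.energy w + (1 + α) * ‖w‖ ^ 2 := fun w => by
      rw [order_self, energy_shift]
      ring
    simp only [key] at hcau ⊢
    obtain ⟨v, hv, hlim⟩ := hD.closed u hu fun ε hε => by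
      obtain ⟨N, hN⟩ := hcau ε hε
      refine ⟨N, fun n hn k hk => lt_of_le_of_lt ?_ (hN n hn k hk)⟩
      rw [order_self]
      gcongr
      linarith
    refine ⟨v, hv, ?_⟩
    refine squeeze_zero (fun n => ?_) (fun n => ?_) (by simpa using hlim.const_mul (1 + α))
    · have := hD.energy_nonneg (hD.sub_mem (hu n) hv)
      positivity
    · have := hD.energy_nonneg (hD.sub_mem (hu n) hv)
      rw [order_self]
      nlinarith [mul_nonneg hα this]
  markov u hu v hv := by
    obtain ⟨h1, h2⟩ := hD.markov u hu v hv
    refine ⟨h1, ?_⟩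
    change (D.shift α).energy v ≤ (D.shift α).energy u
    rw [energy_shift, energy_shift]
    have h3 : ‖v‖ ≤ ‖u‖ := by
      apply Lp.norm_le_norm_of_ae_le
      filter_upwards [hv] with x hx
      rw [hx, Real.norm_eq_abs, Real.norm_eq_abs, abs_le]
      rcases le_total (u x) 0 with h | h
      · rw [min_eq_left (by linarith), max_eq_left h]
        constructor <;> linarith [abs_nonneg (u x)]
      · rw [abs_of_nonneg h]
        exact ⟨by linarith [le_max_left 0 (min (u x) 1)], max_le h (min_le_left _ _)⟩
    have : D.energy v ≤ D.energy u := h2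
    gcongr

lemma norm_sq_le_order (hD : D.IsDirichletForm) (hu : u ∈ D.domain) : ‖u‖ ^ 2 ≤ D.order 1 u u := by
  rw [order_self]
  linarith [hD.energy_nonneg hu]

lemma tendsto_Lp_of_order (hD : D.IsDirichletForm)
    {c : ℕ → Lp ℝ 2 m} (hc : ∀ n, c n ∈ D.domain) (hv : v ∈ D.domain)
    (h : Tendsto (fun n => D.order 1 (c n - v) (c n - v)) atTop (𝓝 0)) :
    Tendsto c atTop (𝓝 v) := by
  rw [tendsto_iff_norm_sub_tendsto_zero]
  have h1 : Tendsto (fun n => ‖c n - v‖ ^ 2) atTop (𝓝 0) :=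
    squeeze_zero (fun n => by positivity)
      (fun n => hD.norm_sq_le_order (hD.sub_mem (hc n) hv)) h
  simpa [Real.sqrt_sq (norm_nonneg _)] using h1.sqrt

lemma energy_tendsto_of_order (hD : D.IsDirichletForm)
    {c : ℕ → Lp ℝ 2 m} (hc : ∀ n, c n ∈ D.domain) (hv : v ∈ D.domain)
    (h : Tendsto (fun n => D.order 1 (c n - v) (c n - v)) atTop (𝓝 0)) :
    Tendsto (fun n => D.energy (c n - v)) atTop (𝓝 0) :=
  squeeze_zero (fun n => hD.energy_nonneg (hD.sub_mem (hc n) hv))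
    (fun _ => D.energy_le_order zero_le_one _) h

lemma energy_le_of_tendsto (hD : D.IsDirichletForm)
    {c : ℕ → Lp ℝ 2 m} (hc : ∀ n, c n ∈ D.domain) (hv : v ∈ D.domain)
    {M : ℝ} (hM : ∀ n, D.energy (c n) ≤ M)
    (h : Tendsto (fun n => D.energy (c n - v)) atTop (𝓝 0)) : D.energy v ≤ M := by
  refine hD.energy_le_of_close hv fun ε hε => ?_
  obtain ⟨n, hn⟩ := (h.eventually (gt_mem_nhds hε)).exists
  exact ⟨c n, hc n, by linarith [hM n], hn⟩

/-- Banach-Saks property: convex combinations of the tails of an `𝓔₁`-bounded sequence converge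
in `𝓔₁`. -/
lemma exists_convexHull_tendsto (hD : D.IsDirichletForm)
    {v : ℕ → Lp ℝ 2 m} (hv : ∀ n, v n ∈ D.domain) {M : ℝ}
    (hM : ∀ n, D.order 1 (v n) (v n) ≤ M) :
    ∃ c : ℕ → Lp ℝ 2 m, (∀ n, c n ∈ convexHull ℝ (v '' Set.Ici n)) ∧ ∃ w ∈ D.domain,
      D.order 1 w w ≤ M ∧ Tendsto (fun n => D.order 1 (c n - w) (c n - w)) atTop (𝓝 0) := by
  -- Applied to `𝓔₁` instead of `𝓔`, the construction gives a sequence that is Cauchy for the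
  -- complete norm of the domain.
  have hD1 := hD.shift zero_le_one
  obtain ⟨c, hc, hcau⟩ := hD1.exists_cauchy_convexHull (v := v) hv hM
  have hcd := fun n => hD1.convexHull_subset_energy_le hv hM (hc n)
  obtain ⟨w, hw, hlim⟩ := hD.closed c (fun n => (hcd n).1) hcau
  exact ⟨c, hc, w, hw, hD1.energy_le_of_tendsto (fun n => (hcd n).1) hw (fun n => (hcd n).2) hlim,
    hlim⟩

/-- The `L²`-limit of an energy bounded sequence belongs to the domain and is the `𝓔₁`-limit of
convex combinations of the tails of the sequence. -/
lemma exists_convexHull_tendsto_of_tendsto (hD : D.IsDirichletForm)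
    {v : ℕ → Lp ℝ 2 m} (hv : ∀ n, v n ∈ D.domain)
    {M : ℝ} (hM : ∀ n, D.energy (v n) ≤ M) (hlim : Tendsto v atTop (𝓝 w)) :
    w ∈ D.domain ∧ D.energy w ≤ M ∧ ∃ c : ℕ → Lp ℝ 2 m,
      (∀ n, c n ∈ convexHull ℝ (v '' Set.Ici n)) ∧
      Tendsto (fun n => D.order 1 (c n - w) (c n - w)) atTop (𝓝 0) := by
  obtain ⟨K, hK⟩ := hlim.norm.bddAbove_range
  have hM1 : ∀ n, D.order 1 (v n) (v n) ≤ M + K ^ 2 := fun n => by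
    rw [order_self, one_mul]
    have : ‖v n‖ ≤ K := hK ⟨n, rfl⟩
    gcongr
    exact hM n
  obtain ⟨c, hc, w', hw', -, hcw⟩ := hD.exists_convexHull_tendsto hv hM1
  have hcd := fun n => hD.convexHull_subset_energy_le hv hM (hc n)
  have h1 := hD.tendsto_Lp_of_order (fun n => (hcd n).1) hw' hcw
  have h2 := Lp.tendsto_of_mem_convexHull hc hlim
  obtain rfl := tendsto_nhds_unique h1 h2
  exact ⟨hw', hD.energy_le_of_tendsto (fun n => (hcd n).1) hw' (fun n => (hcd n).2)
    (hD.energy_tendsto_of_order (fun n => (hcd n).1) hw' hcw), c, hc, hcw⟩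

/-- In the definition of the extended space, boundedness of the energies may replace the Cauchy
property: Cauchy convex combinations of the tails keep the a.e. limit. -/
lemma mem_extendedSpace_of_energy_le (hD : D.IsDirichletForm)
    {v : ℕ → Lp ℝ 2 m} (hv : ∀ n, v n ∈ D.domain) {M : ℝ}
    (hM : ∀ n, D.energy (v n) ≤ M) {u : E →ₘ[m] ℝ}
    (hlim : ∀ᵐ x ∂m, Tendsto (fun n => v n x) atTop (𝓝 (u x))) : u ∈ D.extendedSpace := by
  obtain ⟨c, hc, hcau⟩ := hD.exists_cauchy_convexHull hv hM
  exact ⟨c, fun n => (hD.convexHull_subset_energy_le hv hM (hc n)).1, hcau,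
    Lp.ae_tendsto_of_mem_convexHull hc hlim⟩

lemma exists_energy_le_of_cauchy (hD : D.IsDirichletForm)
    {c : ℕ → Lp ℝ 2 m} (hc : ∀ n, c n ∈ D.domain)
    (h : ∀ ε > 0, ∃ N, ∀ n ≥ N, ∀ k ≥ N, D.toFun (c n - c k) (c n - c k) < ε) :
    ∃ M N, ∀ n, D.energy (c (n + N)) ≤ M := by
  obtain ⟨N, hN⟩ := h 1 one_pos
  refine ⟨2 * (1 + D.energy (c N)), N, fun n => ?_⟩
  have h1 := hD.energy_add_le (hD.sub_mem (hc (n + N)) (hc N)) (hc N)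
  rw [sub_add_cancel] at h1
  have h2 : D.energy (c (n + N) - c N) < 1 := hN _ (by omega) _ le_rfl
  linarith

end IsDirichletForm

end L2Form

/-! ### The Markov property: truncations and lattice operations -/

namespace L2Form

namespace IsDirichletForm

variable {E : Type*} [MeasurableSpace E] {m : Measure E} {D : L2Form m}
variable {u v w : Lp ℝ 2 m}

/-- The unit contraction applied to `c⁻¹ u` and rescaled; only `c = 0` needs a separate word. -/
lemma exists_trunc (hD : D.IsDirichletForm) (hu : u ∈ D.domain) {c : ℝ} (hc : 0 ≤ c) :
    ∃ v ∈ D.domain, (∀ᵐ x ∂m, v x = max 0 (min (u x) c)) ∧ D.energy v ≤ D.energy u := by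
  rcases hc.eq_or_lt with rfl | hc
  · refine ⟨0, hD.zero_mem, ?_, by rw [hD.energy_zero]; exact hD.energy_nonneg hu⟩
    filter_upwards [Lp.coeFn_zero ℝ 2 m] with x hx
    rw [hx, Pi.zero_apply, max_eq_left (min_le_right _ _)]
  · obtain ⟨v, hv⟩ := Lp.exists_coeFn_ae_eq_of_abs_le (c⁻¹ • u)
      (f := fun x => max 0 (min ((c⁻¹ • u) x) 1))
      (aemeasurable_const.max ((Lp.aestronglyMeasurable (c⁻¹ • u)).aemeasurable.min
        aemeasurable_const)).aestronglyMeasurable (.of_forall fun x => by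
        rw [abs_le]
        rcases le_total ((c⁻¹ • u) x) 0 with h | h
        · rw [min_eq_left (by linarith), max_eq_left h]
          constructor <;> linarith [abs_nonneg ((c⁻¹ • u) x)]
        · rw [abs_of_nonneg h]
          exact ⟨by linarith [le_max_left 0 (min ((c⁻¹ • u) x) 1)],
            max_le h (min_le_left _ _)⟩)
    obtain ⟨h1, h2⟩ := hD.markov _ (hD.smul_mem _ _ hu) v hv
    refine ⟨c • v, hD.smul_mem _ _ h1, ?_, ?_⟩
    · filter_upwards [hv, Lp.coeFn_smul c v, Lp.coeFn_smul c⁻¹ u] with x h3 h4 h5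
      rw [h4, Pi.smul_apply, h3, h5, Pi.smul_apply, smul_eq_mul, smul_eq_mul,
        mul_max_of_nonneg _ _ hc.le, mul_min_of_nonneg _ _ hc.le, mul_zero, mul_one,
        mul_inv_cancel_left₀ hc.ne']
    · rw [hD.energy_smul _ h1]
      have h3 : D.energy v ≤ c⁻¹ ^ 2 * D.energy u := by
        rw [← hD.energy_smul _ hu]; exact h2
      calc c ^ 2 * D.energy v ≤ c ^ 2 * (c⁻¹ ^ 2 * D.energy u) := by gcongr
        _ = D.energy u := by field_simp

/-- The truncations of `u` to `[0, n]` converge to `u⁺` in `L²` with energies at most `𝓔(u)`, and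
closedness gives lower semicontinuity. -/
lemma posPart_mem (hD : D.IsDirichletForm) (hu : u ∈ D.domain) :
    u ⊔ 0 ∈ D.domain ∧ D.energy (u ⊔ 0) ≤ D.energy u := by
  choose v hv hvu hvE using fun n : ℕ => hD.exists_trunc hu (Nat.cast_nonneg (α := ℝ) n)
  have h : Tendsto v atTop (𝓝 (u ⊔ 0)) := by
    refine Lp.tendsto_of_ae_tendsto_of_abs_le (h := u) (fun n => ?_) ?_
    · filter_upwards [hvu n] with x hx
      rw [hx, abs_of_nonneg (le_max_left _ _)]
      exact max_le (abs_nonneg _) ((min_le_left _ _).trans (le_abs_self _))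
    · filter_upwards [ae_all_iff.2 hvu, Lp.coeFn_sup u 0, Lp.coeFn_zero ℝ 2 m] with x h1 h2 h3
      rw [h2, Pi.sup_apply, h3, Pi.zero_apply]
      refine tendsto_const_nhds.congr' ?_
      filter_upwards [eventually_ge_atTop ⌈u x⌉₊] with n hn
      rw [h1, min_eq_left ((Nat.le_ceil _).trans (by exact_mod_cast hn)), max_comm]
  obtain ⟨h1, h2, -⟩ := hD.exists_convexHull_tendsto_of_tendsto hv hvE h
  exact ⟨h1, h2⟩

/-- `𝓔(a, b) ≤ 0` for nonnegative `a, b` living on disjoint sets. -/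
lemma toFun_nonpos_of_mul_eq_zero (hD : D.IsDirichletForm) (hu : u ∈ D.domain) (hv : v ∈ D.domain)
    (hu0 : ∀ᵐ x ∂m, 0 ≤ u x) (hv0 : ∀ᵐ x ∂m, 0 ≤ v x) (huv : ∀ᵐ x ∂m, u x * v x = 0) :
    D.toFun u v ≤ 0 := by
  have key : 0 ≤ -(2 * D.toFun u v) := by
    refine nonneg_of_forall_quadratic_nonneg (c := D.energy v) fun t ht => ?_
    -- Subtracting a multiple of `v` is undone by the positive part, so `𝓔(u) ≤ 𝓔(u - t v)` for all
    -- `t > 0`; the sign of the first-order term is the claim.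
    have h1 : (u + (-t) • v) ⊔ 0 = u := by
      apply Lp.ext
      filter_upwards [Lp.coeFn_sup (u + (-t) • v) 0, Lp.coeFn_zero ℝ 2 m,
        Lp.coeFn_add u ((-t) • v), Lp.coeFn_smul (-t) v, hu0, hv0, huv] with x h1 h2 h3 h4 h5 h6 h7
      rw [h1, Pi.sup_apply, h2, h3, Pi.add_apply, h4, Pi.smul_apply, smul_eq_mul, Pi.zero_apply]
      rcases mul_eq_zero.1 h7 with h | h
      · rw [h, sup_eq_right]
        nlinarith
      · rw [h]
        simpa using h5
    have h2 := (hD.posPart_mem (hD.add_mem _ hu _ (hD.smul_mem (-t) _ hv))).2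
    rw [h1, hD.energy_add_smul _ hu hv] at h2
    linarith
  linarith

/-- The energies of `u⁺ + u⁻` and `u⁺ - u⁻` differ only in the sign of the cross term, and `𝓔(u⁺,
u⁻) ≤ 0`. -/
lemma abs_mem (hD : D.IsDirichletForm)
    (hu : u ∈ D.domain) : |u| ∈ D.domain ∧ D.energy |u| ≤ D.energy u := by
  obtain ⟨hp, -⟩ := hD.posPart_mem hu
  obtain ⟨hn, -⟩ := hD.posPart_mem (hD.neg_mem hu)
  have hae : ∀ᵐ x ∂m, (u ⊔ 0) x = max (u x) 0 ∧ (-u ⊔ 0) x = max (-u x) 0 := by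
    filter_upwards [Lp.coeFn_sup u 0, Lp.coeFn_sup (-u) 0, Lp.coeFn_neg u, Lp.coeFn_zero ℝ 2 m]
      with x h1 h2 h3 h4
    rw [h1, h2, Pi.sup_apply, Pi.sup_apply, h3, h4]
    exact ⟨rfl, rfl⟩
  have h1 : |u| = (u ⊔ 0) + (-u ⊔ 0) := by
    apply Lp.ext
    filter_upwards [hae, Lp.coeFn_abs u, Lp.coeFn_add (u ⊔ 0) (-u ⊔ 0)] with x h1 h2 h3
    rw [h2, h3, Pi.add_apply, h1.1, h1.2]
    rcases le_total (u x) 0 with h | h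
    · rw [abs_of_nonpos h, max_eq_right h, max_eq_left (by linarith), zero_add]
    · rw [abs_of_nonneg h, max_eq_left h, max_eq_right (by linarith), add_zero]
  have h2 : u = (u ⊔ 0) - (-u ⊔ 0) := by
    apply Lp.ext
    filter_upwards [hae, Lp.coeFn_sub (u ⊔ 0) (-u ⊔ 0)] with x h1 h3
    rw [h3, Pi.sub_apply, h1.1, h1.2]
    rcases le_total (u x) 0 with h | h
    · rw [max_eq_right h, max_eq_left (by linarith)]; ring
    · rw [max_eq_left h, max_eq_right (by linarith), sub_zero]
  have h3 : D.toFun (u ⊔ 0) (-u ⊔ 0) ≤ 0 := by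
    refine hD.toFun_nonpos_of_mul_eq_zero hp hn ?_ ?_ ?_
    · filter_upwards [hae] with x h1
      rw [h1.1]; exact le_max_right _ _
    · filter_upwards [hae] with x h1
      rw [h1.2]; exact le_max_right _ _
    · filter_upwards [hae] with x h1
      rw [h1.1, h1.2]
      rcases le_total (u x) 0 with h | h
      · rw [max_eq_right h, zero_mul]
      · rw [max_eq_right (by linarith : -u x ≤ 0), mul_zero]
  rw [h1]
  refine ⟨hD.add_mem _ hp _ hn, ?_⟩
  have h4 := hD.energy_sub hp hn
  rw [← h2] at h4
  rw [hD.energy_add hp hn, h4]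
  linarith

/-- Write both as `(u + v ± |u - v|) / 2`. The sum of the energies is `(𝓔(u + v) + 𝓔(|u - v|)) / 2`;
drop the absolute value and use the parallelogram identity. -/
lemma sup_inf_mem (hD : D.IsDirichletForm) (hu : u ∈ D.domain) (hv : v ∈ D.domain) :
    u ⊔ v ∈ D.domain ∧ u ⊓ v ∈ D.domain ∧
      D.energy (u ⊔ v) + D.energy (u ⊓ v) ≤ D.energy u + D.energy v := by
  obtain ⟨ha, haE⟩ := hD.abs_mem (hD.sub_mem hu hv)
  have hs := hD.add_mem _ hu _ hv
  have h1 : u ⊔ v = (1 / 2 : ℝ) • (u + v + |u - v|) := by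
    apply Lp.ext
    filter_upwards [Lp.coeFn_sup u v, Lp.coeFn_smul (1 / 2 : ℝ) (u + v + |u - v|),
      Lp.coeFn_add (u + v) |u - v|, Lp.coeFn_add u v, Lp.coeFn_abs (u - v), Lp.coeFn_sub u v]
      with x h1 h2 h3 h4 h5 h6
    rw [h1, h2, Pi.smul_apply, h3, Pi.add_apply, h4, h5, h6, Pi.add_apply, Pi.sub_apply,
      Pi.sup_apply, smul_eq_mul]
    rcases le_total (u x) (v x) with h | h
    · rw [sup_eq_right.2 h, abs_of_nonpos (by linarith)]; ring
    · rw [sup_eq_left.2 h, abs_of_nonneg (by linarith)]; ring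
  have h2 : u ⊓ v = (1 / 2 : ℝ) • (u + v - |u - v|) := by
    apply Lp.ext
    filter_upwards [Lp.coeFn_inf u v, Lp.coeFn_smul (1 / 2 : ℝ) (u + v - |u - v|),
      Lp.coeFn_sub (u + v) |u - v|, Lp.coeFn_add u v, Lp.coeFn_abs (u - v), Lp.coeFn_sub u v]
      with x h1 h2 h3 h4 h5 h6
    rw [h1, h2, Pi.smul_apply, h3, Pi.sub_apply, h4, h5, h6, Pi.add_apply, Pi.sub_apply,
      Pi.inf_apply, smul_eq_mul]
    rcases le_total (u x) (v x) with h | h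
    · rw [inf_eq_left.2 h, abs_of_nonpos (by linarith)]; ring
    · rw [inf_eq_right.2 h, abs_of_nonneg (by linarith)]; ring
  rw [h1, h2]
  refine ⟨hD.smul_mem _ _ (hD.add_mem _ hs _ ha), hD.smul_mem _ _ (hD.sub_mem hs ha), ?_⟩
  rw [hD.energy_smul _ (hD.add_mem _ hs _ ha), hD.energy_smul _ (hD.sub_mem hs ha),
    hD.energy_add hs ha, hD.energy_sub hs ha, hD.energy_add hu hv]
  rw [hD.energy_sub hu hv] at haE
  linarith

lemma sup_mem (hD : D.IsDirichletForm) (hu : u ∈ D.domain) (hv : v ∈ D.domain) :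
    u ⊔ v ∈ D.domain ∧ D.energy (u ⊔ v) ≤ D.energy u + D.energy v := by
  obtain ⟨h1, h2, h3⟩ := hD.sup_inf_mem hu hv
  exact ⟨h1, by linarith [hD.energy_nonneg h2]⟩

lemma inf_mem (hD : D.IsDirichletForm) (hu : u ∈ D.domain) (hv : v ∈ D.domain) :
    u ⊓ v ∈ D.domain ∧ D.energy (u ⊓ v) ≤ D.energy u + D.energy v := by
  obtain ⟨h1, h2, h3⟩ := hD.sup_inf_mem hu hv
  exact ⟨h2, by linarith [hD.energy_nonneg h1]⟩

lemma _root_.max_neg_min_eq_sub {a : ℝ} (ha : 0 ≤ a) (r : ℝ) :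
    max (-a) (min r a) = max 0 (min r a) - max 0 (min (-r) a) := by
  rcases le_total r 0 with h | h
  · have h1 : max 0 (min r a) = 0 := max_eq_left ((min_le_left _ _).trans h)
    have h2 : max 0 (min (-r) a) = min (-r) a := max_eq_right (le_min (by linarith) ha)
    rw [h1, h2, min_eq_left (h.trans ha), zero_sub, ← max_neg_neg, neg_neg, max_comm]
  · have h1 : max 0 (min r a) = min r a := max_eq_right (le_min h ha)
    have h2 : max 0 (min (-r) a) = 0 := max_eq_left ((min_le_left _ _).trans (by linarith))
    rw [h1, h2, sub_zero, max_eq_right (le_min (by linarith) (by linarith))]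

/-- The clamp is `u⁺ ∧ h - u⁻ ∧ h`. A level `h ∈ 𝓕` instead of a constant keeps truncations
dominated in `L²`, so that sequences converging only a.e. become `L²`-convergent. The constant `4`
is not optimal. -/
lemma exists_clamp (hD : D.IsDirichletForm) (hu : u ∈ D.domain) {h : Lp ℝ 2 m} (hh : h ∈ D.domain)
    (hh0 : ∀ᵐ x ∂m, 0 ≤ h x) :
    ∃ v ∈ D.domain, (∀ᵐ x ∂m, v x = max (-h x) (min (u x) (h x))) ∧
      D.energy v ≤ 4 * (D.energy u + D.energy h) := by
  obtain ⟨hp, hpE⟩ := hD.posPart_mem hu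
  obtain ⟨hn, hnE⟩ := hD.posPart_mem (hD.neg_mem hu)
  obtain ⟨h1, h1E⟩ := hD.inf_mem hp hh
  obtain ⟨h2, h2E⟩ := hD.inf_mem hn hh
  refine ⟨_, hD.sub_mem h1 h2, ?_, ?_⟩
  · filter_upwards [hh0, Lp.coeFn_sub ((u ⊔ 0) ⊓ h) ((-u ⊔ 0) ⊓ h), Lp.coeFn_inf (u ⊔ 0) h,
      Lp.coeFn_inf (-u ⊔ 0) h, Lp.coeFn_sup u 0, Lp.coeFn_sup (-u) 0, Lp.coeFn_neg u,
      Lp.coeFn_zero ℝ 2 m] with x h0 h1 h2 h3 h4 h5 h6 h7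
    rw [h1, Pi.sub_apply, h2, h3, Pi.inf_apply, Pi.inf_apply, h4, h5, Pi.sup_apply, Pi.sup_apply,
      h6, h7, Pi.neg_apply, Pi.zero_apply, max_neg_min_eq_sub h0]
    have : ∀ r : ℝ, (r ⊔ 0) ⊓ h x = max 0 (min r (h x)) := fun r => by
      rw [max_min_distrib_left, max_eq_right h0, max_comm]
    rw [this, this]
  · rw [hD.energy_neg hu] at hnE
    have := hD.energy_sub_le h1 h2
    linarith

lemma exists_clamp_const (hD : D.IsDirichletForm) (hu : u ∈ D.domain) {c : ℝ} (hc : 0 ≤ c) :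
    ∃ v ∈ D.domain, (∀ᵐ x ∂m, v x = max (-c) (min (u x) c)) ∧ D.energy v ≤ 4 * D.energy u := by
  obtain ⟨p, hp, hpu, hpE⟩ := hD.exists_trunc hu hc
  obtain ⟨n, hn, hnu, hnE⟩ := hD.exists_trunc (hD.neg_mem hu) hc
  refine ⟨p - n, hD.sub_mem hp hn, ?_, ?_⟩
  · filter_upwards [hpu, hnu, Lp.coeFn_sub p n, Lp.coeFn_neg u] with x h1 h2 h3 h4
    rw [h3, Pi.sub_apply, h1, h2, h4, Pi.neg_apply, max_neg_min_eq_sub hc]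
  · rw [hD.energy_neg hu] at hnE
    have := hD.energy_sub_le hp hn
    linarith

/-- `𝓔(u ∧ c, u ∧ c) ≤ 𝓔(u, u ∧ c)` for `u ≥ 0` and a constant `c ≥ 0`. -/
lemma energy_min_const_le (hD : D.IsDirichletForm)
    (hu : u ∈ D.domain) (hu0 : ∀ᵐ x ∂m, 0 ≤ u x) (hv : v ∈ D.domain)
    {c : ℝ} (hc : 0 ≤ c) (hvu : ∀ᵐ x ∂m, v x = min (u x) c) : D.energy v ≤ D.toFun u v := by
  have hw := hD.sub_mem hu hv
  have key : 0 ≤ 2 * D.toFun v (u - v) := by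
    refine nonneg_of_forall_quadratic_nonneg (c := D.energy (u - v)) fun t ht => ?_
    obtain ⟨z, hz, hzu, hzE⟩ := hD.exists_trunc (hD.add_mem _ hv _ (hD.smul_mem t _ hw)) hc
    -- Moving from `u ∧ c` towards `u` is undone by truncating at `c`: where `u ≤ c` nothing moves,
    -- and where `u ≥ c` the value only rises above `c`.
    have h1 : z = v := by
      apply Lp.ext
      filter_upwards [hzu, hvu, hu0, Lp.coeFn_add v (t • (u - v)), Lp.coeFn_smul t (u - v),
        Lp.coeFn_sub u v] with x h1 h2 h3 h4 h5 h6
      rw [h1, h4, Pi.add_apply, h5, Pi.smul_apply, h6, Pi.sub_apply, h2, smul_eq_mul]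
      rcases le_total (u x) c with h | h
      · rw [min_eq_left h, sub_self, mul_zero, add_zero, min_eq_left h, max_eq_right h3]
      · rw [min_eq_right h, min_eq_right (by nlinarith), max_eq_right hc]
    rw [h1, hD.energy_add_smul _ hv hw] at hzE
    linarith
  rw [hD.sub_right hv hu hv, hD.symm _ hv _ hu] at key
  unfold energy
  linarith

/-- If `𝓔(u, ·) = ℓ` then `ℓ((z - u)⁺) ≤ 𝓔(z) / 4` for all `z` in the domain. -/
lemma toFun_posPart_sub_le (hD : D.IsDirichletForm) (hu : u ∈ D.domain) (hv : v ∈ D.domain) :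
    D.toFun u ((v - u) ⊔ 0) ≤ D.energy v / 4 := by
  have hs := hD.sub_mem hv hu
  obtain ⟨hp, -⟩ := hD.posPart_mem hs
  obtain ⟨hn, -⟩ := hD.posPart_mem (hD.neg_mem hs)
  set p := (v - u) ⊔ 0 with hpdef
  set n := -(v - u) ⊔ 0 with hndef
  have hae : ∀ᵐ x ∂m, p x = max (v x - u x) 0 ∧ n x = max (-(v x - u x)) 0 := by
    filter_upwards [Lp.coeFn_sup (v - u) 0, Lp.coeFn_sup (-(v - u)) 0, Lp.coeFn_neg (v - u),
      Lp.coeFn_zero ℝ 2 m, Lp.coeFn_sub v u] with x h1 h2 h3 h4 h5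
    rw [h1, h2, Pi.sup_apply, Pi.sup_apply, h3, h4, Pi.neg_apply, h5]
    exact ⟨rfl, rfl⟩
  have h1 : u = v - p + n := by
    apply Lp.ext
    filter_upwards [hae, Lp.coeFn_add (v - p) n, Lp.coeFn_sub v p] with x h1 h2 h3
    rw [h2, Pi.add_apply, h3, Pi.sub_apply, h1.1, h1.2]
    rcases le_total (v x - u x) 0 with h | h
    · rw [max_eq_right h, max_eq_left (by linarith)]; ring
    · rw [max_eq_left h, max_eq_right (by linarith)]; ring
  have h2 : D.toFun n p ≤ 0 := by
    refine hD.toFun_nonpos_of_mul_eq_zero hn hp ?_ ?_ ?_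
    · filter_upwards [hae] with x h1
      rw [h1.2]; exact le_max_right _ _
    · filter_upwards [hae] with x h1
      rw [h1.1]; exact le_max_right _ _
    · filter_upwards [hae] with x h1
      rw [h1.1, h1.2]
      rcases le_total (v x - u x) 0 with h | h
      · rw [max_eq_right h, mul_zero]
      · rw [max_eq_right (by linarith : -(v x - u x) ≤ 0), zero_mul]
  have h3 : D.toFun u p = D.toFun v p - D.energy p + D.toFun n p := by
    conv_lhs => rw [h1]
    rw [hD.add_left _ (hD.sub_mem hv hp) _ hn _ hp, hD.sub_left hv hp hp]
    rfl
  -- Nonnegativity of `𝓔(v - 2 p)` is `𝓔(v, p) - 𝓔(p) ≤ 𝓔(v) / 4`.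
  have h4 := hD.energy_nonneg (hD.add_mem _ hv _ (hD.smul_mem (-2) _ hp))
  rw [hD.energy_add_smul _ hv hp] at h4
  linarith

end IsDirichletForm

end L2Form

/-! ### The resolvent -/

namespace L2Form

variable {E : Type*} [MeasurableSpace E] {m : Measure E} {D : L2Form m}

namespace IsDirichletForm

variable {u v w f g : Lp ℝ 2 m} {α β : ℝ}

lemma tendsto_toFun_left (hD : D.IsDirichletForm)
    {c : ℕ → Lp ℝ 2 m} (hc : ∀ n, c n ∈ D.domain) (hv : v ∈ D.domain)
    (hw : w ∈ D.domain) (h : Tendsto (fun n => D.energy (c n - v)) atTop (𝓝 0)) :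
    Tendsto (fun n => D.toFun (c n) w) atTop (𝓝 (D.toFun v w)) := by
  rw [tendsto_iff_norm_sub_tendsto_zero]
  have h1 : Tendsto (fun n => √(D.energy (c n - v) * D.energy w)) atTop (𝓝 0) := by
    simpa using (h.mul_const (D.energy w)).sqrt
  refine squeeze_zero (fun n => norm_nonneg _) (fun n => ?_) h1
  rw [← hD.sub_left (hc n) hv hw, Real.norm_eq_abs]
  exact Real.abs_le_sqrt (hD.cauchy_schwarz (hD.sub_mem (hc n) hv) hw)

/-- Direct method: a minimising sequence of `w ↦ 𝓔_α(w) - 2 (f, w)` is Cauchy by the parallelogram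
identity, and the Euler-Lagrange equation of the limit is the resolvent equation. -/
lemma exists_isResolvent (hD : D.IsDirichletForm)
    (hα : 0 < α) (f : Lp ℝ 2 m) : ∃ w, D.IsResolvent α f w := by
  have hS := hD.shift hα.le
  set S := D.shift α with hSdef
  set J : Lp ℝ 2 m → ℝ := fun w => S.energy w - 2 * inner ℝ f w with hJ
  have hlow : ∀ w ∈ S.domain, α * ‖w‖ ^ 2 ≤ S.energy w := fun w hw => by
    rw [hSdef, energy_shift]
    linarith [hD.energy_nonneg hw]
  have hbdd : BddBelow (J '' S.domain) := by
    refine ⟨-(‖f‖ ^ 2 / α), ?_⟩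
    rintro _ ⟨w, hw, rfl⟩
    have h1 := hlow w hw
    have h2 := (abs_le.1 (abs_real_inner_le_norm f w)).2
    have h3 : 0 ≤ (α * ‖w‖ - ‖f‖) ^ 2 / α := by positivity
    have h4 : (α * ‖w‖ - ‖f‖) ^ 2 / α = α * ‖w‖ ^ 2 - 2 * (‖f‖ * ‖w‖) + ‖f‖ ^ 2 / α := by
      field_simp
      ring
    simp only [hJ]
    linarith
  set d := sInf (J '' S.domain) with hd
  have hdle : ∀ w ∈ S.domain, d ≤ J w := fun w hw => csInf_le hbdd ⟨w, hw, rfl⟩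
  have hex : ∀ n : ℕ, ∃ w ∈ S.domain, J w < d + 1 / ((n : ℝ) + 1) := fun n => by
    obtain ⟨_, ⟨w, hw, rfl⟩, h⟩ := exists_lt_of_csInf_lt (⟨_, 0, hS.zero_mem, rfl⟩ :
      (J '' S.domain).Nonempty) (show sInf (J '' S.domain) < d + 1 / ((n : ℝ) + 1) from
        lt_add_of_pos_right _ (by positivity))
    exact ⟨w, hw, h⟩
  choose w hw hwJ using hex
  have hcau : ∀ n k, S.energy (w n - w k) ≤ 2 * (1 / ((n : ℝ) + 1)) + 2 * (1 / ((k : ℝ) + 1)) := by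
    intro n k
    have hs := hS.add_mem _ (hw n) _ (hw k)
    have h1 := hdle _ (hS.smul_mem (1 / 2) _ hs)
    simp only [hJ, hS.energy_smul _ hs, hS.energy_add (hw n) (hw k), real_inner_smul_right,
      inner_add_right] at h1
    rw [hS.energy_sub (hw n) (hw k)]
    have h2 := hwJ n
    have h3 := hwJ k
    simp only [hJ] at h2 h3
    linarith
  obtain ⟨v, hv, hlim⟩ := hS.closed w hw fun ε hε => by
    have hlim2 : Tendsto (fun n : ℕ => (1 + 1 / α) * (4 * (1 / ((n : ℝ) + 1)))) atTop (𝓝 0) := by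
      simpa using (tendsto_one_div_add_atTop_nhds_zero_nat.const_mul 4).const_mul (1 + 1 / α)
    obtain ⟨N, hN⟩ := (hlim2.eventually (gt_mem_nhds hε)).exists
    refine ⟨N, fun n hn k hk => lt_of_le_of_lt ?_ hN⟩
    have h2 : 1 / ((n : ℝ) + 1) ≤ 1 / ((N : ℝ) + 1) := by gcongr
    have h3 : 1 / ((k : ℝ) + 1) ≤ 1 / ((N : ℝ) + 1) := by gcongr
    have h4 := hlow _ (hS.sub_mem (hw n) (hw k))
    have h5 : ‖w n - w k‖ ^ 2 ≤ 1 / α * S.energy (w n - w k) := by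
      rw [one_div, ← div_eq_inv_mul, le_div_iff₀ hα]
      linarith
    calc S.order 1 (w n - w k) (w n - w k) ≤ (1 + 1 / α) * S.energy (w n - w k) := by
          rw [order_self]; linarith
      _ ≤ _ := by gcongr; linarith [hcau n k]
  have hE := hS.energy_tendsto_of_order hw hv hlim
  refine ⟨v, hv, fun z hz => ?_⟩
  change S.toFun v z = inner ℝ f z
  -- Near-minimality of `w n` under the variation `t z`, passed to the limit. A nonnegative
  -- quadratic without constant term has no linear term.
  have hquad : ∀ t : ℝ, 0 ≤ 0 + 2 * t * (S.toFun v z - inner ℝ f z) + t ^ 2 * S.energy z := by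
    intro t
    have h1 : ∀ n : ℕ, 0 ≤ 1 / ((n : ℝ) + 1) + 2 * t * (S.toFun (w n) z - inner ℝ f z)
        + t ^ 2 * S.energy z := fun n => by
      have h2 := hdle _ (hS.add_mem _ (hw n) _ (hS.smul_mem t _ hz))
      have h3 := hwJ n
      simp only [hJ, hS.energy_add_smul t (hw n) hz, real_inner_smul_right,
        inner_add_right] at h2 h3
      linarith
    refine ge_of_tendsto' (((tendsto_one_div_add_atTop_nhds_zero_nat (𝕜 := ℝ)).add
      (((hS.tendsto_toFun_left hw hv hz hE).sub_const _).const_mul (2 * t))).add_const _) h1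
  have h2 := sq_le_mul_of_forall_quadratic_nonneg hquad
  rw [zero_mul] at h2
  have h3 := pow_eq_zero_iff (two_ne_zero) |>.1 (le_antisymm h2 (sq_nonneg _))
  linarith

lemma isResolvent_resolvent (hD : D.IsDirichletForm) (hα : 0 < α) (f : Lp ℝ 2 m) :
    D.IsResolvent α f (D.resolvent α f) := by
  have h := hD.exists_isResolvent hα f
  rw [resolvent, dif_pos h]
  exact h.choose_spec

lemma resolvent_mem (hD : D.IsDirichletForm)
    (hα : 0 < α) (f : Lp ℝ 2 m) : D.resolvent α f ∈ D.domain :=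
  (hD.isResolvent_resolvent hα f).1

lemma order_resolvent (hD : D.IsDirichletForm) (hα : 0 < α) (f : Lp ℝ 2 m) (hv : v ∈ D.domain) :
    D.order α (D.resolvent α f) v = inner ℝ f v :=
  (hD.isResolvent_resolvent hα f).2 v hv

lemma eq_resolvent (hD : D.IsDirichletForm)
    (hα : 0 < α) (h : D.IsResolvent α f w) : w = D.resolvent α f := by
  have hS := hD.shift hα.le
  have hr := hD.resolvent_mem hα f
  have h1 : (D.shift α).energy (w - D.resolvent α f) = 0 := by
    change (D.shift α).toFun _ _ = 0
    rw [hS.sub_left h.1 hr (hS.sub_mem h.1 hr)]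
    change D.order α _ _ - D.order α _ _ = 0
    rw [h.2 _ (hD.sub_mem h.1 hr), hD.order_resolvent hα f (hD.sub_mem h.1 hr), sub_self]
  rw [energy_shift] at h1
  have h2 := hD.energy_nonneg (hD.sub_mem h.1 hr)
  have h3 : ‖w - D.resolvent α f‖ ^ 2 = 0 := by
    have : 0 ≤ ‖w - D.resolvent α f‖ ^ 2 := by positivity
    nlinarith
  exact sub_eq_zero.1 (norm_eq_zero.1 (pow_eq_zero_iff two_ne_zero |>.1 h3))

lemma resolvent_add (hD : D.IsDirichletForm) (hα : 0 < α) (f g : Lp ℝ 2 m) :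
    D.resolvent α (f + g) = D.resolvent α f + D.resolvent α g := by
  have hf := hD.resolvent_mem hα f
  have hg := hD.resolvent_mem hα g
  refine (hD.eq_resolvent hα ⟨hD.add_mem _ hf _ hg, fun v hv => ?_⟩).symm
  rw [inner_add_left, ← hD.order_resolvent hα f hv, ← hD.order_resolvent hα g hv]
  exact (hD.shift hα.le).add_left _ hf _ hg _ hv

lemma resolvent_smul (hD : D.IsDirichletForm) (hα : 0 < α) (c : ℝ) (f : Lp ℝ 2 m) :
    D.resolvent α (c • f) = c • D.resolvent α f := by
  have hf := hD.resolvent_mem hα f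
  refine (hD.eq_resolvent hα ⟨hD.smul_mem _ _ hf, fun v hv => ?_⟩).symm
  rw [real_inner_smul_left, ← hD.order_resolvent hα f hv]
  exact (hD.shift hα.le).smul_left _ _ hf _ hv

lemma resolvent_sub (hD : D.IsDirichletForm) (hα : 0 < α) (f g : Lp ℝ 2 m) :
    D.resolvent α (f - g) = D.resolvent α f - D.resolvent α g := by
  have h : f - g = f + (-1 : ℝ) • g := by rw [neg_one_smul, sub_eq_add_neg]
  rw [h, hD.resolvent_add hα, hD.resolvent_smul hα, neg_one_smul, sub_eq_add_neg]

lemma inner_resolvent_comm (hD : D.IsDirichletForm) (hα : 0 < α) (f g : Lp ℝ 2 m) :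
    inner ℝ f (D.resolvent α g) = inner ℝ (D.resolvent α f) g := by
  have hf := hD.resolvent_mem hα f
  have hg := hD.resolvent_mem hα g
  rw [← hD.order_resolvent hα f hg, real_inner_comm, ← hD.order_resolvent hα g hf]
  exact (hD.shift hα.le).symm _ hf _ hg

lemma norm_resolvent_le (hD : D.IsDirichletForm)
    (hα : 0 < α) (f : Lp ℝ 2 m) : ‖D.resolvent α f‖ ≤ ‖f‖ / α := by
  have hf := hD.resolvent_mem hα f
  have h1 := hD.order_resolvent hα f hf
  rw [order_self] at h1
  have h2 := hD.energy_nonneg hf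
  have h3 := real_inner_le_norm f (D.resolvent α f)
  rcases (norm_nonneg (D.resolvent α f)).eq_or_lt with h | h
  · rw [← h]; positivity
  · rw [le_div_iff₀ hα]
    have h4 : (‖D.resolvent α f‖ * α) * ‖D.resolvent α f‖ ≤ ‖f‖ * ‖D.resolvent α f‖ := by nlinarith
    exact le_of_mul_le_mul_right h4 h

lemma tendsto_resolvent (hD : D.IsDirichletForm)
    (hα : 0 < α) {f : ℕ → Lp ℝ 2 m} (h : Tendsto f atTop (𝓝 g)) :
    Tendsto (fun n => D.resolvent α (f n)) atTop (𝓝 (D.resolvent α g)) := by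
  rw [tendsto_iff_norm_sub_tendsto_zero] at h ⊢
  refine squeeze_zero (fun _ => norm_nonneg _) (fun n => ?_) (by simpa using h.div_const α)
  rw [← hD.resolvent_sub hα]
  exact hD.norm_resolvent_le hα _

/-- Test the equation with the negative part `w⁻` of `w = G_α f`: `0 ≤ (f, w⁻) = 𝓔_α(w⁺, w⁻) -
𝓔_α(w⁻) ≤ -𝓔_α(w⁻)`, so `w⁻ = 0`. -/
lemma resolvent_nonneg (hD : D.IsDirichletForm) (hα : 0 < α) (hf : ∀ᵐ x ∂m, 0 ≤ f x) :
    ∀ᵐ x ∂m, 0 ≤ D.resolvent α f x := by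
  have hS := hD.shift hα.le
  have hr := hD.resolvent_mem hα f
  set w := D.resolvent α f with hw
  obtain ⟨hp, -⟩ := hD.posPart_mem hr
  obtain ⟨hn, -⟩ := hD.posPart_mem (hD.neg_mem hr)
  have hae : ∀ᵐ x ∂m, (w ⊔ 0) x = max (w x) 0 ∧ (-w ⊔ 0) x = max (-w x) 0 := by
    filter_upwards [Lp.coeFn_sup w 0, Lp.coeFn_sup (-w) 0, Lp.coeFn_neg w, Lp.coeFn_zero ℝ 2 m]
      with x h1 h2 h3 h4
    rw [h1, h2, Pi.sup_apply, Pi.sup_apply, h3, h4]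
    exact ⟨rfl, rfl⟩
  have h2 : w = (w ⊔ 0) - (-w ⊔ 0) := by
    apply Lp.ext
    filter_upwards [hae, Lp.coeFn_sub (w ⊔ 0) (-w ⊔ 0)] with x h1 h3
    rw [h3, Pi.sub_apply, h1.1, h1.2]
    rcases le_total (w x) 0 with h | h
    · rw [max_eq_right h, max_eq_left (by linarith)]; ring
    · rw [max_eq_left h, max_eq_right (by linarith), sub_zero]
  have hn0 : ∀ᵐ x ∂m, 0 ≤ (-w ⊔ 0) x := by
    filter_upwards [hae] with x h1
    rw [h1.2]; exact le_max_right _ _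
  have h3 : (D.shift α).toFun (w ⊔ 0) (-w ⊔ 0) ≤ 0 := by
    refine hS.toFun_nonpos_of_mul_eq_zero hp hn ?_ hn0 ?_
    · filter_upwards [hae] with x h1
      rw [h1.1]; exact le_max_right _ _
    · filter_upwards [hae] with x h1
      rw [h1.1, h1.2]
      rcases le_total (w x) 0 with h | h
      · rw [max_eq_right h, zero_mul]
      · rw [max_eq_right (by linarith : -w x ≤ 0), mul_zero]
  have h4 : (D.shift α).toFun w (-w ⊔ 0) = inner ℝ f (-w ⊔ 0) := hD.order_resolvent hα f hn
  have h5 := Lp.inner_nonneg_of_ae_nonneg hf hn0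
  rw [← h4, h2, hS.sub_left hp hn, ← h2] at h5
  · have h6 : (D.shift α).energy (-w ⊔ 0) ≤ 0 := by
      change (D.shift α).toFun _ _ ≤ 0
      linarith
    rw [energy_shift] at h6
    have h7 := hD.energy_nonneg hn
    have h8 : ‖-w ⊔ 0‖ ^ 2 = 0 := by
      have : 0 ≤ ‖-w ⊔ 0‖ ^ 2 := by positivity
      nlinarith
    have h9 : -w ⊔ 0 = 0 := norm_eq_zero.1 (pow_eq_zero_iff two_ne_zero |>.1 h8)
    rw [h9] at hae
    filter_upwards [hae, Lp.coeFn_zero ℝ 2 m] with x h1 h2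
    have h3 := h1.2
    rw [h2, Pi.zero_apply] at h3
    have := le_max_left (-w x) 0
    linarith
  · rw [← h2]; exact hn

lemma resolvent_mono (hD : D.IsDirichletForm) (hα : 0 < α) (hfg : ∀ᵐ x ∂m, f x ≤ g x) :
    ∀ᵐ x ∂m, D.resolvent α f x ≤ D.resolvent α g x := by
  have h := hD.resolvent_nonneg hα (f := g - f) (by
    filter_upwards [hfg, Lp.coeFn_sub g f] with x h1 h2
    rw [h2, Pi.sub_apply]
    linarith)
  rw [hD.resolvent_sub hα] at h
  filter_upwards [h, Lp.coeFn_sub (D.resolvent α g) (D.resolvent α f)] with x h1 h2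
  rw [h2, Pi.sub_apply] at h1
  linarith

lemma abs_resolvent_le (hD : D.IsDirichletForm) (hα : 0 < α) (f : Lp ℝ 2 m) :
    ∀ᵐ x ∂m, |D.resolvent α f x| ≤ D.resolvent α |f| x := by
  have h1 := hD.resolvent_mono hα (f := f) (g := |f|) (by
    filter_upwards [Lp.coeFn_abs f] with x h
    rw [h]; exact le_abs_self _)
  have h2 := hD.resolvent_mono hα (f := (-1 : ℝ) • f) (g := |f|) (by
    filter_upwards [Lp.coeFn_abs f, Lp.coeFn_smul (-1 : ℝ) f] with x h h'
    rw [h, h', Pi.smul_apply, neg_one_smul]; exact neg_le_abs _)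
  rw [hD.resolvent_smul hα] at h2
  filter_upwards [h1, h2, Lp.coeFn_smul (-1 : ℝ) (D.resolvent α f)] with x h1 h2 h3
  rw [h3, Pi.smul_apply, neg_one_smul] at h2
  exact abs_le.2 ⟨by linarith, h1⟩

lemma resolvent_eq (hD : D.IsDirichletForm) (hα : 0 < α) (hβ : 0 < β) (f : Lp ℝ 2 m) :
    D.resolvent α f = D.resolvent β f + (β - α) • D.resolvent β (D.resolvent α f) := by
  rw [← hD.resolvent_smul hβ, ← hD.resolvent_add hβ]
  refine hD.eq_resolvent hβ ⟨hD.resolvent_mem hα f, fun v hv => ?_⟩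
  rw [inner_add_left, real_inner_smul_left, ← hD.order_resolvent hα f hv]
  simp only [order]
  ring

lemma smul_resolvent_resolvent_le (hD : D.IsDirichletForm)
    (hα : 0 < α) (hβ : 0 < β) (hf : ∀ᵐ x ∂m, 0 ≤ f x) :
    ∀ᵐ x ∂m, (β - α) * D.resolvent β (D.resolvent α f) x ≤ D.resolvent α f x := by
  have h := hD.resolvent_eq hα hβ f
  filter_upwards [hD.resolvent_nonneg hβ hf,
    Lp.coeFn_add (D.resolvent β f) ((β - α) • D.resolvent β (D.resolvent α f)),
    Lp.coeFn_smul (β - α) (D.resolvent β (D.resolvent α f))] with x h1 h2 h3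
  rw [← h, Pi.add_apply, h3, Pi.smul_apply, smul_eq_mul] at h2
  linarith

lemma resolvent_anti (hD : D.IsDirichletForm) (hα : 0 < α) (hαβ : α ≤ β) (hf : ∀ᵐ x ∂m, 0 ≤ f x) :
    ∀ᵐ x ∂m, D.resolvent β f x ≤ D.resolvent α f x := by
  have hβ := hα.trans_le hαβ
  have h := hD.resolvent_eq hα hβ f
  filter_upwards [hD.resolvent_nonneg hβ (hD.resolvent_nonneg hα hf),
    Lp.coeFn_add (D.resolvent β f) ((β - α) • D.resolvent β (D.resolvent α f)),
    Lp.coeFn_smul (β - α) (D.resolvent β (D.resolvent α f))] with x h1 h2 h3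
  rw [← h, Pi.add_apply, h3, Pi.smul_apply, smul_eq_mul] at h2
  have := mul_nonneg (sub_nonneg.2 hαβ) h1
  linarith

lemma _root_.Dense.eq_zero_of_inner_eq_zero {H : Type*} [NormedAddCommGroup H]
    [InnerProductSpace ℝ H] {s : Set H} (hs : Dense s) {x : H} (h : ∀ y ∈ s, inner ℝ x y = 0) :
    x = 0 := by
  have h1 : (fun y => inner ℝ x y) = fun _ => (0 : ℝ) :=
    Continuous.ext_on hs (by fun_prop) continuous_const h
  exact inner_self_eq_zero.1 (congrFun h1 x)

lemma resolvent_eq_zero (hD : D.IsDirichletForm)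
    (hα : 0 < α) (h : D.resolvent α f = 0) : f = 0 := by
  refine hD.dense.eq_zero_of_inner_eq_zero fun v hv => ?_
  rw [← hD.order_resolvent hα f hv, h]
  have h1 := (hD.shift hα.le).smul_left 0 _ hD.zero_mem _ hv
  rwa [zero_smul, zero_mul] at h1

lemma _root_.MeasureTheory.Lp.exists_indicator_ae_eq (f : Lp ℝ 2 m) {A : Set E}
    (hA : MeasurableSet A) : ∃ g : Lp ℝ 2 m, ∀ᵐ x ∂m, g x = A.indicator f x :=
  Lp.exists_coeFn_ae_eq_of_abs_le f ((Lp.aestronglyMeasurable f).indicator hA)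
    (.of_forall fun x => by
      by_cases hx : x ∈ A <;> simp [hx])

/-- Let `g` be `f` restricted to the set where `G_α f` vanishes. By symmetry `(f, G_α g) = (G_α f,
g) = 0`, so `G_α g = 0` as `f > 0`, and `g = 0` because `G_α` is injective. -/
lemma resolvent_pos (hD : D.IsDirichletForm) (hα : 0 < α) (hf : ∀ᵐ x ∂m, 0 < f x) :
    ∀ᵐ x ∂m, 0 < D.resolvent α f x := by
  have hA : MeasurableSet {x | D.resolvent α f x ≤ 0} :=
    (Lp.stronglyMeasurable (D.resolvent α f)).measurable measurableSet_Iic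
  have hr := hD.resolvent_nonneg hα (hf.mono fun x hx => hx.le)
  obtain ⟨g, hg⟩ := Lp.exists_indicator_ae_eq f hA
  have hg0 : ∀ᵐ x ∂m, 0 ≤ g x := by
    filter_upwards [hf, hg] with x h1 h2
    rw [h2]
    exact Set.indicator_apply_nonneg fun _ => h1.le
  have h1 : inner ℝ f (D.resolvent α g) = 0 := by
    rw [hD.inner_resolvent_comm hα, Lp.real_inner_eq_integral]
    refine integral_eq_zero_of_ae ?_
    filter_upwards [hg, hr] with x h1 h2
    rw [h1, Pi.zero_apply]
    by_cases hx : D.resolvent α f x ≤ 0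
    · rw [le_antisymm hx h2, zero_mul]
    · rw [Set.indicator_of_notMem (by simpa using hx), mul_zero]
  have hrg := hD.resolvent_nonneg hα hg0
  rw [Lp.real_inner_eq_integral, integral_eq_zero_iff_of_nonneg_ae (by
    filter_upwards [hf, hrg] with x h1 h2 using mul_nonneg h1.le h2)
    (Lp.integrable_mul_coeFn _ _)] at h1
  have h2 : D.resolvent α g = 0 := by
    apply Lp.ext
    filter_upwards [h1, hf, Lp.coeFn_zero ℝ 2 m] with x h1 h2 h3
    rw [h3]
    exact (mul_eq_zero.1 h1).resolve_left h2.ne'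
  have h3 := hD.resolvent_eq_zero hα h2
  rw [h3] at hg
  filter_upwards [hg, hf, Lp.coeFn_zero ℝ 2 m] with x h1 h2 h3
  by_contra! h4
  rw [h3, Set.indicator_of_mem (show x ∈ {x | D.resolvent α f x ≤ 0} from h4)] at h1
  exact h2.ne h1

end IsDirichletForm

end L2Form

/-! ### Recurrence and transience -/

lemma ENNReal.ofReal_mul_sub_le {a z u : ℝ} {p : ℝ≥0∞} (ha : 0 ≤ a) (hu : 0 ≤ u)
    (hp : ENNReal.ofReal u ≤ p) :
    ENNReal.ofReal a * (ENNReal.ofReal z - p) ≤ ENNReal.ofReal (a * max (z - u) 0) := by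
  rw [ENNReal.ofReal_mul ha]
  gcongr
  calc ENNReal.ofReal z - p ≤ ENNReal.ofReal z - ENNReal.ofReal u := tsub_le_tsub_left hp _
    _ = ENNReal.ofReal (z - u) := (ENNReal.ofReal_sub z hu).symm
    _ ≤ _ := ENNReal.ofReal_le_ofReal (le_max_left _ _)

lemma MeasureTheory.exists_integrable_pos_Lp {E : Type*} [MeasurableSpace E] (m : Measure E)
    [SigmaFinite m] : ∃ f : Lp ℝ 2 m, Integrable f m ∧ ∀ᵐ x ∂m, 0 < f x := by
  obtain ⟨g, hg0, hg, hgi⟩ := exists_pos_lintegral_lt_of_sigmaFinite m (one_ne_zero (α := ℝ≥0∞))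
  have hgm : Measurable fun x => min (g x : ℝ) 1 := by fun_prop
  have hint : Integrable (fun x => min (g x : ℝ) 1) m := by
    refine ⟨hgm.aestronglyMeasurable, ?_⟩
    refine lt_of_le_of_lt (lintegral_mono fun x => ?_) (hgi.trans ENNReal.one_lt_top)
    have h0 : 0 ≤ min (g x : ℝ) 1 := le_min (g x).2 zero_le_one
    rw [Real.enorm_eq_ofReal h0]
    calc ENNReal.ofReal (min (g x : ℝ) 1) ≤ ENNReal.ofReal (g x) :=
          ENNReal.ofReal_le_ofReal (min_le_left _ _)
      _ = g x := ENNReal.ofReal_coe_nnreal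
  have hmem : MemLp (fun x => min (g x : ℝ) 1) 2 m := by
    refine (memLp_two_iff_integrable_sq hgm.aestronglyMeasurable).2
      (hint.mono (hgm.pow_const 2).aestronglyMeasurable (.of_forall fun x => ?_))
    have h0 : 0 ≤ min (g x : ℝ) 1 := le_min (g x).2 zero_le_one
    have h1 : min (g x : ℝ) 1 ≤ 1 := min_le_right _ _
    rw [Real.norm_of_nonneg (by positivity), Real.norm_of_nonneg h0]
    nlinarith
  refine ⟨hmem.toLp _, hint.congr hmem.coeFn_toLp.symm, ?_⟩
  filter_upwards [hmem.coeFn_toLp] with x hx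
  rw [hx]
  exact lt_min (hg0 x) one_pos

namespace L2Form

variable {E : Type*} [MeasurableSpace E] {m : Measure E} {D : L2Form m}

lemma measurable_potential (D : L2Form m) (f : Lp ℝ 2 m) : Measurable (D.potential f) :=
  .iSup fun _ => (Lp.stronglyMeasurable _).measurable.ennreal_ofReal

lemma ofReal_resolvent_le_potential (D : L2Form m) (f : Lp ℝ 2 m) (n : ℕ) (x : E) :
    ENNReal.ofReal (D.resolvent (1 / ((n : ℝ) + 1)) f x) ≤ D.potential f x :=
  le_iSup (fun n : ℕ => ENNReal.ofReal (D.resolvent (1 / ((n : ℝ) + 1)) f x)) n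

/-- The constant `1` is, for every `ε > 0`, an a.e. limit of functions of energy at most `ε`. -/
def ApproximatesOne (D : L2Form m) : Prop :=
  ∀ ε > 0, ∃ w : ℕ → Lp ℝ 2 m, (∀ n, w n ∈ D.domain ∧ D.energy (w n) ≤ ε) ∧
    ∀ᵐ x ∂m, Tendsto (fun n => w n x) atTop (𝓝 1)

namespace IsDirichletForm

variable {u v w f g : Lp ℝ 2 m} {α β : ℝ}

lemma ae_monotone_resolvent (hD : D.IsDirichletForm) (hf : ∀ᵐ x ∂m, 0 ≤ f x) :
    ∀ᵐ x ∂m, Monotone fun n : ℕ => D.resolvent (1 / ((n : ℝ) + 1)) f x := by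
  have h : ∀ n : ℕ, ∀ᵐ x ∂m, D.resolvent (1 / ((n : ℝ) + 1)) f x
      ≤ D.resolvent (1 / (((n + 1 : ℕ) : ℝ) + 1)) f x := fun n =>
    hD.resolvent_anti (by positivity) (by push_cast; gcongr; linarith) hf
  filter_upwards [ae_all_iff.2 h] with x hx
  exact monotone_nat_of_le_succ hx

lemma ae_resolvent_nonneg (hD : D.IsDirichletForm) (hf : ∀ᵐ x ∂m, 0 ≤ f x) :
    ∀ᵐ x ∂m, ∀ n : ℕ, 0 ≤ D.resolvent (1 / ((n : ℝ) + 1)) f x :=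
  ae_all_iff.2 fun _ => hD.resolvent_nonneg (by positivity) hf

/-- `toFun_posPart_sub_le` for `𝓔_α` with `u = G_α f` reads `(f, (v - G_α f)⁺) ≤ 𝓔_α(v) / 4`; then
`α ↓ 0`. It says that a function of small energy cannot exceed `G f` by much where `f` is positive.
-/
lemma lintegral_mul_sub_potential_le (hD : D.IsDirichletForm)
    (hf : ∀ᵐ x ∂m, 0 ≤ f x) (hv : v ∈ D.domain) :
    ∫⁻ x, ENNReal.ofReal (f x) * (ENNReal.ofReal (v x) - D.potential f x) ∂m
      ≤ ENNReal.ofReal (D.energy v / 4) := by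
  have key : ∀ n : ℕ, ∫⁻ x, ENNReal.ofReal (f x) * (ENNReal.ofReal (v x) - D.potential f x) ∂m
      ≤ ENNReal.ofReal ((D.energy v + 1 / ((n : ℝ) + 1) * ‖v‖ ^ 2) / 4) := fun n => by
    have hα : 0 < 1 / ((n : ℝ) + 1) := by positivity
    set α := 1 / ((n : ℝ) + 1) with hαdef
    have hS := hD.shift hα.le
    have hu := hD.resolvent_mem hα f
    set u := D.resolvent α f with hudef
    have hp := (hD.posPart_mem (hD.sub_mem hv hu)).1
    have h1 := hS.toFun_posPart_sub_le hu hv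
    rw [energy_shift] at h1
    have h2 : (D.shift α).toFun u ((v - u) ⊔ 0) = inner ℝ f ((v - u) ⊔ 0) :=
      hD.order_resolvent hα f hp
    have hae : ∀ᵐ x ∂m, ((v - u) ⊔ 0) x = max (v x - u x) 0 := by
      filter_upwards [Lp.coeFn_sup (v - u) 0, Lp.coeFn_zero ℝ 2 m, Lp.coeFn_sub v u]
        with x h1 h2 h3
      rw [h1, Pi.sup_apply, h2, h3]
      rfl
    rw [h2, Lp.real_inner_eq_integral] at h1
    refine le_trans ?_ (ENNReal.ofReal_le_ofReal h1)
    rw [ofReal_integral_eq_lintegral_ofReal (Lp.integrable_mul_coeFn _ _)]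
    · refine lintegral_mono_ae ?_
      filter_upwards [hf, hae, hD.resolvent_nonneg hα hf] with x h1 h2 h3
      rw [h2]
      exact ENNReal.ofReal_mul_sub_le h1 h3 (D.ofReal_resolvent_le_potential f n x)
    · filter_upwards [hf, hae] with x h1 h2
      rw [h2]
      exact mul_nonneg h1 (le_max_right _ _)
  have hlim : Tendsto (fun n : ℕ => (D.energy v + 1 / ((n : ℝ) + 1) * ‖v‖ ^ 2) / 4) atTop
      (𝓝 (D.energy v / 4)) := by
    simpa using ((((tendsto_one_div_add_atTop_nhds_zero_nat (𝕜 := ℝ)).mul_const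
      (‖v‖ ^ 2)).const_add (D.energy v)).div_const 4)
  exact ge_of_tendsto' (ENNReal.tendsto_ofReal hlim) key

/-- Insert `c w_n`, with `w_n → 1` of small energy, in `lintegral_mul_sub_potential_le`. Fatou's
lemma gives `∫ f (c - G f)⁺ = 0` for every `c`. -/
lemma potential_eq_top_of_pos (hD : D.IsDirichletForm)
    (h1 : D.ApproximatesOne) (hf : ∀ᵐ x ∂m, 0 ≤ f x) :
    ∀ᵐ x ∂m, 0 < f x → D.potential f x = ∞ := by
  have hfm : Measurable fun x => ENNReal.ofReal (f x) :=
    (Lp.stronglyMeasurable f).measurable.ennreal_ofReal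
  have key : ∀ c : ℕ, ∫⁻ x, ENNReal.ofReal (f x) * (ENNReal.ofReal c - D.potential f x) ∂m = 0 := by
    intro c
    refine le_antisymm (ENNReal.le_of_forall_pos_le_add fun ε hε _ => ?_) zero_le
    have hε' : (0 : ℝ) < ε := hε
    -- This level makes `𝓔(c w_n) / 4` at most `c² ε / (c² + 1) ≤ ε`, including for `c = 0`.
    obtain ⟨w, hw, hlim⟩ := h1 (4 * ε / ((c : ℝ) ^ 2 + 1)) (by positivity)
    rw [zero_add]
    calc ∫⁻ x, ENNReal.ofReal (f x) * (ENNReal.ofReal c - D.potential f x) ∂m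
        ≤ ∫⁻ x, liminf (fun n => ENNReal.ofReal (f x) *
            (ENNReal.ofReal (((c : ℝ) • w n) x) - D.potential f x)) atTop ∂m := by
          refine lintegral_mono_ae ?_
          filter_upwards [hlim, ae_all_iff.2 fun n => Lp.coeFn_smul (c : ℝ) (w n)] with x h2 h3
          refine le_of_eq (Tendsto.liminf_eq ?_).symm
          refine ENNReal.Tendsto.const_mul ?_ (.inr ENNReal.ofReal_ne_top)
          refine ENNReal.Tendsto.sub (ENNReal.tendsto_ofReal ?_) tendsto_const_nhds
            (.inl ENNReal.ofReal_ne_top)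
          simp only [h3, Pi.smul_apply, smul_eq_mul]
          simpa using h2.const_mul (c : ℝ)
      _ ≤ liminf (fun n => ∫⁻ x, ENNReal.ofReal (f x) *
            (ENNReal.ofReal (((c : ℝ) • w n) x) - D.potential f x) ∂m) atTop :=
          lintegral_liminf_le fun n => hfm.mul
            ((Lp.stronglyMeasurable _).measurable.ennreal_ofReal.sub (D.measurable_potential f))
      _ ≤ ε := by
          refine liminf_le_of_le (h := fun b hb => ?_)
          obtain ⟨n, hn⟩ := hb.exists
          refine hn.trans ((hD.lintegral_mul_sub_potential_le hf
            (hD.smul_mem _ _ (hw n).1)).trans ?_)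
          rw [hD.energy_smul _ (hw n).1]
          rw [← ENNReal.ofReal_coe_nnreal]
          refine ENNReal.ofReal_le_ofReal ?_
          have h2 := (hw n).2
          rw [le_div_iff₀ (by positivity)] at h2
          have := hD.energy_nonneg (hw n).1
          linarith
  have key2 : ∀ c : ℕ, ∀ᵐ x ∂m,
      ENNReal.ofReal (f x) * (ENNReal.ofReal c - D.potential f x) = 0 := fun c =>
    (lintegral_eq_zero_iff (hfm.mul (measurable_const.sub (D.measurable_potential f)))).1 (key c)
  filter_upwards [ae_all_iff.2 key2] with x hx hfx
  refine ENNReal.eq_top_of_forall_nnreal_le fun r => ?_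
  obtain ⟨c, hc⟩ := exists_nat_ge (r : ℝ)
  have h2 := (mul_eq_zero.1 (hx c)).resolve_left (by simpa using hfx)
  refine le_trans ?_ (tsub_eq_zero_iff_le.1 h2)
  rw [← ENNReal.ofReal_coe_nnreal]
  exact ENNReal.ofReal_le_ofReal hc

/-- Where `G f > 0`, some `h = G_α f` is positive, so `G h = ∞` there. The resolvent equation bounds
`G h` by a multiple of `G f`, whence `G f = ∞`. -/
lemma isRecurrent_of_approximatesOne (hD : D.IsDirichletForm)
    (h1 : D.ApproximatesOne) : D.IsRecurrent := by
  intro f _ hf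
  have hpos : ∀ n : ℕ, (0 : ℝ) < 1 / ((n : ℝ) + 1) := fun n => by positivity
  have h2 : ∀ n : ℕ, ∀ᵐ x ∂m, 0 < D.resolvent (1 / ((n : ℝ) + 1)) f x →
      D.potential (D.resolvent (1 / ((n : ℝ) + 1)) f) x = ∞ := fun n =>
    hD.potential_eq_top_of_pos h1 (hD.resolvent_nonneg (hpos n) hf)
  have h3 : ∀ n k : ℕ, ∀ᵐ x ∂m, (1 / ((n : ℝ) + 1) - 1 / ((k : ℝ) + 1)) *
      D.resolvent (1 / ((k : ℝ) + 1)) (D.resolvent (1 / ((n : ℝ) + 1)) f) x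
        ≤ D.resolvent (1 / ((k : ℝ) + 1)) f x := fun n k => by
    have h4 := hD.resolvent_eq (hpos k) (hpos n) f
    have h5 := hD.resolvent_eq (hpos n) (hpos k) f
    have h6 : D.resolvent (1 / ((k : ℝ) + 1)) f = D.resolvent (1 / ((n : ℝ) + 1)) f
        + (1 / ((n : ℝ) + 1) - 1 / ((k : ℝ) + 1)) •
          D.resolvent (1 / ((k : ℝ) + 1)) (D.resolvent (1 / ((n : ℝ) + 1)) f) := by
      conv_rhs => enter [1]; rw [h5]
      module
    filter_upwards [hD.resolvent_nonneg (hpos n) hf,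
      Lp.coeFn_add (D.resolvent (1 / ((n : ℝ) + 1)) f)
      ((1 / ((n : ℝ) + 1) - 1 / ((k : ℝ) + 1)) •
          D.resolvent (1 / ((k : ℝ) + 1)) (D.resolvent (1 / ((n : ℝ) + 1)) f)),
      Lp.coeFn_smul (1 / ((n : ℝ) + 1) - 1 / ((k : ℝ) + 1))
          (D.resolvent (1 / ((k : ℝ) + 1)) (D.resolvent (1 / ((n : ℝ) + 1)) f))] with x h7 h8 h9
    rw [← h6, Pi.add_apply, h9, Pi.smul_apply, smul_eq_mul] at h8
    linarith
  have hmono : ∀ n : ℕ, ∀ᵐ x ∂m, Monotone fun k : ℕ =>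
      D.resolvent (1 / ((k : ℝ) + 1)) (D.resolvent (1 / ((n : ℝ) + 1)) f) x := fun n =>
    hD.ae_monotone_resolvent (hD.resolvent_nonneg (hpos n) hf)
  filter_upwards [ae_all_iff.2 h2, ae_all_iff.2 fun n => ae_all_iff.2 (h3 n), ae_all_iff.2 hmono]
    with x h4 h5 h6
  by_contra! hx
  obtain ⟨hx0, hxt⟩ := hx
  have hex : ∃ n : ℕ, 0 < D.resolvent (1 / ((n : ℝ) + 1)) f x := by
    by_contra! h
    refine hx0 ?_
    rw [potential, ENNReal.iSup_eq_zero]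
    exact fun n => ENNReal.ofReal_eq_zero.2 (h n)
  obtain ⟨n, hn⟩ := hex
  have htop := h4 n hn
  -- The difference `1/(n+1) - 1/(k+1)` is bounded below by this `δ` for `k ≥ n + 1`; smaller `k`
  -- are covered by monotonicity in `k`.
  set δ := 1 / ((n : ℝ) + 1) - 1 / (((n + 1 : ℕ) : ℝ) + 1) with hδ
  have hδ0 : 0 < δ := by
    rw [hδ, sub_pos]
    push_cast
    gcongr
    linarith
  have hle : D.potential (D.resolvent (1 / ((n : ℝ) + 1)) f) x
      ≤ ENNReal.ofReal (1 / δ * (D.potential f x).toReal) := by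
    refine iSup_le fun k => ENNReal.ofReal_le_ofReal ?_
    refine (h6 n (le_max_left k (n + 1))).trans ?_
    have h7 := h5 n (max k (n + 1))
    have h8 := D.ofReal_resolvent_le_potential f (max k (n + 1)) x
    rw [ENNReal.ofReal_le_iff_le_toReal hxt] at h8
    have h9 : δ ≤ 1 / ((n : ℝ) + 1) - 1 / (((max k (n + 1) : ℕ) : ℝ) + 1) := by
      rw [hδ]
      gcongr
      exact le_max_right _ _
    beta_reduce
    set r := D.resolvent (1 / (((max k (n + 1) : ℕ) : ℝ) + 1))
      (D.resolvent (1 / ((n : ℝ) + 1)) f) x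
    rw [one_div, ← div_eq_inv_mul, le_div_iff₀ hδ0]
    rcases le_total r 0 with hr | hr
    · exact (mul_nonpos_of_nonpos_of_nonneg hr hδ0.le).trans ENNReal.toReal_nonneg
    · calc r * δ ≤ r * (1 / ((n : ℝ) + 1) - 1 / (((max k (n + 1) : ℕ) : ℝ) + 1)) := by gcongr
        _ ≤ _ := by linarith
  rw [htop] at hle
  exact absurd hle (by simp)

/-- The approximants are `c⁻¹ (G_α f ∧ c)`. Since `𝓔_α(G_α f ∧ c) ≤ 𝓔_α(G_α f, G_α f ∧ c) = (f, G_α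
f ∧ c) ≤ c ∫ f`, their energy is at most `c⁻¹ ∫ f`. -/
lemma approximatesOne_of_potential_eq_top (hD : D.IsDirichletForm)
    (hfi : Integrable f m) (hf : ∀ᵐ x ∂m, 0 ≤ f x)
    (htop : ∀ᵐ x ∂m, D.potential f x = ∞) : D.ApproximatesOne := by
  intro ε hε
  have hpos : ∀ n : ℕ, (0 : ℝ) < 1 / ((n : ℝ) + 1) := fun n => by positivity
  have hI : 0 ≤ ∫ x, f x ∂m := integral_nonneg_of_ae hf
  -- Large enough for `c⁻¹ ∫ f ≤ ε`, and positive even when `∫ f = 0`.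
  obtain ⟨c, hc0, hc⟩ : ∃ c : ℝ, 0 < c ∧ (∫ x, f x ∂m) ≤ c * ε :=
    ⟨(∫ x, f x ∂m) / ε + 1, by positivity, by
      rw [add_mul, div_mul_cancel₀ _ hε.ne']; linarith⟩
  have hu0 := hD.ae_resolvent_nonneg hf
  choose v hv hvu hvE using fun n : ℕ =>
    hD.exists_trunc (hD.resolvent_mem (hpos n) f) hc0.le
  have hvu' : ∀ n : ℕ, ∀ᵐ x ∂m, v n x = min (D.resolvent (1 / ((n : ℝ) + 1)) f x) c := fun n => by
    filter_upwards [hvu n, hu0] with x h1 h2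
    rw [h1, max_eq_right (le_min (h2 n) hc0.le)]
  refine ⟨fun n => c⁻¹ • v n, fun n => ⟨hD.smul_mem _ _ (hv n), ?_⟩, ?_⟩
  · have hS := hD.shift (hpos n).le
    have h1 := hS.energy_min_const_le (hD.resolvent_mem (hpos n) f)
      (hu0.mono fun x h => h n) (hv n) hc0.le (hvu' n)
    have h2 := D.energy_le_order (hpos n).le (v n)
    have h3 := hD.order_resolvent (hpos n) f (hv n)
    have h4 : inner ℝ f (v n) ≤ c * ∫ x, f x ∂m := by
      rw [Lp.real_inner_eq_integral, ← integral_const_mul]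
      refine integral_mono_ae (Lp.integrable_mul_coeFn _ _) (hfi.const_mul c) ?_
      filter_upwards [hf, hvu' n] with x h5 h6
      rw [h6, mul_comm]
      exact mul_le_mul_of_nonneg_right (min_le_right _ _) h5
    have h5 : D.energy (v n) ≤ c * ∫ x, f x ∂m := by
      refine h2.trans (le_trans ?_ h4)
      rw [← h3]
      exact h1
    rw [hD.energy_smul _ (hv n)]
    calc c⁻¹ ^ 2 * D.energy (v n) ≤ c⁻¹ ^ 2 * (c * (c * ε)) := by
          gcongr
          exact h5.trans (by gcongr)
      _ = ε := by field_simp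
  · filter_upwards [ae_all_iff.2 hvu', htop, hD.ae_monotone_resolvent hf,
      ae_all_iff.2 fun n => Lp.coeFn_smul c⁻¹ (v n)] with x h1 h2 h3 h4
    refine tendsto_const_nhds.congr' ?_
    have hex : ∃ n : ℕ, c ≤ D.resolvent (1 / ((n : ℝ) + 1)) f x := by
      by_contra! h
      have : D.potential f x ≤ ENNReal.ofReal c :=
        iSup_le fun n => ENNReal.ofReal_le_ofReal (h n).le
      rw [h2] at this
      exact absurd this (by simp)
    obtain ⟨N, hN⟩ := hex
    filter_upwards [eventually_ge_atTop N] with n hn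
    rw [h4, Pi.smul_apply, h1, min_eq_right (hN.trans (h3 hn)), smul_eq_mul,
      inv_mul_cancel₀ hc0.ne']

lemma potential_pos (hD : D.IsDirichletForm)
    (hf : ∀ᵐ x ∂m, 0 < f x) : ∀ᵐ x ∂m, 0 < D.potential f x := by
  filter_upwards [hD.resolvent_pos (α := 1 / (((0 : ℕ) : ℝ) + 1)) (by positivity) hf] with x hx
  exact (ENNReal.ofReal_pos.2 hx).trans_le (D.ofReal_resolvent_le_potential f 0 x)

/-- Recurrence applied to a strictly positive `f` leaves only `G f = ∞`, because `G f > 0`. -/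
lemma isRecurrent_iff_approximatesOne (hD : D.IsDirichletForm)
    [SigmaFinite m] : D.IsRecurrent ↔ D.ApproximatesOne := by
  refine ⟨fun h => ?_, hD.isRecurrent_of_approximatesOne⟩
  obtain ⟨f, hfi, hf⟩ := exists_integrable_pos_Lp m
  have hf' : ∀ᵐ x ∂m, 0 ≤ f x := hf.mono fun x hx => hx.le
  refine hD.approximatesOne_of_potential_eq_top hfi hf' ?_
  filter_upwards [h f hfi hf', hD.potential_pos hf] with x h1 h2
  exact h1.resolve_left h2.ne'

lemma not_isTransient_of_isRecurrent (hD : D.IsDirichletForm)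
    [NeZero m] (h : D.IsRecurrent) : ¬ D.IsTransient := by
  rintro ⟨g, hgi, hg, hlt⟩
  have : ∀ᵐ _ ∂m, False := by
    filter_upwards [h g hgi (hg.mono fun x hx => hx.le), hD.potential_pos hg, hlt] with x h1 h2 h3
    exact h1.elim h2.ne' h3.ne
  rw [eventually_false_iff_eq_bot, ae_eq_bot] at this
  exact NeZero.ne m this

/-- Transience is inherited by a form with smaller domain and larger energy. -/
lemma isTransient_of_le (hD : D.IsDirichletForm) {D' : L2Form m} (hD' : D'.IsDirichletForm)
    (hdom : D'.domain ⊆ D.domain) (hle : ∀ u ∈ D'.domain, D.energy u ≤ D'.energy u)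
    (h : D.IsTransient) : D'.IsTransient := by
  obtain ⟨g, hgi, hg, hlt⟩ := h
  have hpos : ∀ n : ℕ, (0 : ℝ) < 1 / ((n : ℝ) + 1) := fun n => by positivity
  set p : E → ℝ := fun x => (D.potential g x).toReal with hp
  have hpm : Measurable p := (D.measurable_potential g).ennreal_toReal
  have hp0 : ∀ x, 0 ≤ p x := fun x => ENNReal.toReal_nonneg
  -- The weight `1 / (1 + G g)` gives `g' G g' ≤ g' G g ≤ g`, which is integrable.
  obtain ⟨g', hg'⟩ := Lp.exists_coeFn_ae_eq_of_abs_le g (f := fun x => g x / (1 + p x))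
    ((Lp.stronglyMeasurable g).measurable.div (measurable_const.add hpm)).aestronglyMeasurable
    (.of_forall fun x => by
      rw [abs_div, abs_of_pos (show 0 < 1 + p x by linarith [hp0 x])]
      exact div_le_self (abs_nonneg _) (by linarith [hp0 x]))
  have hg'pos : ∀ᵐ x ∂m, 0 < g' x := by
    filter_upwards [hg, hg'] with x h1 h2
    rw [h2]
    have := hp0 x
    positivity
  have hg'le : ∀ᵐ x ∂m, g' x ≤ g x := by
    filter_upwards [hg, hg'] with x h1 h2
    rw [h2]
    exact div_le_self h1.le (by linarith [hp0 x])
  have hg'int : Integrable g' m := by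
    refine hgi.mono (Lp.aestronglyMeasurable g') ?_
    filter_upwards [hg'pos, hg'le] with x h1 h2
    rw [Real.norm_of_nonneg h1.le, Real.norm_of_nonneg (h1.le.trans h2)]
    exact h2
  refine ⟨g', hg'int, hg'pos, ?_⟩
  -- Let `a = (g', G'_α g')` and `b = (g', G_α g')`. Cauchy-Schwarz for `𝓔_α` gives `a² ≤ b 𝓔_α(G'_α
  -- g') ≤ b 𝓔'_α(G'_α g') = b a`.
  have hcomp : ∀ n : ℕ, inner ℝ g' (D'.resolvent (1 / ((n : ℝ) + 1)) g')
      ≤ inner ℝ g' (D.resolvent (1 / ((n : ℝ) + 1)) g') := fun n => by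
    have h1 := hD'.resolvent_mem (hpos n) g'
    have h2 := hD.resolvent_mem (hpos n) g'
    have h3 := (hD.shift (hpos n).le).cauchy_schwarz h2 (hdom h1)
    have h4 : (D.shift (1 / ((n : ℝ) + 1))).toFun (D.resolvent (1 / ((n : ℝ) + 1)) g')
        (D'.resolvent (1 / ((n : ℝ) + 1)) g') = inner ℝ g' (D'.resolvent (1 / ((n : ℝ) + 1)) g') :=
      hD.order_resolvent (hpos n) g' (hdom h1)
    have h5 : (D.shift (1 / ((n : ℝ) + 1))).energy (D.resolvent (1 / ((n : ℝ) + 1)) g')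
        = inner ℝ g' (D.resolvent (1 / ((n : ℝ) + 1)) g') := hD.order_resolvent (hpos n) g' h2
    have h6 : (D'.shift (1 / ((n : ℝ) + 1))).energy (D'.resolvent (1 / ((n : ℝ) + 1)) g')
        = inner ℝ g' (D'.resolvent (1 / ((n : ℝ) + 1)) g') := hD'.order_resolvent (hpos n) g' h1
    have h7 : (D.shift (1 / ((n : ℝ) + 1))).energy (D'.resolvent (1 / ((n : ℝ) + 1)) g')
        ≤ (D'.shift (1 / ((n : ℝ) + 1))).energy (D'.resolvent (1 / ((n : ℝ) + 1)) g') := by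
      rw [energy_shift, energy_shift]
      linarith [hle _ h1]
    rw [h4, h5] at h3
    rw [h6] at h7
    have h8 := (hD.shift (hpos n).le).energy_nonneg h2
    rw [h5] at h8
    have h9 := (hD'.shift (hpos n).le).energy_nonneg h1
    rw [h6] at h9
    set a := inner ℝ g' (D'.resolvent (1 / ((n : ℝ) + 1)) g')
    set b := inner ℝ g' (D.resolvent (1 / ((n : ℝ) + 1)) g')
    rcases h9.eq_or_lt with h | h
    · rw [← h]; exact h8
    · have h10 : a * a ≤ b * a := by nlinarith
      exact le_of_mul_le_mul_right h10 h
  have hbound : ∀ n : ℕ, inner ℝ g' (D.resolvent (1 / ((n : ℝ) + 1)) g') ≤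
      ∫ x, g x ∂m := fun n => by
    rw [Lp.real_inner_eq_integral]
    refine integral_mono_ae (Lp.integrable_mul_coeFn _ _) hgi ?_
    filter_upwards [hg', hg, hlt, hD.resolvent_mono (hpos n) hg'le] with x h1 h2 h3 h4
    have h5 := D.ofReal_resolvent_le_potential g n x
    rw [ENNReal.ofReal_le_iff_le_toReal h3.ne] at h5
    rw [h1, div_mul_eq_mul_div, div_le_iff₀ (by linarith [hp0 x])]
    have : D.resolvent (1 / ((n : ℝ) + 1)) g' x ≤ 1 + p x := by
      have : p x = (D.potential g x).toReal := rfl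
      linarith
    gcongr
  have hnn := hD'.ae_resolvent_nonneg (f := g') (hg'pos.mono fun x h => h.le)
  have hfin : ∫⁻ x, ENNReal.ofReal (g' x) * D'.potential g' x ∂m ≤
      ENNReal.ofReal (∫ x, g x ∂m) := by
    simp only [potential, ENNReal.mul_iSup]
    rw [lintegral_iSup']
    · refine iSup_le fun n => ?_
      calc _ = ENNReal.ofReal (inner ℝ g' (D'.resolvent (1 / ((n : ℝ) + 1)) g')) := by
            rw [Lp.real_inner_eq_integral, ofReal_integral_eq_lintegral_ofReal
              (Lp.integrable_mul_coeFn _ _)]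
            · refine lintegral_congr_ae ?_
              filter_upwards [hg'pos] with x h1
              rw [ENNReal.ofReal_mul h1.le]
            · filter_upwards [hg'pos, hnn] with x h1 h2
              exact mul_nonneg h1.le (h2 n)
        _ ≤ _ := ENNReal.ofReal_le_ofReal ((hcomp n).trans (hbound n))
    · exact fun n => ((Lp.stronglyMeasurable g').measurable.ennreal_ofReal.mul
        (Lp.stronglyMeasurable _).measurable.ennreal_ofReal).aemeasurable
    · filter_upwards [hD'.ae_monotone_resolvent (f := g') (hg'pos.mono fun x h => h.le)] with x h1
      intro n k hnk
      exact mul_le_mul_right (ENNReal.ofReal_le_ofReal (h1 hnk)) _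
  have h1 := ae_lt_top ((Lp.stronglyMeasurable g').measurable.ennreal_ofReal.mul
    (D'.measurable_potential g')) (hfin.trans_lt ENNReal.ofReal_lt_top).ne
  filter_upwards [h1, hg'pos] with x h2 h3
  by_contra h4
  rw [not_lt, top_le_iff] at h4
  rw [Pi.mul_apply, h4, ENNReal.mul_top (by simpa using h3)] at h2
  exact lt_irrefl _ h2

end IsDirichletForm

end L2Form

/-! ### Invariant sets and the approximating forms -/

namespace L2Form

variable {E : Type*} [MeasurableSpace E] {m : Measure E} {D : L2Form m}

namespace IsDirichletForm

variable {u v w f g : Lp ℝ 2 m} {α β : ℝ}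

/-- For `h` living on `{G f = ∞}`, the functions `y_n = G_{α_n} f ∧ k h` tend to `k h` in `L²`, and
`(β - α_n) G_β y_n ≤ G_{α_n} f ≤ G f` by the resolvent equation. In the limit `β k G_β h ≤ G f` for
every `k`, so `G_β h` vanishes where `G f` is finite. This is what makes `{G f = ∞}` invariant. -/
lemma resolvent_eq_zero_of_potential_lt_top (hD : D.IsDirichletForm)
    {h : Lp ℝ 2 m} (hf : ∀ᵐ x ∂m, 0 ≤ f x)
    (hh : ∀ᵐ x ∂m, 0 ≤ h x) (hh0 : ∀ᵐ x ∂m, D.potential f x < ∞ → h x = 0) (hβ : 0 < β) :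
    ∀ᵐ x ∂m, D.potential f x < ∞ → D.resolvent β h x = 0 := by
  have hpos : ∀ n : ℕ, (0 : ℝ) < 1 / ((n : ℝ) + 1) := fun n => by positivity
  have hu0 := hD.ae_resolvent_nonneg hf
  have key : ∀ k : ℕ, ∀ᵐ x ∂m, D.potential f x < ∞ →
      β * (k * D.resolvent β h x) ≤ (D.potential f x).toReal := fun k => by
    set y : ℕ → Lp ℝ 2 m := fun n => D.resolvent (1 / ((n : ℝ) + 1)) f ⊓ ((k : ℝ) • h) with hy
    have hyae : ∀ᵐ x ∂m, ∀ n, y n x = min (D.resolvent (1 / ((n : ℝ) + 1)) f x) (k * h x) := by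
      refine ae_all_iff.2 fun n => ?_
      filter_upwards [Lp.coeFn_inf (D.resolvent (1 / ((n : ℝ) + 1)) f) ((k : ℝ) • h),
        Lp.coeFn_smul (k : ℝ) h] with x h1 h2
      rw [hy, h1, Pi.inf_apply, h2]
      rfl
    have hlim : Tendsto y atTop (𝓝 ((k : ℝ) • h)) := by
      refine Lp.tendsto_of_ae_tendsto_of_abs_le (h := (k : ℝ) • h) (fun n => ?_) ?_
      · filter_upwards [hyae, Lp.coeFn_smul (k : ℝ) h, hh, hu0] with x h1 h2 h3 h4
        have h5 : 0 ≤ (k : ℝ) * h x := by positivity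
        rw [h1, h2, Pi.smul_apply, smul_eq_mul, abs_of_nonneg h5, abs_of_nonneg (le_min (h4 n) h5)]
        exact min_le_right _ _
      · filter_upwards [hyae, Lp.coeFn_smul (k : ℝ) h, hh, hu0, hh0, hD.ae_monotone_resolvent hf]
          with x h1 h2 h3 h4 h5 h6
        rw [h2, Pi.smul_apply, smul_eq_mul]
        refine tendsto_const_nhds.congr' ?_
        by_cases hx : D.potential f x < ∞
        · refine .of_forall fun n => ?_
          beta_reduce
          rw [h1, h5 hx, mul_zero, min_eq_right (h4 n)]
        · have hex : ∃ n : ℕ, k * h x ≤ D.resolvent (1 / ((n : ℝ) + 1)) f x := by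
            by_contra! h
            exact hx (lt_of_le_of_lt (iSup_le fun n => ENNReal.ofReal_le_ofReal (h n).le)
              (ENNReal.ofReal_lt_top (r := k * _)))
          obtain ⟨N, hN⟩ := hex
          filter_upwards [eventually_ge_atTop N] with n hn
          rw [h1, min_eq_right (hN.trans (h6 hn))]
    obtain ⟨ns, hns, hae⟩ := Lp.exists_subseq_ae_tendsto (hD.tendsto_resolvent hβ hlim)
    have hle : ∀ᵐ x ∂m, ∀ n : ℕ, 1 / ((n : ℝ) + 1) ≤ β →
        (β - 1 / ((n : ℝ) + 1)) * D.resolvent β (y n) x ≤ D.resolvent (1 / ((n : ℝ) + 1)) f x := by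
      refine ae_all_iff.2 fun n => ?_
      filter_upwards [hD.smul_resolvent_resolvent_le (hpos n) hβ hf,
        hD.resolvent_mono hβ (f := y n) (g := D.resolvent (1 / ((n : ℝ) + 1)) f) (by
          filter_upwards [hyae] with x h1
          rw [h1]; exact min_le_left _ _)] with x h1 h2 h3
      refine le_trans ?_ h1
      exact mul_le_mul_of_nonneg_left h2 (sub_nonneg.2 h3)
    have hsm := hD.resolvent_smul hβ (k : ℝ) h
    filter_upwards [hae, hle, Lp.coeFn_smul (k : ℝ) (D.resolvent β h)] with x h1 h2 h3 hx
    rw [hsm, h3, Pi.smul_apply, smul_eq_mul] at h1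
    have h4 : Tendsto (fun n => (β - 1 / ((ns n : ℝ) + 1)) * D.resolvent β (y (ns n)) x) atTop
        (𝓝 ((β - 0) * (k * D.resolvent β h x))) :=
      ((tendsto_one_div_add_atTop_nhds_zero_nat.comp hns.tendsto_atTop).const_sub β).mul h1
    rw [sub_zero] at h4
    refine le_of_tendsto h4 ?_
    have h5 : ∀ᶠ n in atTop, 1 / ((ns n : ℝ) + 1) < β :=
      (tendsto_one_div_add_atTop_nhds_zero_nat.comp hns.tendsto_atTop).eventually (gt_mem_nhds hβ)
    filter_upwards [h5] with n hn
    refine (h2 _ hn.le).trans ?_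
    have h6 := D.ofReal_resolvent_le_potential f (ns n) x
    rwa [ENNReal.ofReal_le_iff_le_toReal hx.ne] at h6
  filter_upwards [ae_all_iff.2 key, hD.resolvent_nonneg hβ hh] with x h1 h2 hx
  by_contra h3
  have h4 : 0 < D.resolvent β h x := lt_of_le_of_ne h2 (Ne.symm h3)
  obtain ⟨k, hk⟩ := exists_nat_gt ((D.potential f x).toReal / (β * D.resolvent β h x))
  rw [div_lt_iff₀ (by positivity)] at hk
  have := h1 k hx
  nlinarith

/-- A set which is not left by the resolvent is invariant. -/
lemma isInvariant_of_resolvent_eq_zero (hD : D.IsDirichletForm) {A : Set E} (hA : MeasurableSet A)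
    (h : ∀ β > 0, ∀ h : Lp ℝ 2 m, (∀ᵐ x ∂m, 0 ≤ h x) → (∀ᵐ x ∂m, x ∉ A → h x = 0) →
      ∀ᵐ x ∂m, x ∉ A → D.resolvent β h x = 0) : D.IsInvariant A := by
  intro β hβ f g hg
  have h1 : ∀ᵐ x ∂m, x ∉ A → D.resolvent β |g| x = 0 := by
    refine h β hβ |g| ?_ ?_
    · filter_upwards [Lp.coeFn_abs g] with x hx
      rw [hx]; exact abs_nonneg _
    · filter_upwards [Lp.coeFn_abs g, hg] with x h1 h2 hx
      rw [h1, h2, Set.indicator_of_notMem hx, abs_zero]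
  have h0 : ∀ᵐ x ∂m, 0 ≤ D.resolvent β |f - g| x := by
    refine hD.resolvent_nonneg hβ ?_
    filter_upwards [Lp.coeFn_abs (f - g)] with x h1
    rw [h1]; exact abs_nonneg _
  obtain ⟨k, hk⟩ := Lp.exists_indicator_ae_eq (D.resolvent β |f - g|) hA
  -- The complement is not left either, by symmetry: for `k = 1_A G_β |f - g|`, the integral of `k²`
  -- is `(G_β k, |f - g|)`, and the two factors live on complementary sets.
  have h2 : ∀ᵐ x ∂m, x ∈ A → D.resolvent β |f - g| x = 0 := by
    have h3 : ∀ᵐ x ∂m, x ∉ A → D.resolvent β k x = 0 := by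
      refine h β hβ k ?_ ?_
      · filter_upwards [hk, h0] with x h1 h2
        rw [h1]
        exact Set.indicator_apply_nonneg fun _ => h2
      · filter_upwards [hk] with x h1 hx
        rw [h1, Set.indicator_of_notMem hx]
    have h4 : inner ℝ k (D.resolvent β |f - g|) = 0 := by
      rw [hD.inner_resolvent_comm hβ, Lp.real_inner_eq_integral]
      refine integral_eq_zero_of_ae ?_
      filter_upwards [h3, hg, Lp.coeFn_abs (f - g), Lp.coeFn_sub f g] with x h5 h6 h7 h8
      by_cases hx : x ∈ A
      · rw [h7, h8, Pi.sub_apply, h6, Set.indicator_of_mem hx, sub_self, abs_zero, mul_zero]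
        rfl
      · rw [h5 hx, zero_mul]
        rfl
    rw [Lp.real_inner_eq_integral, integral_eq_zero_iff_of_nonneg_ae ?_
      (Lp.integrable_mul_coeFn _ _)] at h4
    · filter_upwards [h4, hk] with x h5 h6 hx
      rw [h6, Set.indicator_of_mem hx, Pi.zero_apply] at h5
      exact mul_self_eq_zero.1 h5
    · filter_upwards [hk, h0] with x h5 h6
      rw [h5]
      exact mul_nonneg (Set.indicator_apply_nonneg fun _ => h6) h6
  have h3 : D.resolvent β f = D.resolvent β g + D.resolvent β (f - g) := by
    rw [hD.resolvent_sub hβ]; abel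
  filter_upwards [h1, h2, hD.abs_resolvent_le hβ g, hD.abs_resolvent_le hβ (f - g),
    Lp.coeFn_add (D.resolvent β g) (D.resolvent β (f - g))] with x h4 h5 h6 h7 h8
  by_cases hx : x ∈ A
  · rw [h5 hx] at h7
    rw [Set.indicator_of_mem hx, h3, h8, Pi.add_apply, abs_nonpos_iff.1 h7, add_zero]
  · rw [h4 hx] at h6
    rw [Set.indicator_of_notMem hx, abs_nonpos_iff.1 h6]

/-- An irreducible Dirichlet form is transient or recurrent. -/
lemma isTransient_or_approximatesOne (hD : D.IsDirichletForm)
    [SigmaFinite m] (hirr : D.IsIrreducible) :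
    D.IsTransient ∨ D.ApproximatesOne := by
  obtain ⟨f, hfi, hf⟩ := exists_integrable_pos_Lp m
  have hf' : ∀ᵐ x ∂m, 0 ≤ f x := hf.mono fun x hx => hx.le
  have hA : MeasurableSet {x | D.potential f x = ∞} :=
    D.measurable_potential f (measurableSet_singleton ∞)
  have hinv : D.IsInvariant {x | D.potential f x = ∞} := by
    refine hD.isInvariant_of_resolvent_eq_zero hA fun β hβ h hh hh0 => ?_
    have h1 := hD.resolvent_eq_zero_of_potential_lt_top hf' hh (by
      filter_upwards [hh0] with x hx hlt
      exact hx hlt.ne) hβ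
    filter_upwards [h1] with x hx hlt
    exact hx (lt_top_iff_ne_top.2 hlt)
  rcases hirr _ hA hinv with h | h
  · refine .inl ⟨f, hfi, hf, ?_⟩
    filter_upwards [measure_eq_zero_iff_ae_notMem.1 h] with x hx
    exact lt_top_iff_ne_top.2 hx
  · exact .inr (hD.approximatesOne_of_potential_eq_top hfi hf' (mem_ae_iff.2 h))

/-- This is the resolvent equation tested with `G_β u`, times `β²`. It bounds both the energy of `β
G_β u` and its distance to `u` by the approximating form. -/
lemma energy_resolvent_eq (hD : D.IsDirichletForm) (hβ : 0 < β) (u : Lp ℝ 2 m) :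
    D.energy (β • D.resolvent β u) + β * ‖u - β • D.resolvent β u‖ ^ 2
      = β * inner ℝ (u - β • D.resolvent β u) u := by
  have hr := hD.resolvent_mem hβ u
  have h1 := hD.order_resolvent hβ u hr
  rw [order_self, ← real_inner_self_eq_norm_sq] at h1
  rw [hD.energy_smul _ hr, ← real_inner_self_eq_norm_sq]
  simp only [inner_sub_left, inner_sub_right, real_inner_smul_left, real_inner_smul_right]
  rw [real_inner_comm u (D.resolvent β u)] at *
  linear_combination β ^ 2 * h1

lemma approxEnergy_nonneg (hD : D.IsDirichletForm) (hβ : 0 < β) (u : Lp ℝ 2 m) :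
    0 ≤ β * inner ℝ (u - β • D.resolvent β u) u := by
  rw [← hD.energy_resolvent_eq hβ]
  have := hD.energy_nonneg (hD.smul_mem β _ (hD.resolvent_mem hβ u))
  positivity

/-- The approximating forms `β (u - β G_β u, u)` are dominated by the energy. -/
lemma approxEnergy_le (hD : D.IsDirichletForm) (hβ : 0 < β) (hu : u ∈ D.domain) :
    β * inner ℝ (u - β • D.resolvent β u) u ≤ D.energy u := by
  have hr := hD.resolvent_mem hβ u
  have hw := hD.smul_mem β _ hr
  have h1 := hD.energy_resolvent_eq hβ u
  have h2 := hD.order_resolvent hβ u hu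
  have h3 : D.toFun (β • D.resolvent β u) u = β * inner ℝ (u - β • D.resolvent β u) u := by
    rw [hD.smul_left _ _ hr _ hu, inner_sub_left, real_inner_smul_left]
    simp only [order] at h2
    linear_combination β * h2
  have h4 := hD.cauchy_schwarz hw hu
  rw [h3] at h4
  have h5 := hD.approxEnergy_nonneg hβ u
  have h6 := hD.energy_nonneg hu
  set a := β * inner ℝ (u - β • D.resolvent β u) u
  rcases h5.eq_or_lt with h | h
  · rw [← h]; exact h6
  · have h7 : D.energy (β • D.resolvent β u) ≤ a := by
      have : 0 ≤ β * ‖u - β • D.resolvent β u‖ ^ 2 := by positivity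
      linarith
    have h8 : a * a ≤ a * D.energy u := by nlinarith
    exact le_of_mul_le_mul_left h8 h

/-- By `energy_resolvent_eq`, `β G_β u` has energy at most `M` and lies within `√(M / β)` of `u`;
let `β → ∞` and use closedness. -/
lemma mem_of_approxEnergy_le (hD : D.IsDirichletForm) {M : ℝ}
    (h : ∀ β > 0, β * inner ℝ (u - β • D.resolvent β u) u ≤ M) :
    u ∈ D.domain ∧ D.energy u ≤ M := by
  have hpos : ∀ n : ℕ, (0 : ℝ) < (n : ℝ) + 1 := fun n => by positivity
  set w : ℕ → Lp ℝ 2 m := fun n => ((n : ℝ) + 1) • D.resolvent ((n : ℝ) + 1) u with hw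
  have hwd : ∀ n, w n ∈ D.domain := fun n => hD.smul_mem _ _ (hD.resolvent_mem (hpos n) u)
  have hwE : ∀ n, D.energy (w n) + ((n : ℝ) + 1) * ‖u - w n‖ ^ 2 ≤ M := fun n => by
    rw [hw, hD.energy_resolvent_eq (hpos n)]
    exact h _ (hpos n)
  have hM : 0 ≤ M := (hD.approxEnergy_nonneg one_pos u).trans (h 1 one_pos)
  have hlim : Tendsto w atTop (𝓝 u) := by
    rw [tendsto_iff_norm_sub_tendsto_zero]
    have h1 : Tendsto (fun n : ℕ => √(M * (1 / ((n : ℝ) + 1)))) atTop (𝓝 0) := by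
      simpa using (tendsto_one_div_add_atTop_nhds_zero_nat.const_mul M).sqrt
    refine squeeze_zero (fun n => norm_nonneg _) (fun n => ?_) h1
    refine Real.le_sqrt_of_sq_le ?_
    rw [norm_sub_rev, mul_one_div, le_div_iff₀ (hpos n)]
    linarith [hwE n, hD.energy_nonneg (hwd n)]
  obtain ⟨h1, h2, -⟩ := hD.exists_convexHull_tendsto_of_tendsto hwd (M := M) (fun n => by
    have : 0 ≤ ((n : ℝ) + 1) * ‖u - w n‖ ^ 2 := by positivity
    linarith [hwE n]) hlim
  exact ⟨h1, h2⟩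

/-- Multiplication by the indicator of an invariant set operates on the form. -/
lemma indicator_mem_of_isInvariant (hD : D.IsDirichletForm) {A : Set E} (hinv : D.IsInvariant A)
    (hu : u ∈ D.domain) (hv : ∀ᵐ x ∂m, v x = A.indicator u x) :
    v ∈ D.domain ∧ D.energy v ≤ D.energy u := by
  refine hD.mem_of_approxEnergy_le fun β hβ => ?_
  refine le_trans ?_ (hD.approxEnergy_le hβ hu)
  have h1 := hinv β hβ u v hv
  have h2 := hD.approxEnergy_nonneg hβ (u - v)
  have hz : ∀ᵐ x ∂m, D.resolvent β (u - v) x = Aᶜ.indicator (D.resolvent β u) x := by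
    rw [hD.resolvent_sub hβ]
    filter_upwards [h1, Lp.coeFn_sub (D.resolvent β u) (D.resolvent β v)] with x h3 h4
    rw [h4, Pi.sub_apply, h3]
    by_cases hx : x ∈ A <;> simp [hx]
  have hw : ∀ᵐ x ∂m, (u - v) x = Aᶜ.indicator u x := by
    filter_upwards [hv, Lp.coeFn_sub u v] with x h3 h4
    rw [h4, Pi.sub_apply, h3]
    by_cases hx : x ∈ A <;> simp [hx]
  have horth : ∀ {a b c d : Lp ℝ 2 m}, (∀ᵐ x ∂m, a x = A.indicator c x) →
      (∀ᵐ x ∂m, b x = Aᶜ.indicator d x) → inner ℝ a b = 0 := by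
    intro a b c d ha hb
    rw [Lp.real_inner_eq_integral]
    refine integral_eq_zero_of_ae ?_
    filter_upwards [ha, hb] with x h3 h4
    rw [h3, h4]
    by_cases hx : x ∈ A <;> simp [hx]
  -- Both `u` and `G_β u` split into orthogonal pieces on `A` and on its complement. The
  -- approximating form of `u` is thus the sum of those of `v` and `u - v`, and the latter is
  -- nonnegative.
  have e1 := horth hv hw
  have e2 := horth hv hz
  have e3 := horth h1 hw
  simp only [hD.resolvent_sub hβ, inner_sub_left, inner_sub_right, real_inner_smul_left]
    at h2 e1 e2 e3 ⊢
  have a1 : inner ℝ v u = inner ℝ v v := by linarith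
  have a2 : inner ℝ u v = inner ℝ v v := by rw [real_inner_comm]; exact a1
  have a3 : inner ℝ (D.resolvent β v) u = inner ℝ (D.resolvent β v) v := by linarith
  have a4 : inner ℝ (D.resolvent β u) v = inner ℝ (D.resolvent β v) v := by
    rw [real_inner_comm, real_inner_comm v (D.resolvent β v)]; linarith
  rw [a1, a2, a3, a4] at h2
  linarith

/-- If the indicator of `A` operates on the form, functions living on `A` and on `Aᶜ` are
orthogonal. -/
lemma toFun_eq_zero_of_indicator_mem (hD : D.IsDirichletForm) {A : Set E}
    (h : ∀ u ∈ D.domain, ∀ v : Lp ℝ 2 m, (∀ᵐ x ∂m, v x = A.indicator u x) →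
      v ∈ D.domain ∧ D.energy v ≤ D.energy u) (hu : u ∈ D.domain) (hv : v ∈ D.domain)
    (hu0 : ∀ᵐ x ∂m, x ∉ A → u x = 0) (hv0 : ∀ᵐ x ∂m, x ∈ A → v x = 0) : D.toFun u v = 0 := by
  have h1 : ∀ t : ℝ, 0 ≤ 0 + 2 * t * D.toFun u v + t ^ 2 * D.energy v := fun t => by
    -- Restricting `u + t v` to `A` returns `u`, so `𝓔(u) ≤ 𝓔(u + t v)` for `t` of either sign.
    have h2 := (h (u + t • v) (hD.add_mem _ hu _ (hD.smul_mem t _ hv)) u (by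
      filter_upwards [hu0, hv0, Lp.coeFn_add u (t • v), Lp.coeFn_smul t v] with x h1 h2 h3 h4
      by_cases hx : x ∈ A
      · rw [Set.indicator_of_mem hx, h3, Pi.add_apply, h4, Pi.smul_apply, h2 hx, smul_zero,
          add_zero]
      · rw [Set.indicator_of_notMem hx, h1 hx])).2
    rw [hD.energy_add_smul t hu hv] at h2
    linarith
  have h2 := sq_le_mul_of_forall_quadratic_nonneg h1
  rw [zero_mul] at h2
  exact pow_eq_zero_iff two_ne_zero |>.1 (le_antisymm h2 (sq_nonneg _))

/-- A set whose indicator operates on the form is invariant. -/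
lemma isInvariant_of_indicator_mem (hD : D.IsDirichletForm) {A : Set E} (hA : MeasurableSet A)
    (h : ∀ u ∈ D.domain, ∀ v : Lp ℝ 2 m, (∀ᵐ x ∂m, v x = A.indicator u x) →
      v ∈ D.domain ∧ D.energy v ≤ D.energy u) : D.IsInvariant A := by
  intro β hβ f g hg
  have hr := hD.resolvent_mem hβ f
  obtain ⟨w, hw⟩ := Lp.exists_indicator_ae_eq (D.resolvent β f) hA
  have hwd := (h _ hr w hw).1
  suffices hres : D.IsResolvent β g w by
    rw [← hD.eq_resolvent hβ hres]
    exact hw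
  refine ⟨hwd, fun v hv => ?_⟩
  obtain ⟨a, ha⟩ := Lp.exists_indicator_ae_eq v hA
  have had := (h _ hv a ha).1
  -- The two orthogonality relations give `𝓔(1_A G_β f, v) = 𝓔(1_A G_β f, 1_A v) = 𝓔(G_β f, 1_A v)`.
  have h1 : D.toFun w (v - a) = 0 := by
    refine hD.toFun_eq_zero_of_indicator_mem h hwd (hD.sub_mem hv had) ?_ ?_
    · filter_upwards [hw] with x h1 hx
      rw [h1, Set.indicator_of_notMem hx]
    · filter_upwards [ha, Lp.coeFn_sub v a] with x h1 h2 hx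
      rw [h2, Pi.sub_apply, h1, Set.indicator_of_mem hx, sub_self]
  have h2 : D.toFun a (D.resolvent β f - w) = 0 := by
    refine hD.toFun_eq_zero_of_indicator_mem h had (hD.sub_mem hr hwd) ?_ ?_
    · filter_upwards [ha] with x h1 hx
      rw [h1, Set.indicator_of_notMem hx]
    · filter_upwards [hw, Lp.coeFn_sub (D.resolvent β f) w] with x h1 h2 hx
      rw [h2, Pi.sub_apply, h1, Set.indicator_of_mem hx, sub_self]
  have h3 : inner ℝ w v = inner ℝ (D.resolvent β f) a := by
    rw [Lp.real_inner_eq_integral, Lp.real_inner_eq_integral]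
    refine integral_congr_ae ?_
    filter_upwards [hw, ha] with x h1 h2
    rw [h1, h2]
    by_cases hx : x ∈ A <;> simp [hx]
  have h4 : inner ℝ g v = inner ℝ f a := by
    rw [Lp.real_inner_eq_integral, Lp.real_inner_eq_integral]
    refine integral_congr_ae ?_
    filter_upwards [hg, ha] with x h1 h2
    rw [h1, h2]
    by_cases hx : x ∈ A <;> simp [hx]
  rw [hD.sub_right hwd hv had] at h1
  rw [hD.sub_right had hr hwd, hD.symm _ had _ hr, hD.symm _ had _ hwd] at h2
  rw [h4, ← hD.order_resolvent hβ f had]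
  simp only [order]
  rw [h3]
  linarith

end IsDirichletForm

end L2Form

/-! ### Capacity and quasi-continuity -/

namespace L2Form

section Measurable

variable {E : Type*} [MeasurableSpace E] {m : Measure E} {D : L2Form m}

lemma capOpen_mono_ae (D : L2Form m) {U V : Set E} (h : ∀ᵐ x ∂m, x ∈ U → x ∈ V) :
    D.capOpen U ≤ D.capOpen V := by
  refine le_iInf fun u => iInf_le_of_le ⟨u.1, u.2.1, ?_⟩ le_rfl
  filter_upwards [u.2.2, h] with x h1 h2 hx using h1 (h2 hx)

lemma exists_of_capOpen_lt {U : Set E} {ε : ℝ≥0∞} (h : D.capOpen U < ε) :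
    ∃ u ∈ D.domain, (∀ᵐ x ∂m, x ∈ U → 1 ≤ u x) ∧ ENNReal.ofReal (D.order 1 u u) < ε := by
  obtain ⟨u, hu⟩ := iInf_lt_iff.1 h
  exact ⟨u.1, u.2.1, u.2.2, hu⟩

lemma capOpen_le {U : Set E} {u : Lp ℝ 2 m} (hu : u ∈ D.domain)
    (h : ∀ᵐ x ∂m, x ∈ U → 1 ≤ u x) : D.capOpen U ≤ ENNReal.ofReal (D.order 1 u u) :=
  iInf_le_of_le ⟨u, hu, h⟩ le_rfl

/-- Partial suprema of near-optimal functions for the `U n` have `𝓔₁`-energy at most the sum of the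
individual ones; a Banach-Saks limit of these suprema is admissible for the union. -/
lemma IsDirichletForm.capOpen_iUnion_le (hD : D.IsDirichletForm)
    (U : ℕ → Set E) : D.capOpen (⋃ n, U n) ≤ ∑' n, D.capOpen (U n) := by
  have hD1 := hD.shift zero_le_one
  refine ENNReal.le_of_forall_pos_le_add fun ε hε hfin => ?_
  obtain ⟨δ, hδ0, hδ⟩ := ENNReal.exists_pos_sum_of_countable
    (ENNReal.coe_ne_zero.2 hε.ne') ℕ
  have hlt : ∀ n, D.capOpen (U n) < D.capOpen (U n) + δ n := fun n =>
    ENNReal.lt_add_right (ENNReal.ne_top_of_tsum_ne_top hfin.ne n)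
      (ENNReal.coe_ne_zero.2 (hδ0 n).ne')
  choose u hu hu1 huε using fun n => exists_of_capOpen_lt (hlt n)
  set S := ∑' n, (D.capOpen (U n) + δ n) with hS
  have hSle : S ≤ (∑' n, D.capOpen (U n)) + ε := by
    rw [hS, ENNReal.tsum_add]
    gcongr
  have hStop : S ≠ ∞ := (hSle.trans_lt (ENNReal.add_lt_top.2 ⟨hfin, ENNReal.coe_lt_top⟩)).ne
  have hsup : ∀ n, partialSups u n ∈ D.domain ∧ D.order 1 (partialSups u n) (partialSups u n)
      ≤ ∑ i ∈ Finset.range (n + 1), D.order 1 (u i) (u i) := by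
    intro n
    induction n with
    | zero => simpa using hu 0
    | succ n ih =>
      rw [partialSups_add_one, Finset.sum_range_succ]
      obtain ⟨h1, h2⟩ := hD1.sup_mem (u := partialSups u n) (v := u (n + 1)) ih.1 (hu _)
      refine ⟨h1, ?_⟩
      change (D.shift 1).energy _ ≤ _
      refine h2.trans (add_le_add ih.2 le_rfl)
  have hbound : ∀ n, D.order 1 (partialSups u n) (partialSups u n) ≤ S.toReal := fun n => by
    refine (hsup n).2.trans ?_
    rw [← ENNReal.ofReal_le_iff_le_toReal hStop,
      ENNReal.ofReal_sum_of_nonneg (f := fun i => D.order 1 (u i) (u i))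
        fun i _ => hD1.energy_nonneg (hu i)]
    exact (Finset.sum_le_sum fun i _ => (huε i).le).trans (ENNReal.sum_le_tsum _)
  obtain ⟨c, hc, w, hw, hwS, hcw⟩ := hD.exists_convexHull_tendsto (fun n => (hsup n).1) hbound
  have hcd := fun n => hD1.convexHull_subset_energy_le (fun n => (hsup n).1) hbound (hc n)
  obtain ⟨ns, hns, hae⟩ := Lp.exists_subseq_ae_tendsto
    (hD.tendsto_Lp_of_order (fun n => (hcd n).1) hw hcw)
  have hsup1 : ∀ᵐ x ∂m, ∀ k n, k ≤ n → x ∈ U k → 1 ≤ partialSups u n x := by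
    refine ae_all_iff.2 fun k => ae_all_iff.2 fun n => ?_
    by_cases hkn : k ≤ n
    · filter_upwards [hu1 k, (Lp.coeFn_le _ _).2 (le_partialSups_of_le u hkn)] with x h1 h2 _ hx
      exact (h1 hx).trans h2
    · exact .of_forall fun x h => absurd h hkn
  -- On `U k` all members of the tail beyond `k` are at least `1`, and so are their convex
  -- combinations, since `[1, ∞)` is convex.
  have hw1 : ∀ᵐ x ∂m, x ∈ ⋃ n, U n → 1 ≤ w x := by
    filter_upwards [hae, hsup1, ae_all_iff.2 fun n => Lp.ae_mem_convexHull (hc n)] with x h1 h2 h3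
    intro hx
    obtain ⟨k, hk⟩ := Set.mem_iUnion.1 hx
    refine ge_of_tendsto h1 ?_
    filter_upwards [eventually_ge_atTop k] with n hn
    refine convexHull_min ?_ (convex_Ici (1 : ℝ)) (h3 (ns n))
    rintro _ ⟨j, hj, rfl⟩
    exact h2 k j (hn.trans (hns.le_apply.trans hj)) hk
  calc D.capOpen (⋃ n, U n) ≤ ENNReal.ofReal (D.order 1 w w) := capOpen_le hw hw1
    _ ≤ ENNReal.ofReal S.toReal := ENNReal.ofReal_le_ofReal hwS
    _ = S := ENNReal.ofReal_toReal hStop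
    _ ≤ _ := hSle

end Measurable

variable {E : Type*} [TopologicalSpace E] [MeasurableSpace E] {m : Measure E} {D : L2Form m}

lemma cap_mono (D : L2Form m) {A B : Set E} (h : A ⊆ B) : D.cap A ≤ D.cap B :=
  le_iInf fun U => iInf_le_of_le ⟨U.1, U.2.1, h.trans U.2.2⟩ le_rfl

lemma cap_le_capOpen (D : L2Form m) {A U : Set E} (hU : IsOpen U) (h : A ⊆ U) :
    D.cap A ≤ D.capOpen U := iInf_le_of_le ⟨U, hU, h⟩ le_rfl

lemma exists_isOpen_of_cap_lt {A : Set E} {ε : ℝ≥0∞} (h : D.cap A < ε) :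
    ∃ U, IsOpen U ∧ A ⊆ U ∧ D.capOpen U < ε := by
  obtain ⟨U, hU⟩ := iInf_lt_iff.1 h
  exact ⟨U.1, U.2.1, U.2.2, hU⟩

lemma QuasiContinuous.exists_isOpen {f : E → ℝ} (hf : D.QuasiContinuous f) {ε : ℝ≥0∞}
    (hε : 0 < ε) : ∃ U, IsOpen U ∧ D.capOpen U < ε ∧ ContinuousOn f Uᶜ := by
  obtain ⟨U, -, hU, hf⟩ := hf ε hε
  obtain ⟨V, hV, hUV, hVε⟩ := exists_isOpen_of_cap_lt hU
  exact ⟨V, hV, hVε, hf.mono (Set.compl_subset_compl.2 hUV)⟩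

lemma QuasiContinuous.comp {f : E → ℝ} (hf : D.QuasiContinuous f) {φ : ℝ → ℝ}
    (hφ : Continuous φ) : D.QuasiContinuous fun x => φ (f x) := fun ε hε => by
  obtain ⟨U, h1, h2, h3⟩ := hf ε hε
  exact ⟨U, h1, h2, hφ.comp_continuousOn h3⟩

/-- A quasi-continuous function which a.e. on an open set `W` avoids the open set `O` avoids it
quasi-everywhere on `W`. -/
lemma QuasiContinuous.cap_inter_preimage_eq_zero {f : E → ℝ} (hf : D.QuasiContinuous f)
    {W : Set E} (hW : IsOpen W) {O : Set ℝ} (hO : IsOpen O) (h : ∀ᵐ x ∂m, x ∈ W → f x ∉ O) :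
    D.cap (W ∩ f ⁻¹' O) = 0 := by
  refine le_antisymm (le_of_forall_gt fun ε hε => ?_) zero_le
  obtain ⟨G, hG, hGε, hfG⟩ := hf.exists_isOpen hε
  obtain ⟨u, hu, hfu⟩ := continuousOn_iff'.1 hfG O hO
  -- The covering open set `G ∪ (W ∩ u)` differs from `G` only by an `m`-null set, which the
  -- capacity of open sets does not see.
  refine lt_of_le_of_lt ((D.cap_le_capOpen (hG.union (hW.inter hu)) ?_).trans
    (D.capOpen_mono_ae (V := G) ?_)) hGε
  · rintro x ⟨hxW, hxO⟩
    by_cases hx : x ∈ G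
    · exact .inl hx
    · exact .inr ⟨hxW, (hfu ▸ (⟨hxO, hx⟩ : x ∈ f ⁻¹' O ∩ Gᶜ) : x ∈ u ∩ Gᶜ).1⟩
  · filter_upwards [h] with x hx hxV
    by_contra hxG
    rcases hxV with h1 | ⟨h1, h2⟩
    · exact hxG h1
    · exact hx h1 (hfu ▸ (⟨h2, hxG⟩ : x ∈ u ∩ Gᶜ) : x ∈ f ⁻¹' O ∩ Gᶜ).1

namespace IsDirichletForm

variable {u v w : Lp ℝ 2 m}

lemma measure_le_cap (hD : D.IsDirichletForm) (A : Set E) : m A ≤ D.cap A := by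
  refine le_of_forall_gt fun ε hε => ?_
  obtain ⟨U, -, hAU, hU⟩ := exists_isOpen_of_cap_lt hε
  obtain ⟨u, hu, hu1, huε⟩ := exists_of_capOpen_lt hU
  refine lt_of_le_of_lt ?_ huε
  calc m A ≤ m {x | 1 ≤ ENNReal.ofReal (u x ^ 2)} := by
        refine measure_mono_ae ?_
        filter_upwards [hu1] with x hx hxA
        have h1 := hx (hAU hxA)
        refine ENNReal.one_le_ofReal.2 ?_
        nlinarith
    _ ≤ ∫⁻ x, ENNReal.ofReal (u x ^ 2) ∂m := by
        have h1 := mul_meas_ge_le_lintegral (μ := m)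
          ((Lp.stronglyMeasurable u).measurable.pow_const 2).ennreal_ofReal 1
        rwa [one_mul] at h1
    _ = ENNReal.ofReal (‖u‖ ^ 2) := by
        rw [Lp.norm_sq_eq_integral, ofReal_integral_eq_lintegral_ofReal
          (Lp.memLp u).integrable_sq (.of_forall fun x => sq_nonneg _)]
    _ ≤ _ := ENNReal.ofReal_le_ofReal (hD.norm_sq_le_order hu)

lemma cap_iUnion_le (hD : D.IsDirichletForm)
    (A : ℕ → Set E) : D.cap (⋃ n, A n) ≤ ∑' n, D.cap (A n) := by
  refine ENNReal.le_of_forall_pos_le_add fun ε hε hfin => ?_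
  obtain ⟨δ, hδ0, hδ⟩ := ENNReal.exists_pos_sum_of_countable
    (ENNReal.coe_ne_zero.2 hε.ne') ℕ
  have hlt : ∀ n, D.cap (A n) < D.cap (A n) + δ n := fun n =>
    ENNReal.lt_add_right (ENNReal.ne_top_of_tsum_ne_top hfin.ne n)
      (ENNReal.coe_ne_zero.2 (hδ0 n).ne')
  choose U hU hAU hUε using fun n => exists_isOpen_of_cap_lt (hlt n)
  calc D.cap (⋃ n, A n) ≤ D.capOpen (⋃ n, U n) :=
        D.cap_le_capOpen (isOpen_iUnion hU) (Set.iUnion_mono hAU)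
    _ ≤ ∑' n, D.capOpen (U n) := hD.capOpen_iUnion_le U
    _ ≤ ∑' n, (D.cap (A n) + δ n) := ENNReal.tsum_le_tsum fun n => (hUε n).le
    _ ≤ _ := by rw [ENNReal.tsum_add]; gcongr

lemma cap_empty (hD : D.IsDirichletForm) : D.cap ∅ = 0 := by
  refine le_antisymm ((D.cap_le_capOpen isOpen_empty subset_rfl).trans
    ((capOpen_le hD.zero_mem (.of_forall fun x hx => absurd hx (Set.notMem_empty x))).trans ?_))
    zero_le
  rw [order_self, hD.energy_zero]
  simp

lemma cap_iUnion_eq_zero (hD : D.IsDirichletForm)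
    {A : ℕ → Set E} (h : ∀ n, D.cap (A n) = 0) : D.cap (⋃ n, A n) = 0 :=
  le_antisymm ((hD.cap_iUnion_le A).trans (by simp [h])) zero_le

lemma cap_union_le (hD : D.IsDirichletForm) (A B : Set E) : D.cap (A ∪ B) ≤ D.cap A + D.cap B := by
  have h := hD.cap_iUnion_le fun n : ℕ => if n = 0 then A else if n = 1 then B else ∅
  have h1 : A ∪ B ⊆ ⋃ n : ℕ, (if n = 0 then A else if n = 1 then B else ∅) := by
    refine Set.union_subset (fun x hx => Set.mem_iUnion.2 ⟨0, by simpa using hx⟩)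
      (fun x hx => Set.mem_iUnion.2 ⟨1, by simpa using hx⟩)
  refine (D.cap_mono h1).trans (h.trans ?_)
  rw [tsum_eq_sum (s := {0, 1}) fun n hn => ?_]
  · simp
  · simp only [Finset.mem_insert, Finset.mem_singleton, not_or] at hn
    simp [hn.1, hn.2, hD.cap_empty]

lemma cap_union_eq_zero (hD : D.IsDirichletForm)
    {A B : Set E} (hA : D.cap A = 0) (hB : D.cap B = 0) :
    D.cap (A ∪ B) = 0 :=
  le_antisymm ((hD.cap_union_le A B).trans (by simp [hA, hB])) zero_le

lemma ae_of_cap_eq_zero (hD : D.IsDirichletForm)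
    {p : E → Prop} (h : D.cap {x | ¬ p x} = 0) : ∀ᵐ x ∂m, p x :=
  le_antisymm ((hD.measure_le_cap _).trans h.le) zero_le

lemma quasiContinuous_comp₂ (hD : D.IsDirichletForm) {f g : E → ℝ} (hf : D.QuasiContinuous f)
    (hg : D.QuasiContinuous g) {φ : ℝ × ℝ → ℝ} (hφ : Continuous φ) :
    D.QuasiContinuous fun x => φ (f x, g x) := fun ε hε => by
  obtain ⟨U, h1, h2, h3⟩ := hf (ε / 2) (ENNReal.half_pos hε.ne')
  obtain ⟨V, h4, h5, h6⟩ := hg (ε / 2) (ENNReal.half_pos hε.ne')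
  refine ⟨U ∪ V, h1.union h4, ?_, ?_⟩
  · calc D.cap (U ∪ V) ≤ D.cap U + D.cap V := hD.cap_union_le U V
      _ < ε / 2 + ε / 2 := ENNReal.add_lt_add h2 h5
      _ = ε := ENNReal.add_halves ε
  · exact hφ.comp_continuousOn ((h3.mono (by simp)).prodMk (h6.mono (by simp)))

lemma quasiContinuous_of_continuous (hD : D.IsDirichletForm)
    {f : E → ℝ} (hf : Continuous f) : D.QuasiContinuous f :=
  fun ε hε => ⟨∅, isOpen_empty, by rwa [hD.cap_empty], hf.continuousOn⟩

/-- The capacitary weak type inequality. -/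
lemma cap_lt_abs_le (hD : D.IsDirichletForm)
    {f : E → ℝ} (hf : D.QuasiContinuous f) (hu : u ∈ D.domain)
    (hfu : ∀ᵐ x ∂m, f x = u x) {l : ℝ} (hl : 0 < l) :
    D.cap {x | l < |f x|} ≤ ENNReal.ofReal (D.order 1 u u / l ^ 2) := by
  have hD1 := hD.shift zero_le_one
  refine ENNReal.le_of_forall_pos_le_add fun ε hε _ => ?_
  obtain ⟨G, hG, hGε, hfG⟩ := hf.exists_isOpen (ENNReal.coe_pos.2 hε)
  obtain ⟨w, hw, hw1, hwε⟩ := exists_of_capOpen_lt hGε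
  obtain ⟨O, hO, hfO⟩ := continuousOn_iff'.1 hfG {r : ℝ | l < |r|}
    (isOpen_lt continuous_const continuous_abs)
  have hul := hD.smul_mem l⁻¹ _ hu
  -- The competitor is `|u| / l ∨ w`, where `w` takes care of the open set `G` off which the
  -- quasi-continuous version is continuous.
  obtain ⟨ha, haE⟩ := hD1.abs_mem (u := l⁻¹ • u) hul
  obtain ⟨hs, hsE⟩ := hD1.sup_mem (u := |l⁻¹ • u|) (v := w) ha hw
  have hmem : ∀ x, x ∉ G → (x ∈ O ↔ l < |f x|) := fun x hx => by
    have h1 : x ∈ f ⁻¹' {r : ℝ | l < |r|} ∩ Gᶜ ↔ x ∈ O ∩ Gᶜ := by rw [hfO]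
    simpa [hx] using h1.symm
  calc D.cap {x | l < |f x|} ≤ D.capOpen (G ∪ O) := by
        refine D.cap_le_capOpen (hG.union hO) fun x hx => ?_
        by_cases hxG : x ∈ G
        · exact .inl hxG
        · exact .inr ((hmem x hxG).2 hx)
    _ ≤ ENNReal.ofReal (D.order 1 (|l⁻¹ • u| ⊔ w) (|l⁻¹ • u| ⊔ w)) := by
        refine capOpen_le hs ?_
        filter_upwards [hw1, hfu, Lp.coeFn_sup |l⁻¹ • u| w, Lp.coeFn_abs (l⁻¹ • u),
          Lp.coeFn_smul l⁻¹ u] with x h1 h2 h3 h4 h5 hx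
        rw [h3, Pi.sup_apply]
        by_cases hxG : x ∈ G
        · exact (h1 hxG).trans le_sup_right
        · refine le_trans ?_ le_sup_left
          have h6 := (hmem x hxG).1 (hx.resolve_left hxG)
          rw [h4, h5, Pi.smul_apply, smul_eq_mul, abs_mul, abs_of_pos (inv_pos.2 hl), ← h2,
            ← div_eq_inv_mul, le_div_iff₀ hl, one_mul]
          exact h6.le
    _ ≤ ENNReal.ofReal (D.order 1 u u / l ^ 2 + D.order 1 w w) := by
        refine ENNReal.ofReal_le_ofReal (hsE.trans (add_le_add (haE.trans ?_) le_rfl))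
        rw [hD1.energy_smul _ hu]
        change l⁻¹ ^ 2 * D.order 1 u u ≤ _
        rw [inv_pow, div_eq_inv_mul]
    _ ≤ ENNReal.ofReal (D.order 1 u u / l ^ 2) + ENNReal.ofReal (D.order 1 w w) :=
        ENNReal.ofReal_add_le
    _ ≤ _ := by gcongr

/-- Quasi-everywhere convergence of the quasi-continuous versions of a sequence which converges
fast enough in `𝓔₁`. -/
lemma exists_quasiContinuous_of_order_le (hD : D.IsDirichletForm) {c : ℕ → Lp ℝ 2 m} {f : ℕ → E → ℝ}
    (hc : ∀ n, c n ∈ D.domain) (hf : ∀ n, D.QuasiContinuous (f n))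
    (hfc : ∀ n, ∀ᵐ x ∂m, f n x = c n x) (hw : w ∈ D.domain)
    (h : ∀ n, D.order 1 (c n - w) (c n - w) ≤ (1 / 8) ^ n) :
    ∃ g, D.QuasiContinuous g ∧ (∀ᵐ x ∂m, g x = w x) ∧
      D.cap {x | ¬ Tendsto (fun n => f n x) atTop (𝓝 (g x))} = 0 := by
  have hD1 := hD.shift zero_le_one
  -- Rates: `𝓔₁(c (n+1) - c n) ≤ 4 · 8⁻ⁿ`, so the weak type inequality at level `2⁻ⁿ` gives capacity
  -- at most `4 · 2⁻ⁿ`, which is summable.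
  set B : ℕ → Set E := fun n => {x | (1 / 2 : ℝ) ^ n < |f (n + 1) x - f n x|} with hB
  have hBcap : ∀ n, D.cap (B n) ≤ ENNReal.ofReal (4 * (1 / 2) ^ n) := fun n => by
    have hq := hD.quasiContinuous_comp₂ (hf (n + 1)) (hf n) (φ := fun p => p.1 - p.2) (by fun_prop)
    refine (hD.cap_lt_abs_le hq (hD.sub_mem (hc (n + 1)) (hc n)) ?_
      (by positivity : (0 : ℝ) < (1 / 2) ^ n)).trans (ENNReal.ofReal_le_ofReal ?_)
    · filter_upwards [hfc n, hfc (n + 1), Lp.coeFn_sub (c (n + 1)) (c n)] with x h1 h2 h3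
      rw [h3, Pi.sub_apply, h1, h2]
    · have h1 := hD1.energy_sub_le (u := c (n + 1) - w) (v := c n - w)
        (hD.sub_mem (hc (n + 1)) hw) (hD.sub_mem (hc n) hw)
      rw [sub_sub_sub_cancel_right] at h1
      have h2 : D.order 1 (c (n + 1) - c n) (c (n + 1) - c n) ≤ 4 * (1 / 8) ^ n := by
        refine h1.trans ?_
        change 2 * (D.order 1 _ _ + D.order 1 _ _) ≤ _
        have h3 := h (n + 1)
        have h4 := h n
        have h5 : (1 / 8 : ℝ) ^ (n + 1) ≤ (1 / 8) ^ n :=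
          pow_le_pow_of_le_one (by norm_num) (by norm_num) (by omega)
        linarith
      rw [div_le_iff₀ (by positivity)]
      refine h2.trans (le_of_eq ?_)
      rw [show (1 / 8 : ℝ) = 1 / 2 * (1 / 2 * (1 / 2)) by norm_num, mul_pow, mul_pow]
      ring
  -- Off an open set of small capacity, all `f n` are continuous and their increments are eventually
  -- geometric, so the convergence is uniform there.
  have hsmall : ∀ ε : ℝ≥0∞, 0 < ε → ∃ G, IsOpen G ∧ D.capOpen G < ε ∧
      (∀ n, ContinuousOn (f n) Gᶜ) ∧
        ∃ N, ∀ n ≥ N, ∀ x ∉ G, |f (n + 1) x - f n x| ≤ (1 / 2) ^ n := by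
    intro ε hε
    obtain ⟨δ, hδ0, hδ⟩ := ENNReal.exists_pos_sum_of_countable (ENNReal.half_pos hε.ne').ne' ℕ
    choose G hG hGδ hfG using fun n => (hf n).exists_isOpen (ENNReal.coe_pos.2 (hδ0 n))
    have hsum : Summable fun n : ℕ => 4 * (1 / 2 : ℝ) ^ n := summable_geometric_two.mul_left 4
    have htail := ENNReal.tendsto_sum_nat_add (fun n => ENNReal.ofReal (4 * (1 / 2) ^ n))
      (hsum.tsum_ofReal_ne_top)
    obtain ⟨N, hN⟩ := (htail.eventually (gt_mem_nhds (ENNReal.half_pos hε.ne'))).exists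
    have hA : D.cap ((⋃ n, G n) ∪ ⋃ n, B (n + N)) < ε := by
      calc _ ≤ D.cap (⋃ n, G n) + D.cap (⋃ n, B (n + N)) := hD.cap_union_le _ _
        _ ≤ (∑' n, D.cap (G n)) + ∑' n, D.cap (B (n + N)) :=
            add_le_add (hD.cap_iUnion_le _) (hD.cap_iUnion_le _)
        _ ≤ (∑' n, (δ n : ℝ≥0∞)) + ∑' n, ENNReal.ofReal (4 * (1 / 2) ^ (n + N)) :=
            add_le_add (ENNReal.tsum_le_tsum fun n =>
              (D.cap_le_capOpen (hG n) subset_rfl).trans (hGδ n).le)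
              (ENNReal.tsum_le_tsum fun n => hBcap _)
        _ < ε / 2 + ε / 2 := ENNReal.add_lt_add hδ hN
        _ = ε := ENNReal.add_halves ε
    obtain ⟨U, hU, hAU, hUε⟩ := exists_isOpen_of_cap_lt hA
    refine ⟨U, hU, hUε, fun n => (hfG n).mono (Set.compl_subset_compl.2
      ((Set.subset_iUnion G n).trans (Set.subset_union_left.trans hAU))), N, fun n hn x hx => ?_⟩
    by_contra! hlt
    refine hx (hAU (.inr (Set.mem_iUnion.2 ⟨n - N, ?_⟩)))
    rw [Nat.sub_add_cancel hn]
    exact hlt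
  -- Defined everywhere by a choice of limit, so that one `g` serves all exceptional sets at once;
  -- its values where the sequence diverges are irrelevant.
  set g : E → ℝ := fun x => limUnder atTop fun n => f n x with hg
  have hlimG : ∀ (G : Set E) (N : ℕ),
      (∀ n ≥ N, ∀ x ∉ G, |f (n + 1) x - f n x| ≤ (1 / 2) ^ n) → ∀ x ∉ G,
      Tendsto (fun n => f n x) atTop (𝓝 (g x)) ∧
        ∀ n, dist (f (n + N) x) (g x) ≤ 1 * (1 / 2) ^ n / (1 - 1 / 2) := by
    intro G N hN x hx
    have hd : ∀ n, dist (f (n + N) x) (f (n + 1 + N) x) ≤ 1 * (1 / 2) ^ n := fun n => by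
      rw [dist_comm, Real.dist_eq, one_mul, show n + 1 + N = n + N + 1 by omega]
      exact (hN (n + N) (by omega) x hx).trans
        (pow_le_pow_of_le_one (by norm_num) (by norm_num) (by omega))
    have hcau := cauchySeq_of_le_geometric _ _ (by norm_num) hd
    obtain ⟨y, hy⟩ := cauchySeq_tendsto_of_complete hcau
    have hy' : Tendsto (fun n => f n x) atTop (𝓝 y) := (tendsto_add_atTop_iff_nat N).1 hy
    have hgy : g x = y := hy'.limUnder_eq
    rw [hgy]
    exact ⟨hy', dist_le_of_le_geometric_of_tendsto _ _ (by norm_num) hd hy⟩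
  have hcap : D.cap {x | ¬ Tendsto (fun n => f n x) atTop (𝓝 (g x))} = 0 := by
    refine le_antisymm (le_of_forall_gt fun ε hε => ?_) zero_le
    obtain ⟨G, hG, hGε, -, N, hN⟩ := hsmall ε hε
    refine lt_of_le_of_lt (D.cap_le_capOpen hG fun x hx => ?_) hGε
    by_contra hxG
    exact hx (hlimG G N hN x hxG).1
  refine ⟨g, fun ε hε => ?_, ?_, hcap⟩
  · obtain ⟨G, hG, hGε, hfG, N, hN⟩ := hsmall ε hε
    refine ⟨G, hG, (D.cap_le_capOpen hG subset_rfl).trans_lt hGε, ?_⟩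
    have hunif : TendstoUniformlyOn (fun n => f (n + N)) g atTop Gᶜ := by
      rw [Metric.tendstoUniformlyOn_iff]
      intro δ hδ
      have h1 : Tendsto (fun n : ℕ => 1 * (1 / 2 : ℝ) ^ n / (1 - 1 / 2)) atTop (𝓝 0) := by
        simpa using ((tendsto_pow_atTop_nhds_zero_of_lt_one (r := (1 / 2 : ℝ)) (by norm_num)
          (by norm_num)).const_mul 1).div_const (1 - 1 / 2)
      filter_upwards [h1.eventually (gt_mem_nhds hδ)] with n hn x hx
      rw [dist_comm]
      exact ((hlimG G N hN x hx).2 n).trans_lt hn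
    exact hunif.continuousOn (Frequently.of_forall fun n => hfG _)
  · have hlim : Tendsto (fun n => D.order 1 (c n - w) (c n - w)) atTop (𝓝 0) :=
      squeeze_zero (fun n => hD1.energy_nonneg (hD.sub_mem (hc n) hw)) h
        (tendsto_pow_atTop_nhds_zero_of_lt_one (by norm_num) (by norm_num))
    obtain ⟨ns, hns, hae⟩ := Lp.exists_subseq_ae_tendsto (hD.tendsto_Lp_of_order hc hw hlim)
    filter_upwards [hae, hD.ae_of_cap_eq_zero hcap, ae_all_iff.2 hfc] with x h1 h2 h3
    have h4 := h2.comp hns.tendsto_atTop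
    simp only [Function.comp_def, h3] at h4
    exact tendsto_nhds_unique h4 h1

lemma exists_quasiContinuous_of_tendsto (hD : D.IsDirichletForm) {c : ℕ → Lp ℝ 2 m} {f : ℕ → E → ℝ}
    (hc : ∀ n, c n ∈ D.domain) (hf : ∀ n, D.QuasiContinuous (f n))
    (hfc : ∀ n, ∀ᵐ x ∂m, f n x = c n x) (hw : w ∈ D.domain)
    (h : Tendsto (fun n => D.order 1 (c n - w) (c n - w)) atTop (𝓝 0)) :
    ∃ ns : ℕ → ℕ, StrictMono ns ∧ ∃ g, D.QuasiContinuous g ∧ (∀ᵐ x ∂m, g x = w x) ∧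
      D.cap {x | ¬ Tendsto (fun n => f (ns n) x) atTop (𝓝 (g x))} = 0 := by
  obtain ⟨ns, hns, hle⟩ := extraction_forall_of_eventually'
    (P := fun n k => D.order 1 (c k - w) (c k - w) ≤ (1 / 8) ^ n) fun n => by
      exact eventually_atTop.1 ((h.eventually
        (gt_mem_nhds (by positivity : (0 : ℝ) < (1 / 8) ^ n))).mono fun k hk => hk.le)
  exact ⟨ns, hns, hD.exists_quasiContinuous_of_order_le (fun n => hc (ns n))
    (fun n => hf (ns n)) (fun n => hfc (ns n)) hw hle⟩

lemma exists_quasiContinuous (hD : D.IsDirichletForm) (hreg : D.IsRegular) (hu : u ∈ D.domain) :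
    ∃ f, D.QuasiContinuous f ∧ ∀ᵐ x ∂m, f x = u x := by
  have hex : ∀ n : ℕ, ∃ v ∈ D.domain,
      (∃ f : E → ℝ, Continuous f ∧ HasCompactSupport f ∧ ∀ᵐ x ∂m, v x = f x) ∧
      D.order 1 (u - v) (u - v) < (1 / 8) ^ n := fun n =>
    hreg.1 u hu _ (by positivity)
  choose v hv hvf hvε using hex
  choose f hf _ hfv using hvf
  obtain ⟨g, hg, hgu, -⟩ := hD.exists_quasiContinuous_of_order_le hv
    (fun n => hD.quasiContinuous_of_continuous (hf n))
    (fun n => (hfv n).mono fun x hx => hx.symm) hu fun n => by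
      refine le_trans (le_of_eq ?_) (hvε n).le
      exact (hD.shift zero_le_one).energy_sub_comm (hv n) hu
  exact ⟨g, hg, hgu⟩

end IsDirichletForm

end L2Form

/-! ### Truncation and quasi-continuous versions in the extended space -/

lemma max_neg_min_of_abs_le {a r : ℝ} (h : |a| ≤ r) : max (-r) (min a r) = a := by
  obtain ⟨h1, h2⟩ := abs_le.1 h
  rw [min_eq_left h2, max_eq_right h1]

lemma abs_max_neg_min_le {a r : ℝ} (hr : 0 ≤ r) : |max (-r) (min a r)| ≤ r :=
  abs_le.2 ⟨le_max_left _ _, max_le (by linarith) (min_le_right _ _)⟩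

lemma abs_max_neg_min_le_abs {a r : ℝ} (hr : 0 ≤ r) : |max (-r) (min a r)| ≤ |a| := by
  rcases le_total |a| r with h | h
  · rw [max_neg_min_of_abs_le h]
  · exact (abs_max_neg_min_le hr).trans h

lemma max_neg_min_max_neg_min {a r s : ℝ} (hr : 0 ≤ r) (hrs : r ≤ s) :
    max (-r) (min (max (-s) (min a s)) r) = max (-r) (min a r) := by
  rcases le_total a s with h | h
  · rw [min_eq_left h]
    rcases le_total (-s) a with h' | h'
    · rw [max_eq_right h']
    · rw [max_eq_left h', min_eq_left (by linarith), min_eq_left (by linarith),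
        max_eq_left (by linarith), max_eq_left (by linarith)]
  · rw [min_eq_right h, max_eq_right (by linarith : -s ≤ s), min_eq_right hrs,
      min_eq_right (hrs.trans h)]

lemma eq_of_max_neg_min_eq {a b r : ℝ} (h : max (-r) (min a r) = b) (hb : |b| < r) : a = b := by
  obtain ⟨h1, h2⟩ := abs_lt.1 hb
  rcases max_choice (-r) (min a r) with h' | h'
  · rw [h'] at h; linarith
  · rw [h'] at h
    rcases min_choice a r with h'' | h''
    · rw [h''] at h; exact h
    · rw [h''] at h; linarith

namespace L2Form

variable {E : Type*} [MeasurableSpace E] {m : Measure E} {D : L2Form m}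

namespace IsDirichletForm

variable {u v w : Lp ℝ 2 m}

/-- Truncation at the level `h ∈ 𝓕` of an a.e. limit of an energy bounded sequence. -/
lemma exists_clamp_limit (hD : D.IsDirichletForm)
    {w : ℕ → Lp ℝ 2 m} (hw : ∀ n, w n ∈ D.domain) {M : ℝ}
    (hM : ∀ n, D.energy (w n) ≤ M) {u : E →ₘ[m] ℝ}
    (hlim : ∀ᵐ x ∂m, Tendsto (fun n => w n x) atTop (𝓝 (u x))) {h : Lp ℝ 2 m}
    (hh : h ∈ D.domain) (hh0 : ∀ᵐ x ∂m, 0 ≤ h x) :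
    ∃ y : ℕ → Lp ℝ 2 m, (∀ n, y n ∈ D.domain ∧ ∀ᵐ x ∂m, y n x = max (-h x) (min (w n x) (h x))) ∧
      ∃ v ∈ D.domain, (∀ᵐ x ∂m, v x = max (-h x) (min (u x) (h x))) ∧
        D.energy v ≤ 4 * (M + D.energy h) ∧ ∃ c : ℕ → Lp ℝ 2 m,
          (∀ n, c n ∈ D.domain ∧ c n ∈ convexHull ℝ (y '' Set.Ici n)) ∧
          Tendsto (fun n => D.order 1 (c n - v) (c n - v)) atTop (𝓝 0) := by
  choose y hy hyw hyE using fun n => hD.exists_clamp (hw n) hh hh0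
  obtain ⟨v, hv⟩ := Lp.exists_coeFn_ae_eq_of_abs_le h
    (f := fun x => max (-h x) (min (u x) (h x)))
    ((Lp.aestronglyMeasurable h).aemeasurable.neg.max
      (u.aestronglyMeasurable.aemeasurable.min
        (Lp.aestronglyMeasurable h).aemeasurable)).aestronglyMeasurable (by
      filter_upwards [hh0] with x hx
      rw [abs_of_nonneg hx]
      exact abs_max_neg_min_le hx)
  have hyE' : ∀ n, D.energy (y n) ≤ 4 * (M + D.energy h) := fun n =>
    (hyE n).trans (by linarith [hM n])
  have hyv : Tendsto y atTop (𝓝 v) := by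
    refine Lp.tendsto_of_ae_tendsto_of_abs_le (h := h) (fun n => ?_) ?_
    · filter_upwards [hyw n, hh0] with x h1 h2
      rw [h1, abs_of_nonneg h2]
      exact abs_max_neg_min_le h2
    · filter_upwards [ae_all_iff.2 hyw, hv, hlim] with x h1 h2 h3
      simp only [h1, h2]
      exact tendsto_const_nhds.max (h3.min tendsto_const_nhds)
  obtain ⟨hvd, hvE, c, hc, hcv⟩ := hD.exists_convexHull_tendsto_of_tendsto hy hyE' hyv
  exact ⟨y, fun n => ⟨hy n, hyw n⟩, v, hvd, hv, hvE, c, fun n =>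
    ⟨(hD.convexHull_subset_energy_le hy hyE' (hc n)).1, hc n⟩, hcv⟩

lemma exists_bounded_of_mem_extendedSpace (hD : D.IsDirichletForm)
    {u : E →ₘ[m] ℝ} (hu : u ∈ D.extendedSpace) :
    ∃ (w : ℕ → Lp ℝ 2 m) (M : ℝ), (∀ n, w n ∈ D.domain) ∧ (∀ n, D.energy (w n) ≤ M) ∧
      ∀ᵐ x ∂m, Tendsto (fun n => w n x) atTop (𝓝 (u x)) := by
  obtain ⟨w, hw, hcau, hlim⟩ := hu
  obtain ⟨M, N, hM⟩ := hD.exists_energy_le_of_cauchy hw hcau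
  refine ⟨fun n => w (n + N), M, fun n => hw _, hM, ?_⟩
  filter_upwards [hlim] with x hx
  exact hx.comp (tendsto_add_atTop_nat N)

end IsDirichletForm

section Topological

variable {E : Type*} [TopologicalSpace E] [MeasurableSpace E] {m : Measure E} {D : L2Form m}

namespace IsDirichletForm

variable {u v w : Lp ℝ 2 m}

/-- Constants need not belong to `𝓕`; these functions, equal to `1` on open sets exhausting the
space, replace them locally. -/
lemma exists_cutoff (hD : D.IsDirichletForm)
    [RegularSpace E] [LocallyCompactSpace E] [SigmaCompactSpace E]
    (hreg : D.IsRegular) :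
    ∃ (W : ℕ → Set E) (η : ℕ → Lp ℝ 2 m), (∀ n, IsOpen (W n)) ∧ Monotone W ∧
      (⋃ n, W n) = Set.univ ∧ ∀ n, η n ∈ D.domain ∧ (∀ᵐ x ∂m, 0 ≤ η n x) ∧
        ∀ᵐ x ∂m, x ∈ W n → η n x = 1 := by
  set K := CompactExhaustion.choice E
  have hη : ∀ n, ∃ η ∈ D.domain, (∀ᵐ x ∂m, 0 ≤ η x) ∧
      ∀ᵐ x ∂m, x ∈ interior (K n) → η x = 1 := by
    intro n
    obtain ⟨f, hf1, -, hfc, -⟩ := exists_continuous_one_zero_of_isCompact (K.isCompact n)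
      isClosed_empty (Set.disjoint_empty _)
    -- Approximating `2 f` within `1` gives a function that exceeds `1` on the compact set, so
    -- truncation at `1` yields exactly `1` there.
    obtain ⟨g, -, -, ⟨v, hv, hvg⟩, hfg⟩ := hreg.2 (fun x => 2 * f x) (by fun_prop)
      (HasCompactSupport.mul_left (f := fun _ => 2) hfc) 1 one_pos
    obtain ⟨η, hη, hηv, -⟩ := hD.exists_trunc hv zero_le_one
    refine ⟨η, hη, ?_, ?_⟩
    · filter_upwards [hηv] with x hx
      rw [hx]; exact le_max_left _ _
    · filter_upwards [hηv, hvg] with x h1 h2 hx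
      have h3 := (abs_lt.1 (hfg x)).2
      rw [hf1 (interior_subset hx), Pi.one_apply] at h3
      rw [h1, h2, min_eq_right (by linarith), max_eq_right zero_le_one]
  choose η hηd hη0 hη1 using hη
  exact ⟨fun n => interior (K n), η, fun n => isOpen_interior,
    monotone_nat_of_le_succ fun n => interior_mono (K.subset_succ n),
    Set.eq_univ_of_forall fun x => by
      obtain ⟨n, hn⟩ := K.exists_mem x
      exact Set.mem_iUnion.2 ⟨n + 1, K.subset_interior_succ n hn⟩,
    fun n => ⟨hηd n, hη0 n, hη1 n⟩⟩

lemma cap_inter_ne_eq_zero (hD : D.IsDirichletForm)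
    {f g : E → ℝ} (hf : D.QuasiContinuous f) (hg : D.QuasiContinuous g)
    {W : Set E} (hW : IsOpen W) (h : ∀ᵐ x ∂m, x ∈ W → f x = g x) :
    D.cap (W ∩ {x | f x ≠ g x}) = 0 := by
  have hq := hD.quasiContinuous_comp₂ hf hg (φ := fun p => p.1 - p.2) (by fun_prop)
  have h1 := hq.cap_inter_preimage_eq_zero hW (O := {0}ᶜ) isOpen_compl_singleton (by
    filter_upwards [h] with x hx hxW
    simp [hx hxW])
  refine le_antisymm ((D.cap_mono ?_).trans h1.le) zero_le
  rintro x ⟨hxW, hx⟩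
  exact ⟨hxW, sub_ne_zero.2 hx⟩

lemma cap_inter_lt_eq_zero (hD : D.IsDirichletForm)
    {f g : E → ℝ} (hf : D.QuasiContinuous f) (hg : D.QuasiContinuous g)
    {W : Set E} (hW : IsOpen W) (h : ∀ᵐ x ∂m, x ∈ W → f x ≤ g x) :
    D.cap (W ∩ {x | g x < f x}) = 0 := by
  have hq := hD.quasiContinuous_comp₂ hf hg (φ := fun p => p.1 - p.2) (by fun_prop)
  have h1 := hq.cap_inter_preimage_eq_zero hW (O := Set.Ioi 0) isOpen_Ioi (by
    filter_upwards [h] with x hx hxW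
    simpa using hx hxW)
  refine le_antisymm ((D.cap_mono ?_).trans h1.le) zero_le
  rintro x ⟨hxW, hx⟩
  exact ⟨hxW, show 0 < f x - g x from sub_pos.2 hx⟩

/-- A set on which all members of an energy bounded sequence tending to `0` in `L²` are at least
`1` is polar. -/
lemma cap_eq_zero_of_one_le (hD : D.IsDirichletForm)
    (hreg : D.IsRegular) {z : ℕ → Lp ℝ 2 m} (hz : ∀ n, z n ∈ D.domain)
    {M : ℝ} (hM : ∀ n, D.energy (z n) ≤ M) (hlim : Tendsto z atTop (𝓝 0)) {P : Set E}
    (hP : ∀ n, ∀ g, D.QuasiContinuous g → (∀ᵐ x ∂m, g x = z n x) →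
      D.cap (P ∩ {x | g x < 1}) = 0) : D.cap P = 0 := by
  obtain ⟨-, -, c, hc, hcv⟩ := hD.exists_convexHull_tendsto_of_tendsto hz hM hlim
  -- Having quasi-continuous versions at least `1` quasi-everywhere on `P` is a convex condition,
  -- hence it survives the Banach-Saks combinations, which tend to `0` in `𝓔₁`.
  have hconv : Convex ℝ {c : Lp ℝ 2 m | c ∈ D.domain ∧ ∀ g, D.QuasiContinuous g →
      (∀ᵐ x ∂m, g x = c x) → D.cap (P ∩ {x | g x < 1}) = 0} := by
    rintro c₁ ⟨hc₁, h₁⟩ c₂ ⟨hc₂, h₂⟩ a b ha hb hab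
    refine ⟨hD.add_mem _ (hD.smul_mem _ _ hc₁) _ (hD.smul_mem _ _ hc₂), fun g hg hgc => ?_⟩
    obtain ⟨g₁, hg₁, hgc₁⟩ := hD.exists_quasiContinuous hreg hc₁
    obtain ⟨g₂, hg₂, hgc₂⟩ := hD.exists_quasiContinuous hreg hc₂
    have h3 := hD.cap_inter_ne_eq_zero hg (hD.quasiContinuous_comp₂ hg₁ hg₂
      (φ := fun p => a * p.1 + b * p.2) (by fun_prop)) isOpen_univ (by
        filter_upwards [hgc, hgc₁, hgc₂, Lp.coeFn_add (a • c₁) (b • c₂), Lp.coeFn_smul a c₁,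
          Lp.coeFn_smul b c₂] with x e1 e2 e3 e4 e5 e6 _
        rw [e1, e4, Pi.add_apply, e5, e6, e2, e3]
        rfl)
    refine le_antisymm ((D.cap_mono ?_).trans (hD.cap_union_eq_zero h3
      (hD.cap_union_eq_zero (h₁ g₁ hg₁ hgc₁) (h₂ g₂ hg₂ hgc₂))).le) zero_le
    rintro x ⟨hxP, hx⟩
    by_contra hcon
    simp only [Set.mem_union, Set.mem_inter_iff, Set.mem_univ, true_and, Set.mem_ofPred_eq, hxP,
      not_or, not_not, not_lt] at hcon hx
    obtain ⟨e1, e2, e3⟩ := hcon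
    nlinarith
  have hcs : ∀ n, c n ∈ D.domain ∧ ∀ g, D.QuasiContinuous g →
      (∀ᵐ x ∂m, g x = c n x) → D.cap (P ∩ {x | g x < 1}) = 0 := fun n => by
    refine convexHull_min ?_ hconv (hc n)
    rintro _ ⟨k, -, rfl⟩
    exact ⟨hz k, hP k⟩
  refine le_antisymm ?_ zero_le
  have hlim0 : Tendsto (fun n => ENNReal.ofReal (D.order 1 (c n - 0) (c n - 0) / (1 / 2) ^ 2))
      atTop (𝓝 0) := by
    simpa only [zero_div, ENNReal.ofReal_zero] using
      ENNReal.tendsto_ofReal (hcv.div_const ((1 / 2) ^ 2))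
  -- The weak type inequality is used at level `1 / 2`, since the functions are only known to be `≥
  -- 1`, not `> 1`.
  refine ge_of_tendsto' hlim0 fun n => ?_
  rw [sub_zero]
  obtain ⟨g, hg, hgc⟩ := hD.exists_quasiContinuous hreg (hcs n).1
  calc D.cap P ≤ D.cap (P ∩ {x | g x < 1}) + D.cap {x | 1 / 2 < |g x|} := by
        refine (D.cap_mono fun x hx => ?_).trans (hD.cap_union_le _ _)
        rcases lt_or_ge (g x) 1 with h | h
        · exact .inl ⟨hx, h⟩
        · exact .inr (show 1 / 2 < |g x| by linarith [le_abs_self (g x)])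
    _ ≤ _ := by
        rw [(hcs n).2 g hg hgc, zero_add]
        exact hD.cap_lt_abs_le hg (hcs n).1 hgc (by norm_num)

/-- Every function in the extended Dirichlet space has a quasi-continuous version. -/
lemma exists_quasiContinuous_of_mem_extendedSpace (hD : D.IsDirichletForm)
    [RegularSpace E] [LocallyCompactSpace E]
    [SigmaCompactSpace E] (hreg : D.IsRegular) {u : E →ₘ[m] ℝ} (hu : u ∈ D.extendedSpace) :
    ∃ f, D.QuasiContinuous f ∧ ∀ᵐ x ∂m, f x = u x := by
  obtain ⟨w, M, hw, hwM, hlim⟩ := hD.exists_bounded_of_mem_extendedSpace hu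
  obtain ⟨W, η, hW, hWmono, hWuniv, hη⟩ := hD.exists_cutoff hreg
  have hM0 : 0 ≤ M := (hD.energy_nonneg (hw 0)).trans (hwM 0)
  set r : ℕ → ℝ := fun n => (n : ℝ) + 1 with hr
  have hr0 : ∀ n, 0 < r n := fun n => by positivity
  have hrmono : Monotone r := fun i j hij => by simp only [hr]; gcongr
  have hrη : ∀ j i, r j • η i ∈ D.domain := fun j i => hD.smul_mem _ _ (hη i).1
  have hrηae : ∀ j i, ∀ᵐ x ∂m, (r j • η i) x = r j * η i x := fun j i => Lp.coeFn_smul _ _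
  have hrη0 : ∀ j i, ∀ᵐ x ∂m, 0 ≤ (r j • η i) x := fun j i => by
    filter_upwards [hrηae j i, (hη i).2.1] with x h1 h2
    rw [h1]
    exact mul_nonneg (hr0 j).le h2
  -- `v j i` is `u` clamped at the level `r j * η i`. It lies in `𝓕` although `u` need not, and on
  -- `W i` it is the clamp of `u` at the constant `r j`.
  have hex : ∀ j i, ∃ v ∈ D.domain,
      (∀ᵐ x ∂m, v x = max (-(r j * η i x)) (min (u x) (r j * η i x))) ∧
      D.energy v ≤ 4 * (M + D.energy (r j • η i)) := fun j i => by
    obtain ⟨-, -, v, hv, hvu, hvE, -⟩ := hD.exists_clamp_limit hw hwM hlim (hrη j i) (hrη0 j i)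
    refine ⟨v, hv, ?_, hvE⟩
    filter_upwards [hvu, hrηae j i] with x h1 h2
    rw [h1, h2]
  choose v hv hvu hvE using hex
  choose f hf hfv using fun j => hD.exists_quasiContinuous hreg (hv j j)
  have hfu : ∀ i j, i ≤ j → ∀ᵐ x ∂m, x ∈ W i → f j x = max (-r j) (min (u x) (r j)) :=
    fun i j hij => by
      filter_upwards [hfv j, hvu j j, (hη j).2.2] with x h1 h2 h3 hx
      rw [h1, h2, h3 (hWmono hij hx), mul_one]
  -- The local versions are consistent: clamping `f j` further, at `r i`, recovers `f i`
  -- quasi-everywhere on `W i`.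
  have hcons : ∀ i j, D.cap (W i ∩ {x | i ≤ j ∧ max (-r i) (min (f j x) (r i)) ≠ f i x}) = 0 := by
    intro i j
    by_cases hij : i ≤ j
    · simp only [hij, true_and]
      refine hD.cap_inter_ne_eq_zero ((hf j).comp (φ := fun a => max (-r i) (min a (r i)))
        (by fun_prop)) (hf i) (hW i) ?_
      filter_upwards [hfu i j hij, hfu i i le_rfl] with x h1 h2 hx
      rw [h1 hx, h2 hx, max_neg_min_max_neg_min (hr0 i).le (hrmono hij)]
    · simp only [hij, false_and, Set.ofPred_false, Set.inter_empty, hD.cap_empty]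
  -- This expresses that `u` is finite quasi-everywhere. On the set in question every `|v j i| / r
  -- j` with `j ≥ i` is at least `1`, yet these functions have bounded energy and tend to `0` in
  -- `L²`.
  have hfin : ∀ i, D.cap {x | x ∈ W i ∧ ∀ j ≥ i, r j ≤ |f j x|} = 0 := by
    intro i
    set z : ℕ → Lp ℝ 2 m := fun n => |(r (n + i))⁻¹ • v (n + i) i| with hzdef
    have hzae : ∀ n, ∀ᵐ x ∂m, z n x = (r (n + i))⁻¹ * |v (n + i) i x| := fun n => by
      filter_upwards [Lp.coeFn_abs ((r (n + i))⁻¹ • v (n + i) i),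
        Lp.coeFn_smul (r (n + i))⁻¹ (v (n + i) i)] with x h1 h2
      rw [hzdef, h1, h2, Pi.smul_apply, smul_eq_mul, abs_mul, abs_of_pos (inv_pos.2 (hr0 _))]
    have hz : ∀ n, z n ∈ D.domain ∧ D.energy (z n) ≤ 4 * (M + D.energy (η i)) := fun n => by
      obtain ⟨h1, h2⟩ := hD.abs_mem (hD.smul_mem (r (n + i))⁻¹ _ (hv (n + i) i))
      refine ⟨h1, h2.trans ?_⟩
      have h3 := hvE (n + i) i
      have h4 : 1 ≤ r (n + i) := by simp only [hr]; linarith [Nat.cast_nonneg (α := ℝ) (n + i)]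
      rw [hD.energy_smul _ (hη i).1] at h3
      rw [hD.energy_smul _ (hv _ _), inv_pow, inv_mul_le_iff₀ (by positivity)]
      refine h3.trans ?_
      have h5 : M ≤ r (n + i) ^ 2 * M := le_mul_of_one_le_left hM0 (one_le_pow₀ h4)
      linarith
    refine hD.cap_eq_zero_of_one_le hreg (fun n => (hz n).1) (fun n => (hz n).2) ?_ ?_
    · refine Lp.tendsto_of_ae_tendsto_of_abs_le (h := η i) (fun n => ?_) ?_
      · filter_upwards [hzae n, hvu (n + i) i, (hη i).2.1] with x h1 h2 h3
        have h4 : 0 ≤ r (n + i) * η i x := mul_nonneg (hr0 _).le h3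
        rw [h1, h2, abs_of_nonneg h3, abs_of_nonneg (mul_nonneg (inv_pos.2 (hr0 _)).le
          (abs_nonneg _)), inv_mul_le_iff₀ (hr0 _)]
        exact abs_max_neg_min_le h4
      · filter_upwards [ae_all_iff.2 hzae, ae_all_iff.2 fun n => hvu (n + i) i, (hη i).2.1,
          Lp.coeFn_zero ℝ 2 m] with x h1 h2 h3 h4
        rw [h4, Pi.zero_apply]
        have hlim0 : Tendsto (fun n => (r (n + i))⁻¹ * |u x|) atTop (𝓝 0) := by
          have h5 : Tendsto (fun n => r (n + i)) atTop atTop :=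
            (tendsto_atTop_add_const_right _ _ tendsto_natCast_atTop_atTop).comp
              (tendsto_add_atTop_nat i)
          simpa using h5.inv_tendsto_atTop.mul_const |u x|
        refine squeeze_zero (fun n => ?_) (fun n => ?_) hlim0
        · rw [h1]
          exact mul_nonneg (inv_pos.2 (hr0 _)).le (abs_nonneg _)
        · rw [h1, h2]
          exact mul_le_mul_of_nonneg_left (abs_max_neg_min_le_abs (mul_nonneg (hr0 _).le h3))
            (inv_pos.2 (hr0 (n + i))).le
    · intro n g hg hgz
      have h1 := hD.cap_inter_lt_eq_zero ((hf (n + i)).comp continuous_abs)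
        (hg.comp (φ := fun a => r (n + i) * a) (by fun_prop)) (hW i) (by
          filter_upwards [hfu i (n + i) (by omega), hgz, hzae n, hvu (n + i) i, (hη i).2.2]
            with x e1 e2 e3 e4 e5 hx
          rw [e1 hx, e2, e3, e4, e5 hx, mul_one, mul_inv_cancel_left₀ (hr0 _).ne'])
      refine le_antisymm ((D.cap_mono ?_).trans h1.le) zero_le
      rintro x ⟨⟨hxW, hx⟩, hx1⟩
      refine ⟨hxW, lt_of_lt_of_le ?_ (hx (n + i) (by omega))⟩
      have hx1' : g x < 1 := hx1
      nlinarith [hr0 (n + i)]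
  set N : Set E := (⋃ i, ⋃ j, W i ∩ {x | i ≤ j ∧ max (-r i) (min (f j x) (r i)) ≠ f i x}) ∪
    ⋃ i, {x | x ∈ W i ∧ ∀ j ≥ i, r j ≤ |f j x|} with hN
  have hNcap : D.cap N = 0 := hD.cap_union_eq_zero
    (hD.cap_iUnion_eq_zero fun i => hD.cap_iUnion_eq_zero fun j => hcons i j)
    (hD.cap_iUnion_eq_zero hfin)
  have hNeq : ∀ x ∉ N, ∀ i j, i ≤ j → x ∈ W i → |f i x| < r i → f j x = f i x := by
    intro x hx i j hij hxW hlt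
    refine eq_of_max_neg_min_eq ?_ hlt
    by_contra h
    exact hx (.inl (Set.mem_iUnion.2 ⟨i, Set.mem_iUnion.2 ⟨j, hxW, hij, h⟩⟩))
  have hNex : ∀ x ∉ N, ∃ i, x ∈ W i ∧ |f i x| < r i := by
    intro x hx
    obtain ⟨i, hi⟩ := Set.mem_iUnion.1 (hWuniv ▸ Set.mem_univ x)
    by_contra! h
    exact hx (.inr (Set.mem_iUnion.2 ⟨i, hi, fun j hj => h j (hWmono hj hi)⟩))
  classical
  -- Glue: use the first index at which the truncation is inactive. Off `N` any other such index
  -- gives the same value.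
  set g : E → ℝ := fun x => if h : ∃ i, x ∈ W i ∧ |f i x| < r i then f (Nat.find h) x else 0
    with hg
  have hgf : ∀ x ∉ N, ∀ i, x ∈ W i → |f i x| < r i → g x = f i x := by
    intro x hx i hxW hlt
    have h : ∃ i, x ∈ W i ∧ |f i x| < r i := ⟨i, hxW, hlt⟩
    simp only [hg, dif_pos h]
    exact (hNeq x hx _ i (Nat.find_min' h ⟨hxW, hlt⟩) (Nat.find_spec h).1 (Nat.find_spec h).2).symm
  refine ⟨g, fun ε hε => ?_, ?_⟩
  · obtain ⟨δ, hδ0, hδ⟩ := ENNReal.exists_pos_sum_of_countable hε.ne' ℕ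
    choose G hG hGδ hfG using fun n => (hf n).exists_isOpen (ENNReal.coe_pos.2 (hδ0 n))
    have hcap : D.cap ((⋃ n, G n) ∪ N) < ε := by
      calc D.cap ((⋃ n, G n) ∪ N) ≤ D.cap (⋃ n, G n) + D.cap N := hD.cap_union_le _ _
        _ ≤ ∑' n, (δ n : ℝ≥0∞) := by
            rw [hNcap, add_zero]
            exact (hD.cap_iUnion_le _).trans (ENNReal.tsum_le_tsum fun n =>
              (D.cap_le_capOpen (hG n) subset_rfl).trans (hGδ n).le)
        _ < ε := hδ
    obtain ⟨U, hU, hsub, hUε⟩ := exists_isOpen_of_cap_lt hcap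
    refine ⟨U, hU, (D.cap_le_capOpen hU subset_rfl).trans_lt hUε, fun x hx => ?_⟩
    have hUN : ∀ y ∈ Uᶜ, y ∉ N := fun y hy hyN => hy (hsub (.inr hyN))
    have hfU : ∀ n, ContinuousOn (f n) Uᶜ := fun n => (hfG n).mono
      (Set.compl_subset_compl.2 ((Set.subset_iUnion G n).trans
        (Set.subset_union_left.trans hsub)))
    obtain ⟨i, hi, hlt⟩ := hNex x (hUN x hx)
    -- The conditions `y ∈ W i` and `|f i y| < r i` persist near `x` within the complement of `U`,
    -- so `g` coincides there with the single function `f i`.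
    refine (hfU i x hx).congr_of_eventuallyEq ?_ (hgf x (hUN x hx) i hi hlt)
    have h1 : ∀ᶠ y in 𝓝[Uᶜ] x, |f i y| < r i :=
      (hfU i x hx).abs.eventually (gt_mem_nhds hlt)
    have h2 : ∀ᶠ y in 𝓝[Uᶜ] x, y ∈ W i := mem_nhdsWithin_of_mem_nhds ((hW i).mem_nhds hi)
    filter_upwards [h1, h2, self_mem_nhdsWithin] with y e1 e2 e3
    exact hgf y (hUN y e3) i e2 e1
  · have hNm : ∀ᵐ x ∂m, x ∉ N :=
      measure_eq_zero_iff_ae_notMem.1 (le_antisymm ((hD.measure_le_cap N).trans hNcap.le) zero_le)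
    filter_upwards [hNm, ae_all_iff.2 fun i => hfu i i le_rfl] with x h1 h2
    obtain ⟨i, hi⟩ := Set.mem_iUnion.1 (hWuniv ▸ Set.mem_univ x)
    obtain ⟨k, hk⟩ := exists_nat_gt |u x|
    have hlt : |u x| < r (max i k) := hk.trans_le (by
      have : (k : ℝ) ≤ (max i k : ℕ) := by exact_mod_cast le_max_right i k
      simp only [hr]
      linarith)
    have hxW := hWmono (le_max_left i k) hi
    have h3 := h2 _ hxW
    rw [max_neg_min_of_abs_le hlt.le] at h3
    rw [hgf x h1 _ hxW (by rw [h3]; exact hlt), h3]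

end IsDirichletForm

end Topological

end L2Form

/-- The jump integral `∬ (f(x) - f(y))² μ(dx) μ(dy)`. -/
def jumpIntegral {E : Type*} [MeasurableSpace E] (μ : Measure E) (f : E → ℝ) : ℝ≥0∞ :=
  ∫⁻ z, ENNReal.ofReal ((f z.1 - f z.2) ^ 2) ∂(μ.prod μ)

/-! ### The jump integral -/

section JumpIntegral

variable {E : Type*} [MeasurableSpace E] {μ : Measure E} {f g : E → ℝ}

lemma ae_prod_fst_snd {p : E → Prop} (h : ∀ᵐ x ∂μ, p x) :
    ∀ᵐ z ∂(μ.prod μ), p z.1 ∧ p z.2 :=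
  (Measure.quasiMeasurePreserving_fst.ae h).and (Measure.quasiMeasurePreserving_snd.ae h)

lemma AEMeasurable.jump (hf : AEMeasurable f μ) :
    AEMeasurable (fun z : E × E => f z.1 - f z.2) (μ.prod μ) :=
  (hf.comp_quasiMeasurePreserving Measure.quasiMeasurePreserving_fst).sub
    (hf.comp_quasiMeasurePreserving Measure.quasiMeasurePreserving_snd)

lemma jumpIntegral_mono (h : ∀ᵐ z ∂(μ.prod μ), (f z.1 - f z.2) ^ 2 ≤ (g z.1 - g z.2) ^ 2) :
    jumpIntegral μ f ≤ jumpIntegral μ g :=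
  lintegral_mono_ae (h.mono fun _ hz => ENNReal.ofReal_le_ofReal hz)

lemma jumpIntegral_congr (h : ∀ᵐ x ∂μ, f x = g x) : jumpIntegral μ f = jumpIntegral μ g :=
  lintegral_congr_ae ((ae_prod_fst_snd h).mono fun z hz => by simp only [hz.1, hz.2])

lemma jumpIntegral_comp_le {φ : ℝ → ℝ} (hφ : LipschitzWith 1 φ) :
    jumpIntegral μ (fun x => φ (f x)) ≤ jumpIntegral μ f :=
  jumpIntegral_mono (.of_forall fun z => by
    refine sq_le_sq.2 ?_
    have := hφ.dist_le_mul (f z.1) (f z.2)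
    rwa [NNReal.coe_one, one_mul, Real.dist_eq, Real.dist_eq] at this)

/-- With `d = f - g`, the jump of `f` is that of `g` plus `d(x) - d(y)`, so its square is at most
twice the square for `g` plus `4 (d(x)² + d(y)²)`. Each of the last two terms integrates to `μ(E) ∫
d²`, whence the factor `8`. -/
lemma jumpIntegral_le_add [IsFiniteMeasure μ] (hf : AEMeasurable f μ) (hg : AEMeasurable g μ) :
    jumpIntegral μ f ≤ 2 * jumpIntegral μ g +
      8 * μ Set.univ * ∫⁻ x, ENNReal.ofReal ((f x - g x) ^ 2) ∂μ := by
  set d : E → ℝ≥0∞ := fun x => ENNReal.ofReal ((f x - g x) ^ 2) with hd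
  have hdm : AEMeasurable d μ := ((hf.sub hg).pow_const 2).ennreal_ofReal
  have h1 : AEMeasurable (fun z : E × E => d z.1) (μ.prod μ) :=
    hdm.comp_quasiMeasurePreserving Measure.quasiMeasurePreserving_fst
  have h2 : AEMeasurable (fun z : E × E => d z.2) (μ.prod μ) :=
    hdm.comp_quasiMeasurePreserving Measure.quasiMeasurePreserving_snd
  have hgm : AEMeasurable (fun z : E × E => ENNReal.ofReal ((g z.1 - g z.2) ^ 2)) (μ.prod μ) :=
    (hg.jump.pow_const 2).ennreal_ofReal
  have e1 : ∫⁻ z : E × E, d z.1 ∂(μ.prod μ) = μ Set.univ * ∫⁻ x, d x ∂μ := by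
    rw [lintegral_prod _ h1]
    simp only [lintegral_const]
    rw [lintegral_mul_const' _ _ (measure_ne_top _ _), mul_comm]
  have e2 : ∫⁻ z : E × E, d z.2 ∂(μ.prod μ) = μ Set.univ * ∫⁻ x, d x ∂μ := by
    rw [lintegral_prod _ h2]
    simp only [lintegral_const]
    rw [mul_comm]
  calc jumpIntegral μ f ≤ ∫⁻ z : E × E, (2 * ENNReal.ofReal ((g z.1 - g z.2) ^ 2)
        + 4 * (d z.1 + d z.2)) ∂(μ.prod μ) := by
        refine lintegral_mono fun z => ?_
        have e : 2 * ENNReal.ofReal ((g z.1 - g z.2) ^ 2) + 4 * (d z.1 + d z.2) =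
            ENNReal.ofReal (2 * (g z.1 - g z.2) ^ 2 +
              4 * ((f z.1 - g z.1) ^ 2 + (f z.2 - g z.2) ^ 2)) := by
          rw [ENNReal.ofReal_add (by positivity) (by positivity),
            ENNReal.ofReal_mul (by norm_num), ENNReal.ofReal_mul (by norm_num),
            ENNReal.ofReal_add (by positivity) (by positivity)]
          simp [hd]
        rw [e]
        refine ENNReal.ofReal_le_ofReal ?_
        nlinarith [sq_nonneg ((g z.1 - g z.2) - ((f z.1 - g z.1) - (f z.2 - g z.2))),
          sq_nonneg ((f z.1 - g z.1) + (f z.2 - g z.2))]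
    _ = 2 * jumpIntegral μ g + 4 * (μ Set.univ * (∫⁻ x, d x ∂μ) +
          μ Set.univ * ∫⁻ x, d x ∂μ) := by
        rw [lintegral_add_left' (hgm.const_mul 2), lintegral_const_mul'' _ hgm,
          lintegral_const_mul' _ _ ENNReal.ofNat_ne_top, lintegral_add_left' h1, e1, e2]
        rfl
    _ = _ := by ring

lemma jumpIntegral_convex_comb_le (hf : AEMeasurable f μ) {a b : ℝ} (ha : 0 ≤ a) (hb : 0 ≤ b)
    (hab : a + b = 1) {M : ℝ≥0∞} (hfM : jumpIntegral μ f ≤ M) (hgM : jumpIntegral μ g ≤ M) :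
    jumpIntegral μ (fun x => a * f x + b * g x) ≤ M := by
  calc jumpIntegral μ (fun x => a * f x + b * g x)
      ≤ ∫⁻ z : E × E, (ENNReal.ofReal a * ENNReal.ofReal ((f z.1 - f z.2) ^ 2) +
          ENNReal.ofReal b * ENNReal.ofReal ((g z.1 - g z.2) ^ 2)) ∂(μ.prod μ) := by
        refine lintegral_mono fun z => ?_
        rw [← ENNReal.ofReal_mul ha, ← ENNReal.ofReal_mul hb,
          ← ENNReal.ofReal_add (by positivity) (by positivity)]
        refine ENNReal.ofReal_le_ofReal ?_
        obtain rfl : b = 1 - a := by linarith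
        nlinarith [mul_nonneg (mul_nonneg ha hb)
          (sq_nonneg ((f z.1 - f z.2) - (g z.1 - g z.2)))]
    _ = ENNReal.ofReal a * jumpIntegral μ f + ENNReal.ofReal b * jumpIntegral μ g := by
        rw [lintegral_add_left' ((hf.jump.pow_const 2).ennreal_ofReal.const_mul _),
          lintegral_const_mul' _ _ ENNReal.ofReal_ne_top,
          lintegral_const_mul' _ _ ENNReal.ofReal_ne_top]
        rfl
    _ ≤ ENNReal.ofReal a * M + ENNReal.ofReal b * M := by gcongr
    _ = M := by
        rw [← add_mul, ← ENNReal.ofReal_add ha hb, hab, ENNReal.ofReal_one, one_mul]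

lemma jumpIntegral_le_of_tendsto {f : ℕ → E → ℝ} (hf : ∀ n, AEMeasurable (f n) μ) {M : ℝ≥0∞}
    (hM : ∀ n, jumpIntegral μ (f n) ≤ M)
    (hlim : ∀ᵐ x ∂μ, Tendsto (fun n => f n x) atTop (𝓝 (g x))) : jumpIntegral μ g ≤ M := by
  calc jumpIntegral μ g ≤ ∫⁻ z : E × E, liminf (fun n =>
        ENNReal.ofReal ((f n z.1 - f n z.2) ^ 2)) atTop ∂(μ.prod μ) := by
        refine lintegral_mono_ae ((ae_prod_fst_snd hlim).mono fun z hz => le_of_eq ?_)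
        exact (Tendsto.liminf_eq (ENNReal.tendsto_ofReal ((hz.1.sub hz.2).pow 2))).symm
    _ ≤ liminf (fun n => jumpIntegral μ (f n)) atTop :=
        lintegral_liminf_le' fun n => ((hf n).jump.pow_const 2).ennreal_ofReal
    _ ≤ M := liminf_le_of_le (h := fun b hb => by
        obtain ⟨n, hn⟩ := hb.exists
        exact hn.trans (hM n))

end JumpIntegral

lemma lipschitzWith_max_neg_min (r : ℝ) : LipschitzWith 1 fun a : ℝ => max (-r) (min a r) :=
  (LipschitzWith.id.min_const r).const_max (-r)

/-! ### Quasi-continuous functions and smooth measures -/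

namespace L2Form

section Version

variable {E : Type*} [TopologicalSpace E] [MeasurableSpace E] {m : Measure E} {D : L2Form m}

lemma qcVersion_spec {u : E →ₘ[m] ℝ} (h : ∃ f, D.QuasiContinuous f ∧ ∀ᵐ x ∂m, f x = u x) :
    D.QuasiContinuous (D.qcVersion u) ∧ ∀ᵐ x ∂m, D.qcVersion u x = u x := by
  rw [qcVersion, dif_pos h]
  exact h.choose_spec

lemma ChargesNoPolarSet.ae_of_cap_eq_zero {μ : Measure E} (hμ : D.ChargesNoPolarSet μ)
    {p : E → Prop} (h : D.cap {x | ¬ p x} = 0) : ∀ᵐ x ∂μ, p x := hμ _ h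

/-- A quasi-continuous function is continuous on closed sets whose union has a polar, hence
`μ`-null, complement. -/
lemma ChargesNoPolarSet.aemeasurable [OpensMeasurableSpace E] {μ : Measure E}
    (hμ : D.ChargesNoPolarSet μ) {f : E → ℝ} (hf : D.QuasiContinuous f) :
    AEMeasurable f μ := by
  have hpos : ∀ n : ℕ, (0 : ℝ≥0∞) < ((n : ℝ≥0∞) + 1)⁻¹ := fun n =>
    ENNReal.inv_pos.2 (ENNReal.add_ne_top.2 ⟨ENNReal.natCast_ne_top n, ENNReal.one_ne_top⟩)
  choose G hG hGε hfG using fun n : ℕ => hf.exists_isOpen (hpos n)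
  have hcap : D.cap (⋂ n, G n) = 0 := by
    refine le_antisymm (ge_of_tendsto' (f := fun n : ℕ => ((n : ℝ≥0∞) + 1)⁻¹) (x := atTop) ?_
      fun n => ?_) zero_le
    · have := ENNReal.tendsto_inv_nat_nhds_zero.comp (tendsto_add_atTop_nat 1)
      simpa [Function.comp_def] using this
    · exact (D.cap_le_capOpen (hG n) (Set.iInter_subset G n)).trans (hGε n).le
  have h1 : AEMeasurable f (μ.restrict (⋃ n, (G n)ᶜ)) :=
    aemeasurable_iUnion_iff.2 fun n => (hfG n).aemeasurable (hG n).measurableSet.compl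
  rwa [Measure.restrict_eq_self_of_ae_mem] at h1
  refine hμ.ae_of_cap_eq_zero ?_
  convert hcap using 2
  ext x
  simp

end Version

namespace IsDirichletForm

section Smooth

variable {E : Type*} [TopologicalSpace E] [MeasurableSpace E] {m : Measure E} {D : L2Form m}
variable {μ : Measure E}
variable {f g : E → ℝ} {u v w : Lp ℝ 2 m}

lemma ae_eq_of_ae_eq_on (hD : D.IsDirichletForm) (hμ : D.ChargesNoPolarSet μ)
    (hf : D.QuasiContinuous f) (hg : D.QuasiContinuous g) {W : Set E}
    (hW : IsOpen W) (h : ∀ᵐ x ∂m, x ∈ W → f x = g x) : ∀ᵐ x ∂μ, x ∈ W → f x = g x := by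
  refine hμ.ae_of_cap_eq_zero ?_
  convert hD.cap_inter_ne_eq_zero hf hg hW h using 2
  ext x
  simp

lemma ae_eq_of_ae_eq (hD : D.IsDirichletForm) (hμ : D.ChargesNoPolarSet μ)
    (hf : D.QuasiContinuous f) (hg : D.QuasiContinuous g)
    (h : ∀ᵐ x ∂m, f x = g x) : ∀ᵐ x ∂μ, f x = g x := by
  filter_upwards [hD.ae_eq_of_ae_eq_on hμ hf hg isOpen_univ (h.mono fun x hx _ => hx)] with x hx
    using hx (Set.mem_univ x)

lemma ae_le_of_ae_le (hD : D.IsDirichletForm) (hμ : D.ChargesNoPolarSet μ)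
    (hf : D.QuasiContinuous f) (hg : D.QuasiContinuous g)
    (h : ∀ᵐ x ∂m, f x ≤ g x) : ∀ᵐ x ∂μ, f x ≤ g x := by
  refine hμ.ae_of_cap_eq_zero ?_
  simpa only [not_le, Set.univ_inter] using
    hD.cap_inter_lt_eq_zero hf hg isOpen_univ (h.mono fun x hx _ => hx)

/-- The version picked by choice may be replaced `μ`-a.e. by any convenient quasi-continuous one. -/
lemma ae_qcVersion_eq (hD : D.IsDirichletForm) (hμ : D.ChargesNoPolarSet μ)
    {u : E →ₘ[m] ℝ} (hf : D.QuasiContinuous f) (h : ∀ᵐ x ∂m, f x = u x) :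
    ∀ᵐ x ∂μ, D.qcVersion u x = f x := by
  obtain ⟨h1, h2⟩ := qcVersion_spec ⟨f, hf, h⟩
  refine hD.ae_eq_of_ae_eq hμ h1 hf ?_
  filter_upwards [h, h2] with x h3 h4
  rw [h3, h4]

lemma jumpEnergy_eq (hD : D.IsDirichletForm) (hμ : D.ChargesNoPolarSet μ)
    {u : E →ₘ[m] ℝ} (hf : D.QuasiContinuous f)
    (h : ∀ᵐ x ∂m, f x = u x) : D.jumpEnergy μ u = jumpIntegral μ f :=
  jumpIntegral_congr (hD.ae_qcVersion_eq hμ hf h)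

/-- Convex combinations of the tails of a bounded and energy bounded sequence converge in
`L²(μ)`. -/
lemma exists_convexHull_lintegral_lt (hD : D.IsDirichletForm) (hμ : D.ChargesNoPolarSet μ)
    [BorelSpace E] [RegularSpace E] [LocallyCompactSpace E]
    [SigmaCompactSpace E] [IsFiniteMeasure μ] (hreg : D.IsRegular) {w : ℕ → Lp ℝ 2 m}
    (hw : ∀ n, w n ∈ D.domain) {M : ℝ} (hM : ∀ n, D.energy (w n) ≤ M) {k : ℝ} (hk : 0 ≤ k)
    (hwk : ∀ n, ∀ᵐ x ∂m, |w n x| ≤ k) {u : E →ₘ[m] ℝ}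
    (hlim : ∀ᵐ x ∂m, Tendsto (fun n => w n x) atTop (𝓝 (u x))) (hf : D.QuasiContinuous f)
    (hfu : ∀ᵐ x ∂m, f x = u x) (N : ℕ) {δ : ℝ≥0∞} (hδ : 0 < δ) :
    ∃ z ∈ convexHull ℝ (w '' Set.Ici N), ∀ g, D.QuasiContinuous g → (∀ᵐ x ∂m, g x = z x) →
      ∫⁻ x, ENNReal.ofReal ((g x - f x) ^ 2) ∂μ < δ := by
  obtain ⟨W, η, hW, hWmono, hWuniv, hη⟩ := hD.exists_cutoff hreg
  -- All functions involved are bounded by `k`, so `4 k² μ(W i)ᶜ` bounds the error outside `W i`.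
  obtain ⟨i, hi⟩ : ∃ i, ENNReal.ofReal (4 * k ^ 2) * μ (W i)ᶜ < δ / 2 := by
    have h1 : Tendsto (fun i => μ (W i)ᶜ) atTop (𝓝 (μ (⋂ i, (W i)ᶜ))) :=
      tendsto_measure_iInter_atTop (fun i => (hW i).measurableSet.compl.nullMeasurableSet)
        (fun i j hij => Set.compl_subset_compl.2 (hWmono hij)) ⟨0, measure_ne_top _ _⟩
    rw [← Set.compl_iUnion, hWuniv, Set.compl_univ, measure_empty] at h1
    have h2 := ENNReal.Tendsto.const_mul (a := ENNReal.ofReal (4 * k ^ 2)) h1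
      (.inr ENNReal.ofReal_ne_top)
    rw [mul_zero] at h2
    exact (h2.eventually (gt_mem_nhds (ENNReal.half_pos hδ.ne'))).exists
  have hkη := hD.smul_mem k _ (hη i).1
  have hkη' : ∀ᵐ x ∂m, (k • η i) x = k * η i x := Lp.coeFn_smul _ _
  -- Clamping at `k η_i` changes nothing on `W i`, but makes the sequence converge in `L²(m)`.
  obtain ⟨y, hy, v, hv, hvu, -, c, hc, hcv⟩ := hD.exists_clamp_limit hw hM hlim hkη (by
    filter_upwards [hkη', (hη i).2.1] with x h1 h2
    rw [h1]; positivity)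
  have hyw : ∀ n, ∀ᵐ x ∂m, x ∈ W i → y n x = w n x := fun n => by
    filter_upwards [(hy n).2, hkη', (hη i).2.2, hwk n] with x h1 h2 h3 h4 hx
    rw [h1, h2, h3 hx, mul_one, max_neg_min_of_abs_le h4]
  have huk : ∀ᵐ x ∂m, |u x| ≤ k := by
    filter_upwards [hlim, ae_all_iff.2 hwk] with x h1 h2
    exact le_of_tendsto h1.abs (.of_forall h2)
  have hvu' : ∀ᵐ x ∂m, x ∈ W i → v x = u x := by
    filter_upwards [hvu, hkη', (hη i).2.2, huk] with x h1 h2 h3 h4 hx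
    rw [h1, h2, h3 hx, mul_one, max_neg_min_of_abs_le h4]
  -- The same convex weights applied to the unclamped sequence give functions that agree with `c n`
  -- on `W i`.
  have hz : ∀ n, ∃ z ∈ convexHull ℝ (w '' Set.Ici n), ∀ᵐ x ∂m, x ∈ W i → c n x = z x := by
    intro n
    have hconv : Convex ℝ {c : Lp ℝ 2 m | ∃ z ∈ convexHull ℝ (w '' Set.Ici n),
        ∀ᵐ x ∂m, x ∈ W i → c x = z x} := by
      rintro c₁ ⟨z₁, hz₁, h₁⟩ c₂ ⟨z₂, hz₂, h₂⟩ a b ha hb hab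
      refine ⟨_, convex_convexHull ℝ _ hz₁ hz₂ ha hb hab, ?_⟩
      filter_upwards [h₁, h₂, Lp.coeFn_add (a • c₁) (b • c₂), Lp.coeFn_smul a c₁,
        Lp.coeFn_smul b c₂, Lp.coeFn_add (a • z₁) (b • z₂), Lp.coeFn_smul a z₁,
        Lp.coeFn_smul b z₂] with x e1 e2 e3 e4 e5 e6 e7 e8 hx
      rw [e3, e6, Pi.add_apply, Pi.add_apply, e4, e5, e7, e8, Pi.smul_apply, Pi.smul_apply,
        Pi.smul_apply, Pi.smul_apply, e1 hx, e2 hx]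
    refine convexHull_min ?_ hconv (hc n).2
    rintro _ ⟨j, hj, rfl⟩
    exact ⟨w j, subset_convexHull ℝ _ ⟨j, hj, rfl⟩, hyw j⟩
  choose z hz hcz using hz
  have hzd := fun n => hD.convexHull_subset_energy_le hw hM (hz n)
  choose F hF hFc using fun n => hD.exists_quasiContinuous hreg (hc n).1
  choose φ hφ hφz using fun n => hD.exists_quasiContinuous hreg (hzd n).1
  obtain ⟨ns, hns, g, hg, hgv, hcap⟩ := hD.exists_quasiContinuous_of_tendsto
    (fun n => (hc n).1) hF hFc hv hcv
  have hzk : ∀ n, ∀ᵐ x ∂m, |z n x| ≤ k := fun n => by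
    filter_upwards [Lp.ae_mem_convexHull (hz n), ae_all_iff.2 hwk] with x h1 h2
    refine abs_le.2 (convexHull_min ?_ (convex_Icc (-k) k) h1)
    rintro _ ⟨j, -, rfl⟩
    exact abs_le.1 (h2 j)
  have hφk : ∀ᵐ x ∂μ, ∀ n, |φ n x| ≤ k := ae_all_iff.2 fun n =>
    hD.ae_le_of_ae_le hμ ((hφ n).comp continuous_abs)
      (hD.quasiContinuous_of_continuous continuous_const) (by
        filter_upwards [hφz n, hzk n] with x h1 h2
        rwa [h1])
  have hfk : ∀ᵐ x ∂μ, |f x| ≤ k :=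
    hD.ae_le_of_ae_le hμ (hf.comp continuous_abs)
      (hD.quasiContinuous_of_continuous continuous_const) (by
        filter_upwards [hfu, huk] with x h1 h2
        rwa [h1])
  have hφF : ∀ᵐ x ∂μ, ∀ n, x ∈ W i → φ n x = F n x := ae_all_iff.2 fun n =>
    hD.ae_eq_of_ae_eq_on hμ (hφ n) (hF n) (hW i) (by
      filter_upwards [hφz n, hFc n, hcz n] with x h1 h2 h3 hx
      rw [h1, h2, h3 hx])
  have hgf : ∀ᵐ x ∂μ, x ∈ W i → g x = f x :=
    hD.ae_eq_of_ae_eq_on hμ hg hf (hW i) (by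
      filter_upwards [hgv, hfu, hvu'] with x h1 h2 h3 hx
      rw [h1, h2, h3 hx])
  have hconv : ∀ᵐ x ∂μ, Tendsto (fun n => F (ns n) x) atTop (𝓝 (g x)) := hμ.ae_of_cap_eq_zero hcap
  have hsq : ∀ a b : ℝ, |a| ≤ k → |b| ≤ k → (a - b) ^ 2 ≤ 4 * k ^ 2 := fun a b ha hb => by
    have h1 : |a - b| ≤ 2 * k := (abs_sub a b).trans (by linarith)
    rw [← sq_abs]
    nlinarith [abs_nonneg (a - b)]
  have hfm := hμ.aemeasurable hf
  have hφm := fun n => hμ.aemeasurable (hφ n)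
  have hint : Tendsto (fun n => ∫⁻ x, (W i).indicator
      (fun x => ENNReal.ofReal ((φ (ns n) x - f x) ^ 2)) x ∂μ) atTop (𝓝 (∫⁻ _, 0 ∂μ)) := by
    refine tendsto_lintegral_of_dominated_convergence' (fun _ => ENNReal.ofReal (4 * k ^ 2))
      (fun n => ((((hφm _).sub hfm).pow_const 2).ennreal_ofReal).indicator (hW i).measurableSet)
      (fun n => ?_) ?_ ?_
    · filter_upwards [hφk, hfk] with x h1 h2
      refine (Set.indicator_le_self' (fun _ _ => zero_le) x).trans ?_
      exact ENNReal.ofReal_le_ofReal (hsq _ _ (h1 _) h2)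
    · rw [lintegral_const]
      exact ENNReal.mul_ne_top ENNReal.ofReal_ne_top (measure_ne_top _ _)
    · filter_upwards [hφF, hgf, hconv] with x h1 h2 h3
      by_cases hx : x ∈ W i
      · simp only [Set.indicator_of_mem hx, h1 _ hx]
        rw [h2 hx] at h3
        simpa using ENNReal.tendsto_ofReal ((h3.sub_const (f x)).pow 2)
      · simp only [Set.indicator_of_notMem hx]
        exact tendsto_const_nhds
  rw [lintegral_zero] at hint
  obtain ⟨n, hn, hnN⟩ := ((hint.eventually (gt_mem_nhds (ENNReal.half_pos hδ.ne'))).and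
    (eventually_ge_atTop N)).exists
  refine ⟨z (ns n), convexHull_mono (Set.image_mono (Set.Ici_subset_Ici.2
    (hnN.trans hns.le_apply))) (hz _), fun h hh hhz => ?_⟩
  have hhφ := hD.ae_eq_of_ae_eq hμ hh (hφ (ns n)) (by
    filter_upwards [hhz, hφz (ns n)] with x h1 h2
    rw [h1, h2])
  calc ∫⁻ x, ENNReal.ofReal ((h x - f x) ^ 2) ∂μ
      ≤ ∫⁻ x, ((W i).indicator (fun x => ENNReal.ofReal ((φ (ns n) x - f x) ^ 2)) x +
          (W i)ᶜ.indicator (fun _ => ENNReal.ofReal (4 * k ^ 2)) x) ∂μ := by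
        refine lintegral_mono_ae ?_
        filter_upwards [hhφ, hφk, hfk] with x h1 h2 h3
        by_cases hx : x ∈ W i
        · simp [hx, h1]
        · simp only [hx, not_false_eq_true, Set.indicator_of_notMem, Set.mem_compl_iff,
            Set.indicator_of_mem, zero_add, h1]
          exact ENNReal.ofReal_le_ofReal (hsq _ _ (h2 _) h3)
    _ = (∫⁻ x, (W i).indicator (fun x => ENNReal.ofReal ((φ (ns n) x - f x) ^ 2)) x ∂μ) +
          ENNReal.ofReal (4 * k ^ 2) * μ (W i)ᶜ := by
        rw [lintegral_add_right _ (measurable_const.indicator (hW i).measurableSet.compl),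
          lintegral_indicator_const (hW i).measurableSet.compl]
    _ < δ / 2 + δ / 2 := ENNReal.add_lt_add hn hi
    _ = δ := ENNReal.add_halves δ

end Smooth

end IsDirichletForm

end L2Form

/-! ### The snapping-out form is a Dirichlet form -/

namespace L2Form

variable {E : Type*} [TopologicalSpace E] [MeasurableSpace E] {m : Measure E} {D : L2Form m}

/-- The jump `(x, y) ↦ u(x) - u(y)` of the quasi-continuous version of `u`. -/
def jump (D : L2Form m) (u : Lp ℝ 2 m) (z : E × E) : ℝ :=
  D.qcVersion (u : E →ₘ[m] ℝ) z.1 - D.qcVersion (u : E →ₘ[m] ℝ) z.2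

lemma snappingOut_toFun (D : L2Form m) (μ : Measure E) (u v : Lp ℝ 2 m) :
    (D.snappingOut μ).toFun u v = D.toFun u v +
      1 / (2 * μ.real Set.univ) * ∫ z, D.jump u z * D.jump v z ∂(μ.prod μ) := rfl

namespace IsDirichletForm

variable {μ : Measure E}
variable {u v w : Lp ℝ 2 m}

lemma qcVersion_spec (hD : D.IsDirichletForm) (hreg : D.IsRegular) (hu : u ∈ D.domain) :
    D.QuasiContinuous (D.qcVersion (u : E →ₘ[m] ℝ)) ∧
      ∀ᵐ x ∂m, D.qcVersion (u : E →ₘ[m] ℝ) x = u x :=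
  L2Form.qcVersion_spec (hD.exists_quasiContinuous hreg hu)

lemma ae_qcVersion_add (hD : D.IsDirichletForm) (hreg : D.IsRegular) (hμ : D.ChargesNoPolarSet μ)
    (hu : u ∈ D.domain) (hv : v ∈ D.domain) :
    ∀ᵐ x ∂μ, D.qcVersion ((u + v : Lp ℝ 2 m) : E →ₘ[m] ℝ) x =
      D.qcVersion (u : E →ₘ[m] ℝ) x + D.qcVersion (v : E →ₘ[m] ℝ) x := by
  obtain ⟨h1, h2⟩ := hD.qcVersion_spec hreg hu
  obtain ⟨h3, h4⟩ := hD.qcVersion_spec hreg hv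
  refine hD.ae_qcVersion_eq hμ (hD.quasiContinuous_comp₂ h1 h3 (φ := fun p => p.1 + p.2)
    (by fun_prop)) ?_
  filter_upwards [h2, h4, Lp.coeFn_add u v] with x e1 e2 e3
  rw [e1, e2]
  exact e3.symm

lemma ae_qcVersion_smul (hD : D.IsDirichletForm) (hreg : D.IsRegular) (hμ : D.ChargesNoPolarSet μ)
    (c : ℝ) (hu : u ∈ D.domain) :
    ∀ᵐ x ∂μ, D.qcVersion ((c • u : Lp ℝ 2 m) : E →ₘ[m] ℝ) x =
      c * D.qcVersion (u : E →ₘ[m] ℝ) x := by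
  obtain ⟨h1, h2⟩ := hD.qcVersion_spec hreg hu
  refine hD.ae_qcVersion_eq hμ (h1.comp (φ := fun a => c * a) (by fun_prop)) ?_
  filter_upwards [h2, Lp.coeFn_smul c u] with x e1 e2
  rw [e1]
  exact e2.symm

lemma ae_jump_add (hD : D.IsDirichletForm) (hreg : D.IsRegular) (hμ : D.ChargesNoPolarSet μ)
    (hu : u ∈ D.domain) (hv : v ∈ D.domain) :
    ∀ᵐ z ∂(μ.prod μ), D.jump (u + v) z = D.jump u z + D.jump v z := by
  filter_upwards [ae_prod_fst_snd (hD.ae_qcVersion_add hreg hμ hu hv)] with z hz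
  rw [jump, hz.1, hz.2, jump, jump]
  ring

lemma ae_jump_smul (hD : D.IsDirichletForm) (hreg : D.IsRegular) (hμ : D.ChargesNoPolarSet μ)
    (c : ℝ) (hu : u ∈ D.domain) :
    ∀ᵐ z ∂(μ.prod μ), D.jump (c • u) z = c * D.jump u z := by
  filter_upwards [ae_prod_fst_snd (hD.ae_qcVersion_smul hreg hμ c hu)] with z hz
  rw [jump, hz.1, hz.2, jump]
  ring

variable [BorelSpace E]

lemma aestronglyMeasurable_jump (hD : D.IsDirichletForm) (hreg : D.IsRegular)
    (hμ : D.ChargesNoPolarSet μ)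
    (hu : u ∈ D.domain) :
    AEStronglyMeasurable (D.jump u) (μ.prod μ) :=
  (hμ.aemeasurable (hD.qcVersion_spec hreg hu).1).jump.aestronglyMeasurable

lemma mem_snappingOut_iff (hD : D.IsDirichletForm) (hreg : D.IsRegular) (hμ : D.ChargesNoPolarSet μ)
    :
    u ∈ (D.snappingOut μ).domain ↔ u ∈ D.domain ∧ MemLp (D.jump u) 2 (μ.prod μ) := by
  refine and_congr_right fun hu => ?_
  have h1 := hD.aestronglyMeasurable_jump hreg hμ hu
  have h2 : AEStronglyMeasurable (fun z => D.jump u z ^ 2) (μ.prod μ) := h1.pow 2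
  rw [memLp_two_iff_integrable_sq h1, Integrable, and_iff_right h2,
    hasFiniteIntegral_iff_ofReal (.of_forall fun z => sq_nonneg _)]
  rfl

lemma integrable_jump_mul (hD : D.IsDirichletForm) (hreg : D.IsRegular) (hμ : D.ChargesNoPolarSet μ)
    (hu : u ∈ (D.snappingOut μ).domain)
    (hv : v ∈ (D.snappingOut μ).domain) :
    Integrable (fun z => D.jump u z * D.jump v z) (μ.prod μ) :=
  ((hD.mem_snappingOut_iff hreg hμ).1 hu).2.integrable_mul
    ((hD.mem_snappingOut_iff hreg hμ).1 hv).2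

lemma energy_snappingOut (hD : D.IsDirichletForm) (hreg : D.IsRegular) (hμ : D.ChargesNoPolarSet μ)
    (hu : u ∈ (D.snappingOut μ).domain) :
    (D.snappingOut μ).energy u = D.energy u +
      1 / (2 * μ.real Set.univ) * (D.jumpEnergy μ (u : E →ₘ[m] ℝ)).toReal := by
  rw [energy, snappingOut_toFun, energy]
  congr 2
  simp only [← sq]
  rw [integral_eq_lintegral_of_nonneg_ae (.of_forall fun z => sq_nonneg _)
    ((hD.aestronglyMeasurable_jump hreg hμ hu.1).pow 2)]
  rfl

lemma energy_le_energy_snappingOut (hD : D.IsDirichletForm) (hreg : D.IsRegular)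
    (hμ : D.ChargesNoPolarSet μ)
    (hu : u ∈ (D.snappingOut μ).domain) :
    D.energy u ≤ (D.snappingOut μ).energy u := by
  rw [hD.energy_snappingOut hreg hμ hu]
  exact le_add_of_nonneg_right (by positivity)

lemma mem_snappingOut_of_bounded (hD : D.IsDirichletForm) (hreg : D.IsRegular)
    (hμ : D.ChargesNoPolarSet μ)
    [IsFiniteMeasure μ] (hu : u ∈ D.domain) {k : ℝ}
    (h : ∀ᵐ x ∂m, |u x| ≤ k) : u ∈ (D.snappingOut μ).domain := by
  obtain ⟨h1, h2⟩ := hD.qcVersion_spec hreg hu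
  have h3 : ∀ᵐ x ∂μ, |D.qcVersion (u : E →ₘ[m] ℝ) x| ≤ k :=
    hD.ae_le_of_ae_le hμ (h1.comp continuous_abs)
      (hD.quasiContinuous_of_continuous continuous_const) (by
        filter_upwards [h, h2] with x e1 e2
        rwa [e2])
  refine (hD.mem_snappingOut_iff hreg hμ).2 ⟨hu, ?_⟩
  refine MemLp.of_bound (hD.aestronglyMeasurable_jump hreg hμ hu) (2 * k) ?_
  filter_upwards [ae_prod_fst_snd h3] with z hz
  exact (abs_sub _ _).trans (by linarith [hz.1, hz.2])

/-- The approximants from regularity have bounded versions, and a bounded function has square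
integrable jumps since `μ` is finite. -/
lemma exists_mem_snappingOut_order_lt (hD : D.IsDirichletForm) (hreg : D.IsRegular)
    (hμ : D.ChargesNoPolarSet μ)
    [IsFiniteMeasure μ] (hu : u ∈ D.domain) {ε : ℝ}
    (hε : 0 < ε) : ∃ v ∈ (D.snappingOut μ).domain, D.order 1 (u - v) (u - v) < ε := by
  obtain ⟨v, hv, ⟨f, hf, hfc, hvf⟩, hlt⟩ := hreg.1 u hu ε hε
  obtain ⟨k, hk⟩ := hfc.exists_bound_of_continuous hf
  refine ⟨v, hD.mem_snappingOut_of_bounded hreg hμ hv (k := k) ?_, hlt⟩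
  filter_upwards [hvf] with x hx
  rw [hx]
  exact hk x

lemma snappingOut_add_mem (hD : D.IsDirichletForm) (hreg : D.IsRegular) (hμ : D.ChargesNoPolarSet μ)
    (hu : u ∈ (D.snappingOut μ).domain)
    (hv : v ∈ (D.snappingOut μ).domain) : u + v ∈ (D.snappingOut μ).domain := by
  rw [hD.mem_snappingOut_iff hreg hμ] at hu hv ⊢
  exact ⟨hD.add_mem _ hu.1 _ hv.1, (memLp_congr_ae (hD.ae_jump_add hreg hμ hu.1 hv.1)).2
    (hu.2.add hv.2)⟩

lemma snappingOut_smul_mem (hD : D.IsDirichletForm) (hreg : D.IsRegular)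
    (hμ : D.ChargesNoPolarSet μ)
    (c : ℝ) (hu : u ∈ (D.snappingOut μ).domain) :
    c • u ∈ (D.snappingOut μ).domain := by
  rw [hD.mem_snappingOut_iff hreg hμ] at hu ⊢
  exact ⟨hD.smul_mem _ _ hu.1, (memLp_congr_ae (hD.ae_jump_smul hreg hμ c hu.1)).2
    (hu.2.const_mul c)⟩

lemma snappingOut_sub_mem (hD : D.IsDirichletForm) (hreg : D.IsRegular) (hμ : D.ChargesNoPolarSet μ)
    (hu : u ∈ (D.snappingOut μ).domain)
    (hv : v ∈ (D.snappingOut μ).domain) : u - v ∈ (D.snappingOut μ).domain := by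
  have h := hD.snappingOut_add_mem hreg hμ hu (hD.snappingOut_smul_mem hreg hμ (-1) hv)
  rwa [neg_one_smul, ← sub_eq_add_neg] at h

/-- Fatou's lemma along a subsequence converging quasi-everywhere. The difference with a fixed `u`
is built in because closedness needs it with `u = c n`. -/
lemma jumpEnergy_le_of_tendsto (hD : D.IsDirichletForm) (hreg : D.IsRegular)
    (hμ : D.ChargesNoPolarSet μ)
    {c : ℕ → Lp ℝ 2 m} (hc : ∀ n, c n ∈ D.domain)
    (hw : w ∈ D.domain) (h : Tendsto (fun n => D.order 1 (c n - w) (c n - w)) atTop (𝓝 0))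
    (hu : u ∈ D.domain) {M : ℝ≥0∞}
    (hM : ∀ᶠ n in atTop, D.jumpEnergy μ ((u - c n : Lp ℝ 2 m) : E →ₘ[m] ℝ) ≤ M) :
    D.jumpEnergy μ ((u - w : Lp ℝ 2 m) : E →ₘ[m] ℝ) ≤ M := by
  obtain ⟨N, hN⟩ := eventually_atTop.1 hM
  have hc' : ∀ n, u - c (n + N) ∈ D.domain := fun n => hD.sub_mem hu (hc _)
  have hlim : Tendsto (fun n => D.order 1 (u - c (n + N) - (u - w)) (u - c (n + N) - (u - w)))
      atTop (𝓝 0) := by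
    refine (h.comp (tendsto_add_atTop_nat N)).congr fun n => ?_
    rw [sub_sub_sub_cancel_left]
    exact (hD.shift zero_le_one).energy_sub_comm (hc _) hw
  obtain ⟨ns, -, g, hg, hgw, hcap⟩ := hD.exists_quasiContinuous_of_tendsto hc'
    (fun n => (hD.qcVersion_spec hreg (hc' n)).1) (fun n => (hD.qcVersion_spec hreg (hc' n)).2)
    (hD.sub_mem hu hw) hlim
  rw [hD.jumpEnergy_eq hμ hg hgw]
  exact jumpIntegral_le_of_tendsto
    (fun n => hμ.aemeasurable (hD.qcVersion_spec hreg (hc' (ns n))).1)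
    (fun n => hN _ (Nat.le_add_left _ _)) (hμ.ae_of_cap_eq_zero hcap)

/-- The snapping-out form is a Dirichlet form. -/
lemma snappingOut (hD : D.IsDirichletForm) (hreg : D.IsRegular) (hμ : D.ChargesNoPolarSet μ)
    [IsFiniteMeasure μ] (hμ0 : μ ≠ 0) : (D.snappingOut μ).IsDirichletForm := by
  have hC : 0 < 1 / (2 * μ.real Set.univ) := by
    have : NeZero μ := ⟨hμ0⟩
    have := measureReal_univ_pos (μ := μ)
    positivity
  have hzero : (0 : Lp ℝ 2 m) ∈ (D.snappingOut μ).domain := by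
    refine hD.mem_snappingOut_of_bounded hreg hμ hD.zero_mem (k := 0) ?_
    filter_upwards [Lp.coeFn_zero ℝ 2 m] with x hx
    rw [hx, Pi.zero_apply, abs_zero]
  have hsub := fun {u v : Lp ℝ 2 m} (hu : u ∈ (D.snappingOut μ).domain)
    (hv : v ∈ (D.snappingOut μ).domain) => hD.snappingOut_sub_mem hreg hμ hu hv
  refine ⟨hzero, fun u hu v hv => hD.snappingOut_add_mem hreg hμ hu hv,
    fun c u hu => hD.snappingOut_smul_mem hreg hμ c hu, ?_, ?_, ?_, ?_, ?_, ?_, ?_⟩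
  · refine hD.dense.mono (s₂ := closure (D.snappingOut μ).domain) (fun u hu => ?_) |>.of_closure
    rw [Metric.mem_closure_iff]
    intro ε hε
    obtain ⟨v, hv, hlt⟩ := hD.exists_mem_snappingOut_order_lt hreg hμ hu
      (show 0 < ε ^ 2 by positivity)
    refine ⟨v, hv, ?_⟩
    rw [dist_eq_norm]
    exact lt_of_pow_lt_pow_left₀ 2 hε.le
      ((hD.norm_sq_le_order (hD.sub_mem hu hv.1)).trans_lt hlt)
  · intro u hu v hv w hw
    rw [snappingOut_toFun, snappingOut_toFun, snappingOut_toFun,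
      hD.add_left _ hu.1 _ hv.1 _ hw.1]
    have h1 : ∫ z, D.jump (u + v) z * D.jump w z ∂(μ.prod μ) =
        (∫ z, D.jump u z * D.jump w z ∂(μ.prod μ)) + ∫ z, D.jump v z * D.jump w z ∂(μ.prod μ) := by
      rw [← integral_add (hD.integrable_jump_mul hreg hμ hu hw)
        (hD.integrable_jump_mul hreg hμ hv hw)]
      refine integral_congr_ae ?_
      filter_upwards [hD.ae_jump_add hreg hμ hu.1 hv.1] with z hz
      rw [hz, add_mul]
    rw [h1]
    ring
  · intro c u hu v hv
    rw [snappingOut_toFun, snappingOut_toFun, hD.smul_left _ _ hu.1 _ hv.1]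
    have h1 : ∫ z, D.jump (c • u) z * D.jump v z ∂(μ.prod μ) =
        c * ∫ z, D.jump u z * D.jump v z ∂(μ.prod μ) := by
      rw [← integral_const_mul]
      refine integral_congr_ae ?_
      filter_upwards [hD.ae_jump_smul hreg hμ c hu.1] with z hz
      rw [hz, mul_assoc]
    rw [h1]
    ring
  · intro u hu v hv
    rw [snappingOut_toFun, snappingOut_toFun, hD.symm _ hu.1 _ hv.1]
    simp only [mul_comm]
  · intro u hu
    exact (hD.energy_nonneg hu.1).trans (hD.energy_le_energy_snappingOut hreg hμ hu)
  · intro c hc hcau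
    have key : ∀ u ∈ (D.snappingOut μ).domain, (D.snappingOut μ).order 1 u u = D.order 1 u u +
        1 / (2 * μ.real Set.univ) * (D.jumpEnergy μ (u : E →ₘ[m] ℝ)).toReal := fun u hu => by
      rw [order_self, order_self, hD.energy_snappingOut hreg hμ hu]
      ring
    obtain ⟨v, hv, hlim⟩ := hD.closed c (fun n => (hc n).1) fun ε hε => by
      obtain ⟨N, hN⟩ := hcau ε hε
      refine ⟨N, fun n hn k hk => lt_of_le_of_lt ?_ (hN n hn k hk)⟩
      rw [key _ (hsub (hc n) (hc k))]
      exact le_add_of_nonneg_right (by positivity)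
    -- The Cauchy property bounds the jump energy of `c n - c k` for large `k`; let `k → ∞` by
    -- `jumpEnergy_le_of_tendsto`.
    have hJ : ∀ ε > 0, ∃ N, ∀ n ≥ N,
        D.jumpEnergy μ ((c n - v : Lp ℝ 2 m) : E →ₘ[m] ℝ) ≤ ENNReal.ofReal ε := fun ε hε => by
      obtain ⟨N, hN⟩ := hcau (1 / (2 * μ.real Set.univ) * ε) (by positivity)
      refine ⟨N, fun n hn => hD.jumpEnergy_le_of_tendsto hreg hμ (fun n => (hc n).1) hv hlim
        (hc n).1 ?_⟩
      filter_upwards [eventually_ge_atTop N] with k hk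
      have h1 := hN n hn k hk
      have h2 := hsub (hc n) (hc k)
      rw [key _ h2] at h1
      have h3 := (hD.shift zero_le_one).energy_nonneg (u := c n - c k) h2.1
      have h4 : 1 / (2 * μ.real Set.univ) *
          (D.jumpEnergy μ ((c n - c k : Lp ℝ 2 m) : E →ₘ[m] ℝ)).toReal <
          1 / (2 * μ.real Set.univ) * ε := by
        change 0 ≤ D.order 1 _ _ at h3
        linarith
      rw [ENNReal.le_ofReal_iff_toReal_le h2.2.ne hε.le]
      exact (lt_of_mul_lt_mul_left h4 hC.le).le
    have hcv : ∃ N, ∀ n ≥ N, c n - v ∈ (D.snappingOut μ).domain := by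
      obtain ⟨N, hN⟩ := hJ 1 one_pos
      exact ⟨N, fun n hn => ⟨hD.sub_mem (hc n).1 hv, (hN n hn).trans_lt ENNReal.ofReal_lt_top⟩⟩
    obtain ⟨N₀, hN₀⟩ := hcv
    -- Finiteness of the jump energy of `v` comes from `v = c N₀ - (c N₀ - v)`.
    have hvs : v ∈ (D.snappingOut μ).domain := by
      have := hsub (hc N₀) (hN₀ N₀ le_rfl)
      rwa [sub_sub_cancel] at this
    refine ⟨v, hvs, ?_⟩
    have hcvs := fun n => hsub (hc n) hvs
    simp only [key _ (hcvs _)]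
    have hJ0 : Tendsto (fun n => (D.jumpEnergy μ ((c n - v : Lp ℝ 2 m) : E →ₘ[m] ℝ)).toReal)
        atTop (𝓝 0) := by
      rw [Metric.tendsto_atTop]
      intro ε hε
      obtain ⟨N, hN⟩ := hJ (ε / 2) (by positivity)
      refine ⟨N, fun n hn => ?_⟩
      rw [Real.dist_eq, sub_zero, abs_of_nonneg ENNReal.toReal_nonneg]
      exact (ENNReal.toReal_le_of_le_ofReal (by positivity) (hN n hn)).trans_lt (by linarith)
    simpa using hlim.add (hJ0.const_mul (1 / (2 * μ.real Set.univ)))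
  · intro u hu v hvu
    obtain ⟨hv, hvE⟩ := hD.markov u hu.1 v hvu
    obtain ⟨h1, h2⟩ := hD.qcVersion_spec hreg hu.1
    have hJ : D.jumpEnergy μ (v : E →ₘ[m] ℝ) ≤ D.jumpEnergy μ (u : E →ₘ[m] ℝ) := by
      rw [hD.jumpEnergy_eq hμ (u := (v : E →ₘ[m] ℝ)) (h1.comp (φ := fun a => max 0 (min a 1))
        (by fun_prop)) (by
          filter_upwards [hvu, h2] with x e1 e2
          rw [e1, e2])]
      exact jumpIntegral_comp_le ((LipschitzWith.id.min_const 1).const_max 0)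
    have hvs : v ∈ (D.snappingOut μ).domain := ⟨hv, hJ.trans_lt hu.2⟩
    refine ⟨hvs, ?_⟩
    change (D.snappingOut μ).energy v ≤ (D.snappingOut μ).energy u
    rw [hD.energy_snappingOut hreg hμ hu, hD.energy_snappingOut hreg hμ hvs]
    exact add_le_add hvE (mul_le_mul_of_nonneg_left (ENNReal.toReal_mono hu.2.ne hJ) hC.le)

end IsDirichletForm

end L2Form

/-! ### Extended space, recurrence and invariant sets of the snapping-out form -/

namespace L2Form

variable {E : Type*} [TopologicalSpace E] [MeasurableSpace E] {m : Measure E} {D : L2Form m}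

namespace IsDirichletForm

variable {μ : Measure E}
variable [BorelSpace E]

lemma jumpEnergy_convexHull_le (hD : D.IsDirichletForm) (hreg : D.IsRegular)
    (hμ : D.ChargesNoPolarSet μ)
    {y : ℕ → Lp ℝ 2 m} (hy : ∀ n, y n ∈ D.domain) {K : ℝ≥0∞}
    (hK : ∀ n, D.jumpEnergy μ (y n : E →ₘ[m] ℝ) ≤ K) {N : ℕ} {c : Lp ℝ 2 m}
    (hc : c ∈ convexHull ℝ (y '' Set.Ici N)) : D.jumpEnergy μ (c : E →ₘ[m] ℝ) ≤ K := by
  have hconv : Convex ℝ {c : Lp ℝ 2 m | c ∈ D.domain ∧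
      D.jumpEnergy μ (c : E →ₘ[m] ℝ) ≤ K} := by
    rintro c₁ ⟨h₁, hK₁⟩ c₂ ⟨h₂, hK₂⟩ a b ha hb hab
    refine ⟨hD.add_mem _ (hD.smul_mem _ _ h₁) _ (hD.smul_mem _ _ h₂), ?_⟩
    obtain ⟨e1, e2⟩ := hD.qcVersion_spec hreg h₁
    obtain ⟨e3, e4⟩ := hD.qcVersion_spec hreg h₂
    rw [hD.jumpEnergy_eq hμ (hD.quasiContinuous_comp₂ e1 e3 (φ := fun p => a * p.1 + b * p.2)
      (by fun_prop)) (by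
        filter_upwards [e2, e4, Lp.coeFn_add (a • c₁) (b • c₂), Lp.coeFn_smul a c₁,
          Lp.coeFn_smul b c₂] with x h1 h2 h3 h4 h5
        rw [h1, h2, h3, Pi.add_apply, h4, h5]
        rfl)]
    exact jumpIntegral_convex_comb_le (hμ.aemeasurable e1) ha hb hab hK₁ hK₂
  refine (convexHull_min ?_ hconv hc).2
  rintro _ ⟨n, -, rfl⟩
  exact ⟨hy n, hK n⟩

variable [IsFiniteMeasure μ]

/-- Fatou's lemma is not directly available, since an approximating sequence converges only `m`-a.e.
After truncation, convex combinations are close to the limit in `L²(μ)` and keep the jump bound. -/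
lemma jumpEnergy_lt_top_of_mem_extendedSpace (hD : D.IsDirichletForm) (hreg : D.IsRegular)
    (hμ : D.ChargesNoPolarSet μ)
    [RegularSpace E] [LocallyCompactSpace E]
    [SigmaCompactSpace E] (hμ0 : μ ≠ 0) {u : E →ₘ[m] ℝ}
    (hu : u ∈ (D.snappingOut μ).extendedSpace) (hu' : u ∈ D.extendedSpace) :
    D.jumpEnergy μ u < ∞ := by
  have hS := hD.snappingOut hreg hμ hμ0
  have hC : 0 < 1 / (2 * μ.real Set.univ) := by
    have : NeZero μ := ⟨hμ0⟩
    have := measureReal_univ_pos (μ := μ)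
    positivity
  obtain ⟨w, M, hw, hwM, hlim⟩ := hS.exists_bounded_of_mem_extendedSpace hu
  obtain ⟨hf, hfu⟩ := L2Form.qcVersion_spec
    (hD.exists_quasiContinuous_of_mem_extendedSpace hreg hu')
  set f := D.qcVersion u
  have hwD : ∀ n, D.energy (w n) ≤ M := fun n =>
    (hD.energy_le_energy_snappingOut hreg hμ (hw n)).trans (hwM n)
  set K := ENNReal.ofReal (M / (1 / (2 * μ.real Set.univ))) with hKdef
  have hwK : ∀ n, D.jumpEnergy μ (w n : E →ₘ[m] ℝ) ≤ K := fun n => by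
    have h1 := hwM n
    rw [hD.energy_snappingOut hreg hμ (hw n)] at h1
    rw [← ENNReal.ofReal_toReal (hw n).2.ne]
    refine ENNReal.ofReal_le_ofReal ?_
    rw [le_div_iff₀ hC]
    linarith [hD.energy_nonneg (hw n).1]
  -- The `L²(μ)`-error need not be small: error `1` already gives a bound independent of `k`, and
  -- Fatou's lemma in `k` concludes.
  have hfk : ∀ k : ℕ, jumpIntegral μ (fun x => max (-(k : ℝ)) (min (f x) k)) ≤
      2 * K + 8 * μ Set.univ * 1 := fun k => by
    have hk : (0 : ℝ) ≤ k := Nat.cast_nonneg k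
    choose y hy hyw hyE using fun n => hD.exists_clamp_const (hw n).1 hk
    have hcont : Continuous fun a : ℝ => max (-(k : ℝ)) (min a k) := by fun_prop
    have hfq := hf.comp hcont
    obtain ⟨z, hz, hzf⟩ := hD.exists_convexHull_lintegral_lt hμ hreg (w := y) hy
      (M := 4 * M) (fun n => (hyE n).trans (by linarith [hwD n])) hk
      (fun n => by
        filter_upwards [hyw n] with x hx
        rw [hx]
        exact abs_max_neg_min_le hk)
      (u := AEEqFun.comp _ hcont u) (by
        filter_upwards [ae_all_iff.2 hyw, hlim, AEEqFun.coeFn_comp _ hcont u] with x h1 h2 h3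
        simp only [h1, h3]
        exact (hcont.tendsto _).comp h2) hfq (by
        filter_upwards [hfu, AEEqFun.coeFn_comp _ hcont u] with x h1 h2
        rw [h2, h1]
        rfl) 0 (δ := 1) one_pos
    have hzd := (hD.convexHull_subset_energy_le hy
      (fun n => (hyE n).trans (by linarith [hwD n] : _ ≤ 4 * M)) hz).1
    have hzK : D.jumpEnergy μ (z : E →ₘ[m] ℝ) ≤ K := by
      refine hD.jumpEnergy_convexHull_le hreg hμ hy (fun n => ?_) hz
      refine le_trans ?_ (hwK n)
      obtain ⟨e1, e2⟩ := hD.qcVersion_spec hreg (hw n).1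
      rw [hD.jumpEnergy_eq hμ (u := (y n : E →ₘ[m] ℝ)) (e1.comp hcont) (by
        filter_upwards [e2, hyw n] with x h1 h2
        rw [h1, h2])]
      exact jumpIntegral_comp_le (lipschitzWith_max_neg_min k)
    obtain ⟨e1, e2⟩ := hD.qcVersion_spec hreg hzd
    refine (jumpIntegral_le_add (hμ.aemeasurable hfq) (hμ.aemeasurable e1)).trans ?_
    gcongr
    · exact hzK
    · refine le_trans (le_of_eq ?_) (hzf _ e1 e2).le
      refine lintegral_congr fun x => ?_
      rw [← neg_sub, neg_sq]
  refine lt_of_le_of_lt (jumpIntegral_le_of_tendsto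
    (fun k : ℕ => hμ.aemeasurable (hf.comp (φ := fun a => max (-(k : ℝ)) (min a k))
      (by fun_prop))) hfk (.of_forall fun x => ?_)) ?_
  · refine tendsto_const_nhds.congr' ?_
    filter_upwards [eventually_ge_atTop ⌈|f x|⌉₊] with k hk
    exact (max_neg_min_of_abs_le ((Nat.le_ceil _).trans (by exact_mod_cast hk))).symm
  · rw [mul_one]
    exact ENNReal.add_lt_top.2 ⟨ENNReal.mul_lt_top ENNReal.ofNat_lt_top ENNReal.ofReal_lt_top,
      ENNReal.mul_lt_top ENNReal.ofNat_lt_top (measure_lt_top _ _)⟩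

lemma mem_extendedSpace_snappingOut (hD : D.IsDirichletForm) (hreg : D.IsRegular)
    (hμ : D.ChargesNoPolarSet μ)
    [RegularSpace E] [LocallyCompactSpace E]
    [SigmaCompactSpace E] (hμ0 : μ ≠ 0) {u : E →ₘ[m] ℝ} (hu : u ∈ D.extendedSpace)
    (hJ : D.jumpEnergy μ u < ∞) : u ∈ (D.snappingOut μ).extendedSpace := by
  have hS := hD.snappingOut hreg hμ hμ0
  obtain ⟨w, M, hw, hwM, hlim⟩ := hD.exists_bounded_of_mem_extendedSpace hu
  obtain ⟨hf, hfu⟩ := L2Form.qcVersion_spec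
    (hD.exists_quasiContinuous_of_mem_extendedSpace hreg hu)
  set K : ℝ≥0∞ := 2 * D.jumpEnergy μ u + 8 * μ Set.univ * 1 with hK
  have hKtop : K ≠ ∞ := by
    rw [hK, mul_one]
    exact (ENNReal.add_lt_top.2 ⟨ENNReal.mul_lt_top ENNReal.ofNat_lt_top hJ,
      ENNReal.mul_lt_top ENNReal.ofNat_lt_top (measure_lt_top _ _)⟩).ne
  have hk : ∀ k : ℕ, (0 : ℝ) ≤ k := fun k => Nat.cast_nonneg k
  choose y hy hyw hyE using fun (k : ℕ) (n : ℕ) => hD.exists_clamp_const (hw n) (hk k)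
  have hyM : ∀ k n, D.energy (y k n) ≤ 4 * M := fun k n =>
    (hyE k n).trans (by linarith [hwM n])
  -- Diagonal choice: the level `k` is coupled with the tail from `k`, so that level and index go to
  -- infinity together.
  have hex : ∀ k : ℕ, ∃ z ∈ convexHull ℝ (y k '' Set.Ici k),
      D.jumpEnergy μ (z : E →ₘ[m] ℝ) ≤ K := fun k => by
    have hcont : Continuous fun a : ℝ => max (-(k : ℝ)) (min a k) := by fun_prop
    have hfq := hf.comp hcont
    obtain ⟨z, hz, hzf⟩ := hD.exists_convexHull_lintegral_lt hμ hreg (w := y k) (hy k)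
      (hyM k) (hk k)
      (fun n => by
        filter_upwards [hyw k n] with x hx
        rw [hx]
        exact abs_max_neg_min_le (hk k))
      (u := AEEqFun.comp _ hcont u) (by
        filter_upwards [ae_all_iff.2 (hyw k), hlim, AEEqFun.coeFn_comp _ hcont u] with x h1 h2 h3
        simp only [h1, h3]
        exact (hcont.tendsto _).comp h2) hfq (by
        filter_upwards [hfu, AEEqFun.coeFn_comp _ hcont u] with x h1 h2
        rw [h2, h1]
        rfl) k (δ := 1) one_pos
    obtain ⟨e1, e2⟩ := hD.qcVersion_spec hreg
      (hD.convexHull_subset_energy_le (hy k) (hyM k) hz).1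
    refine ⟨z, hz, (jumpIntegral_le_add (hμ.aemeasurable e1) (hμ.aemeasurable hfq)).trans ?_⟩
    rw [hK]
    gcongr
    · exact jumpIntegral_comp_le (lipschitzWith_max_neg_min k)
    · exact (hzf _ e1 e2).le
  choose z hz hzK using hex
  have hzd := fun k => hD.convexHull_subset_energy_le (hy k) (hyM k) (hz k)
  have hzS : ∀ k, z k ∈ (D.snappingOut μ).domain := fun k =>
    ⟨(hzd k).1, (hzK k).trans_lt hKtop.lt_top⟩
  refine hS.mem_extendedSpace_of_energy_le hzS
    (M := 4 * M + 1 / (2 * μ.real Set.univ) * K.toReal) (fun k => ?_) ?_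
  · rw [hD.energy_snappingOut hreg hμ (hzS k)]
    exact add_le_add (hzd k).2 (mul_le_mul_of_nonneg_left
      (ENNReal.toReal_mono hKtop (hzK k)) (by positivity))
  · filter_upwards [hlim, ae_all_iff.2 fun k => ae_all_iff.2 (hyw k),
      ae_all_iff.2 fun k => Lp.ae_mem_convexHull (hz k)] with x h1 h2 h3
    -- Once `k ≥ |u x|`, clamping fixes `u x` and is `1`-Lipschitz, so every member of the tail of
    -- the `k`-th row, and hence `z k x`, is as close to `u x` as the original sequence.
    rw [Metric.tendsto_atTop] at h1 ⊢
    intro ε hε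
    obtain ⟨N, hN⟩ := h1 ε hε
    refine ⟨max N ⌈|u x|⌉₊, fun k hkN => ?_⟩
    refine convexHull_min ?_ (convex_ball (u x) ε) (h3 k)
    rintro _ ⟨n, hn, rfl⟩
    have h4 : |u x| ≤ k := (Nat.le_ceil _).trans
      (by exact_mod_cast (le_max_right _ _).trans hkN)
    have h5 := (lipschitzWith_max_neg_min (k : ℝ)).dist_le_mul (w n x) (u x)
    rw [max_neg_min_of_abs_le h4, NNReal.coe_one, one_mul] at h5
    rw [Metric.mem_ball]
    beta_reduce
    rw [h2]
    exact h5.trans_lt (hN n ((le_max_left _ _).trans (hkN.trans hn)))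

lemma extendedSpace_snappingOut (hD : D.IsDirichletForm) (hreg : D.IsRegular)
    (hμ : D.ChargesNoPolarSet μ)
    [RegularSpace E] [LocallyCompactSpace E]
    [SigmaCompactSpace E] (hμ0 : μ ≠ 0) :
    (D.snappingOut μ).extendedSpace = {u | u ∈ D.extendedSpace ∧ D.jumpEnergy μ u < ∞} := by
  have hS := hD.snappingOut hreg hμ hμ0
  ext u
  refine ⟨fun hu => ?_, fun hu => hD.mem_extendedSpace_snappingOut hreg hμ hμ0 hu.1 hu.2⟩
  have hu' : u ∈ D.extendedSpace := by
    obtain ⟨w, hw, hcau, hlim⟩ := hu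
    refine ⟨w, fun n => (hw n).1, fun ε hε => ?_, hlim⟩
    obtain ⟨N, hN⟩ := hcau ε hε
    exact ⟨N, fun n hn k hk => (hD.energy_le_energy_snappingOut hreg hμ
      (hS.sub_mem (hw n) (hw k))).trans_lt (hN n hn k hk)⟩
  exact ⟨hu', hD.jumpEnergy_lt_top_of_mem_extendedSpace hreg hμ hμ0 hu hu'⟩

lemma approximatesOne_snappingOut_iff (hD : D.IsDirichletForm) (hreg : D.IsRegular)
    (hμ : D.ChargesNoPolarSet μ)
    [RegularSpace E] [LocallyCompactSpace E]
    [SigmaCompactSpace E] (hμ0 : μ ≠ 0) :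
    (D.snappingOut μ).ApproximatesOne ↔ D.ApproximatesOne := by
  have : NeZero μ := ⟨hμ0⟩
  have hμpos := measureReal_univ_pos (μ := μ)
  refine ⟨fun h ε hε => ?_, fun h ε hε => ?_⟩
  · obtain ⟨w, hw, hlim⟩ := h ε hε
    exact ⟨w, fun n => ⟨(hw n).1.1,
      (hD.energy_le_energy_snappingOut hreg hμ (hw n).1).trans (hw n).2⟩, hlim⟩
  · obtain ⟨w, hw, hlim⟩ := h (ε / 2) (by positivity)
    choose y hy hyw hyE using fun n => hD.exists_trunc (hw n).1 zero_le_one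
    have hyM : ∀ n, D.energy (y n) ≤ ε / 2 := fun n => (hyE n).trans (hw n).2
    have hylim : ∀ᵐ x ∂m, Tendsto (fun n => y n x) atTop (𝓝 1) := by
      filter_upwards [hlim, ae_all_iff.2 hyw] with x h1 h2
      simp only [h2]
      simpa using (tendsto_const_nhds (x := (0 : ℝ))).max
        (h1.min (tendsto_const_nhds (x := (1 : ℝ))))
    have hone : ∀ᵐ x ∂m, (AEEqFun.const E (1 : ℝ) : E →ₘ[m] ℝ) x = 1 := AEEqFun.coeFn_const E 1
    have hq1 : D.QuasiContinuous fun _ => (1 : ℝ) :=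
      hD.quasiContinuous_of_continuous continuous_const
    -- Squared `L²(μ)`-distance to `1` below `ε / 8` gives jump energy at most `μ(E) ε`, that is a
    -- contribution of at most `ε / 2` after division by `2 μ(E)`; the energy takes the other half.
    choose z hz hzf using fun N => hD.exists_convexHull_lintegral_lt hμ hreg (w := y) hy hyM
      (k := 1) zero_le_one (fun n => by
        filter_upwards [hyw n] with x hx
        rw [hx, abs_of_nonneg (le_max_left _ _)]
        exact max_le zero_le_one (min_le_right _ _))
      (u := AEEqFun.const E (1 : ℝ)) (by
        filter_upwards [hylim, hone] with x h1 h2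
        rwa [h2]) hq1 (hone.mono fun x hx => hx.symm) N
      (δ := ENNReal.ofReal (ε / 8)) (ENNReal.ofReal_pos.2 (by positivity))
    have hzd := fun N => hD.convexHull_subset_energy_le hy hyM (hz N)
    have hzJ : ∀ N, D.jumpEnergy μ (z N : E →ₘ[m] ℝ) ≤
        ENNReal.ofReal (μ.real Set.univ * ε) := fun N => by
      obtain ⟨e1, e2⟩ := hD.qcVersion_spec hreg (hzd N).1
      refine (jumpIntegral_le_add (hμ.aemeasurable e1) (hμ.aemeasurable hq1)).trans ?_
      have h0 : jumpIntegral μ (fun _ => (1 : ℝ)) = 0 := by simp [jumpIntegral]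
      rw [h0, mul_zero, zero_add]
      calc 8 * μ Set.univ * ∫⁻ x, ENNReal.ofReal
            ((D.qcVersion (z N : E →ₘ[m] ℝ) x - 1) ^ 2) ∂μ
          ≤ 8 * μ Set.univ * ENNReal.ofReal (ε / 8) := by
            gcongr
            exact (hzf N _ e1 e2).le
        _ = ENNReal.ofReal (μ.real Set.univ * ε) := by
            rw [← ofReal_measureReal (measure_ne_top μ _),
              show (8 : ℝ≥0∞) = ENNReal.ofReal 8 by norm_num,
              ← ENNReal.ofReal_mul (by norm_num), ← ENNReal.ofReal_mul (by positivity)]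
            congr 1
            ring
    have hzS : ∀ N, z N ∈ (D.snappingOut μ).domain := fun N =>
      ⟨(hzd N).1, (hzJ N).trans_lt ENNReal.ofReal_lt_top⟩
    refine ⟨z, fun N => ⟨hzS N, ?_⟩, Lp.ae_tendsto_of_mem_convexHull hz hylim⟩
    rw [hD.energy_snappingOut hreg hμ (hzS N)]
    have h1 := ENNReal.toReal_le_of_le_ofReal (by positivity) (hzJ N)
    calc _ ≤ ε / 2 + 1 / (2 * μ.real Set.univ) * (μ.real Set.univ * ε) := by
          gcongr
          exact (hzd N).2
      _ = ε := by field_simp; norm_num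

/-- Every invariant set of the snapping-out form is invariant for the original form. -/
lemma isInvariant_of_snappingOut (hD : D.IsDirichletForm) (hreg : D.IsRegular)
    (hμ : D.ChargesNoPolarSet μ)
    (hμ0 : μ ≠ 0) {A : Set E} (hA : MeasurableSet A)
    (hinv : (D.snappingOut μ).IsInvariant A) : D.IsInvariant A := by
  have hS := hD.snappingOut hreg hμ hμ0
  have hind := fun u (hu : u ∈ (D.snappingOut μ).domain) (v : Lp ℝ 2 m)
    (hv : ∀ᵐ x ∂m, v x = A.indicator u x) => hS.indicator_mem_of_isInvariant hinv hu hv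
  -- The cross term of `𝓔ˢ` vanishes and is the sum of two nonpositive terms. For the jump part, the
  -- product of the versions is zero `μ`-a.e., so the integrand is `-a(x) b(y) - a(y) b(x)`.
  have hneg : ∀ a ∈ (D.snappingOut μ).domain, ∀ b ∈ (D.snappingOut μ).domain,
      (∀ᵐ x ∂m, 0 ≤ a x) → (∀ᵐ x ∂m, 0 ≤ b x) → (∀ᵐ x ∂m, x ∉ A → a x = 0) →
      (∀ᵐ x ∂m, x ∈ A → b x = 0) → D.toFun a b = 0 := by
    intro a ha b hb ha0 hb0 haA hbA
    have h1 := hS.toFun_eq_zero_of_indicator_mem hind ha hb haA hbA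
    have hab : ∀ᵐ x ∂m, a x * b x = 0 := by
      filter_upwards [haA, hbA] with x h1 h2
      by_cases hx : x ∈ A
      · rw [h2 hx, mul_zero]
      · rw [h1 hx, zero_mul]
    have h2 := hD.toFun_nonpos_of_mul_eq_zero ha.1 hb.1 ha0 hb0 hab
    rw [snappingOut_toFun] at h1
    obtain ⟨e1, e2⟩ := hD.qcVersion_spec hreg ha.1
    obtain ⟨e3, e4⟩ := hD.qcVersion_spec hreg hb.1
    have hq0 : D.QuasiContinuous fun _ => (0 : ℝ) :=
      hD.quasiContinuous_of_continuous continuous_const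
    have f1 := hD.ae_le_of_ae_le hμ hq0 e1 (by
      filter_upwards [e2, ha0] with x h1 h2
      rwa [h1])
    have f2 := hD.ae_le_of_ae_le hμ hq0 e3 (by
      filter_upwards [e4, hb0] with x h1 h2
      rwa [h1])
    have f3 := hD.ae_eq_of_ae_eq hμ (hD.quasiContinuous_comp₂ e1 e3
      (φ := fun p => p.1 * p.2) (by fun_prop)) hq0 (by
        filter_upwards [e2, e4, hab] with x h1 h2 h3
        rw [h1, h2, h3])
    have h3 : ∫ z, D.jump a z * D.jump b z ∂(μ.prod μ) ≤ 0 := by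
      refine integral_nonpos_of_ae ?_
      filter_upwards [ae_prod_fst_snd f1, ae_prod_fst_snd f2, ae_prod_fst_snd f3] with z g1 g2 g3
      simp only [jump, Pi.zero_apply]
      have := mul_nonneg g1.1 g2.2
      have := mul_nonneg g1.2 g2.1
      have := g3.1
      have := g3.2
      nlinarith
    have h4 : 1 / (2 * μ.real Set.univ) * ∫ z, D.jump a z * D.jump b z ∂(μ.prod μ) ≤ 0 :=
      mul_nonpos_of_nonneg_of_nonpos (by positivity) h3
    linarith
  -- Splitting `u` into its positive and negative parts reduces the orthogonality of `1_A u` and `u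
  -- - 1_A u` to the nonnegative case.
  have hle : ∀ u ∈ (D.snappingOut μ).domain, ∀ a : Lp ℝ 2 m,
      (∀ᵐ x ∂m, a x = A.indicator u x) → a ∈ D.domain ∧ D.energy a ≤ D.energy u := by
    intro u hu a ha
    have hp := (hS.posPart_mem hu).1
    have hn := (hS.posPart_mem (hS.neg_mem hu)).1
    obtain ⟨ap, hap⟩ := Lp.exists_indicator_ae_eq (u ⊔ 0) hA
    obtain ⟨an, han⟩ := Lp.exists_indicator_ae_eq (-u ⊔ 0) hA
    have hapd := (hind _ hp ap hap).1
    have hand := (hind _ hn an han).1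
    have hbpd := hS.sub_mem hp hapd
    have hbnd := hS.sub_mem hn hand
    have hpn : ∀ᵐ x ∂m, (u ⊔ 0) x = max (u x) 0 ∧ (-u ⊔ 0) x = max (-u x) 0 := by
      filter_upwards [Lp.coeFn_sup u 0, Lp.coeFn_sup (-u) 0, Lp.coeFn_neg u,
        Lp.coeFn_zero ℝ 2 m] with x h1 h2 h3 h4
      rw [h1, h2, Pi.sup_apply, Pi.sup_apply, h3, h4]
      exact ⟨rfl, rfl⟩
    have hp0 : ∀ᵐ x ∂m, 0 ≤ (u ⊔ 0) x := hpn.mono fun x h => by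
      rw [h.1]; exact le_max_right _ _
    have hn0 : ∀ᵐ x ∂m, 0 ≤ (-u ⊔ 0) x := hpn.mono fun x h => by
      rw [h.2]; exact le_max_right _ _
    have hAnn : ∀ {w c : Lp ℝ 2 m}, (∀ᵐ x ∂m, 0 ≤ w x) → (∀ᵐ x ∂m, c x = A.indicator w x) →
        (∀ᵐ x ∂m, 0 ≤ c x) ∧ (∀ᵐ x ∂m, x ∉ A → c x = 0) ∧ (∀ᵐ x ∂m, 0 ≤ (w - c) x) ∧
          ∀ᵐ x ∂m, x ∈ A → (w - c) x = 0 := by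
      intro w c hw hc
      have hwc : ∀ᵐ x ∂m, (w - c) x = w x - c x := Lp.coeFn_sub w c
      refine ⟨?_, ?_, ?_, ?_⟩
      · filter_upwards [hw, hc] with x h1 h2
        rw [h2]
        exact Set.indicator_apply_nonneg fun _ => h1
      · filter_upwards [hc] with x h1 hx
        rw [h1, Set.indicator_of_notMem hx]
      · filter_upwards [hw, hc, hwc] with x h1 h2 h3
        rw [h3, h2]
        by_cases hx : x ∈ A <;> simp [hx, h1]
      · filter_upwards [hc, hwc] with x h2 h3 hx
        rw [h3, h2, Set.indicator_of_mem hx, sub_self]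
    obtain ⟨p1, p2, p3, p4⟩ := hAnn hp0 hap
    obtain ⟨n1, n2, n3, n4⟩ := hAnn hn0 han
    have hu_eq : u = (u ⊔ 0) - (-u ⊔ 0) := by
      apply Lp.ext
      filter_upwards [hpn, Lp.coeFn_sub (u ⊔ 0) (-u ⊔ 0)] with x h1 h3
      rw [h3, Pi.sub_apply, h1.1, h1.2]
      rcases le_total (u x) 0 with h | h
      · rw [max_eq_right h, max_eq_left (by linarith)]; ring
      · rw [max_eq_left h, max_eq_right (by linarith), sub_zero]
    have ha_eq : a = ap - an := by
      apply Lp.ext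
      filter_upwards [ha, hap, han, hpn, Lp.coeFn_sub ap an] with x h1 h2 h3 h4 h5
      rw [h5, Pi.sub_apply, h1, h2, h3]
      by_cases hx : x ∈ A
      · simp only [Set.indicator_of_mem hx]
        rw [h4.1, h4.2]
        rcases le_total (u x) 0 with h | h
        · rw [max_eq_right h, max_eq_left (by linarith)]; ring
        · rw [max_eq_left h, max_eq_right (by linarith), sub_zero]
      · simp [hx]
    have had : a ∈ D.domain := ha_eq ▸ hD.sub_mem hapd.1 hand.1
    have hb_eq : u - a = (u ⊔ 0 - ap) - (-u ⊔ 0 - an) := by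
      rw [ha_eq]
      conv_lhs => rw [hu_eq]
      abel
    have hzero : D.toFun a (u - a) = 0 := by
      rw [hb_eq, ha_eq, hD.sub_left hapd.1 hand.1 (hD.sub_mem hbpd.1 hbnd.1),
        hD.sub_right hapd.1 hbpd.1 hbnd.1, hD.sub_right hand.1 hbpd.1 hbnd.1,
        hneg _ hapd _ hbpd p1 p3 p2 p4, hneg _ hapd _ hbnd p1 n3 p2 n4,
        hneg _ hand _ hbpd n1 p3 n2 p4, hneg _ hand _ hbnd n1 n3 n2 n4]
      ring
    refine ⟨had, ?_⟩
    have hb := hD.sub_mem hu.1 had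
    have h1 := hD.energy_add had hb
    rw [add_sub_cancel, hzero] at h1
    linarith [hD.energy_nonneg hb]
  -- The bound is known on `𝓕ˢ` only; it extends to `𝓕` by `𝓔₁`-density and lower semicontinuity of
  -- the energy.
  refine hD.isInvariant_of_indicator_mem hA fun u hu v hv => ?_
  choose c hc hcu using fun n : ℕ => hD.exists_mem_snappingOut_order_lt hreg hμ hu
    (show (0 : ℝ) < 1 / ((n : ℝ) + 1) by positivity)
  choose a ha using fun n => Lp.exists_indicator_ae_eq (c n) hA
  have hlim : Tendsto (fun n => D.order 1 (c n - u) (c n - u)) atTop (𝓝 0) := by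
    refine squeeze_zero (fun n => (hD.shift zero_le_one).energy_nonneg (hD.sub_mem (hc n).1 hu))
      (fun n => ?_) tendsto_one_div_add_atTop_nhds_zero_nat
    refine le_trans (le_of_eq ?_) (hcu n).le
    exact (hD.shift zero_le_one).energy_sub_comm (hc n).1 hu
  have hE := hD.energy_tendsto_of_order (fun n => (hc n).1) hu hlim
  have hElim : Tendsto (fun n => D.energy (c n)) atTop (𝓝 (D.energy u)) := by
    have h1 := (hE.add ((hD.tendsto_toFun_left (fun n => (hc n).1) hu hu hE).const_mul 2)).sub_const
      (D.energy u)
    have h2 : 0 + 2 * D.toFun u u - D.energy u = D.energy u := by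
      unfold energy; ring
    rw [h2] at h1
    refine h1.congr fun n => ?_
    rw [hD.energy_sub (hc n).1 hu]
    ring
  have hav : Tendsto a atTop (𝓝 v) := by
    have h1 := hD.tendsto_Lp_of_order (fun n => (hc n).1) hu hlim
    rw [tendsto_iff_norm_sub_tendsto_zero] at h1 ⊢
    refine squeeze_zero (fun n => norm_nonneg _) (fun n => Lp.norm_le_norm_of_ae_le ?_) h1
    filter_upwards [ha n, hv, Lp.coeFn_sub (a n) v, Lp.coeFn_sub (c n) u] with x h1 h2 h3 h4
    rw [h3, h4, Pi.sub_apply, Pi.sub_apply, h1, h2]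
    by_cases hx : x ∈ A <;> simp [hx]
  -- The energies of `c n` converge to `𝓔(u)`, hence are eventually below `𝓔(u) + δ`; this bound
  -- passes to the `L²`-limit `v` of the restrictions to `A`.
  have key : ∀ δ > 0, v ∈ D.domain ∧ D.energy v ≤ D.energy u + δ := fun δ hδ => by
    obtain ⟨N, hN⟩ := eventually_atTop.1
      (hElim.eventually (gt_mem_nhds (lt_add_of_pos_right (D.energy u) hδ)))
    obtain ⟨h1, h2, -⟩ := hD.exists_convexHull_tendsto_of_tendsto (v := fun n => a (n + N))
      (fun n => (hle _ (hc _) _ (ha _)).1)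
      (fun n => (hle _ (hc _) _ (ha _)).2.trans (hN (n + N) (by omega)).le)
      (hav.comp (tendsto_add_atTop_nat N))
    exact ⟨h1, h2⟩
  exact ⟨(key 1 one_pos).1, le_of_forall_pos_le_add fun δ hδ => (key δ hδ).2⟩

end IsDirichletForm

end L2Form

end

/-! ### The proposition -/

theorem proposition3p8 {E : Type*} [MetricSpace E] [LocallyCompactSpace E]
    [SecondCountableTopology E] [MeasurableSpace E] [BorelSpace E]
    (m : Measure E) [IsFiniteMeasureOnCompacts m] [m.IsOpenPosMeasure]
    (D : L2Form m) (hD : D.IsDirichletForm) (hreg : D.IsRegular)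
    (μ : Measure E) [IsFiniteMeasure μ] (hμ0 : μ ≠ 0) (hμ : D.ChargesNoPolarSet μ) :
    (D.snappingOut μ).extendedSpace = {u | u ∈ D.extendedSpace ∧ D.jumpEnergy μ u < ∞} ∧
    (D.IsRecurrent ↔ (D.snappingOut μ).IsRecurrent) ∧
    (D.IsTransient → (D.snappingOut μ).IsTransient) ∧
    (D.IsIrreducible → (D.snappingOut μ).IsTransient → D.IsTransient) ∧
    (D.IsRecurrent ∨ D.IsLocal → D.IsIrreducible → (D.snappingOut μ).IsIrreducible) := by
  have hS := hD.snappingOut hreg hμ hμ0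
  -- Since `μ ≠ 0` the space is nonempty, so the fully supported `m` is nonzero; otherwise
  -- recurrence and transience would not exclude each other.
  have : Nonempty E := by
    by_contra h
    rw [not_nonempty_iff] at h
    exact hμ0 (Measure.eq_zero_of_isEmpty μ)
  have : NeZero m := ⟨fun h =>
    (isOpen_univ.measure_pos m Set.univ_nonempty).ne' (by rw [h]; simp)⟩
  refine ⟨hD.extendedSpace_snappingOut hreg hμ hμ0, ?_, ?_, ?_, ?_⟩
  · rw [hD.isRecurrent_iff_approximatesOne, hS.isRecurrent_iff_approximatesOne,
      hD.approximatesOne_snappingOut_iff hreg hμ hμ0]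
  · exact hD.isTransient_of_le hS (fun u hu => hu.1)
      fun u hu => hD.energy_le_energy_snappingOut hreg hμ hu
  · intro hirr htr
    -- In the recurrent alternative the snapping-out form would be recurrent too, contradicting its
    -- transience.
    refine (hD.isTransient_or_approximatesOne hirr).resolve_right fun h1 => ?_
    exact hS.not_isTransient_of_isRecurrent (hS.isRecurrent_of_approximatesOne
      ((hD.approximatesOne_snappingOut_iff hreg hμ hμ0).2 h1)) htr
  · intro _ hirr A hA hinv
    exact hirr A hA (hD.isInvariant_of_snappingOut hreg hμ hμ0 hA hinv)
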